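/- **Setting.** A polygonal curve in $\mathbb R^d$ of complexity $n\ge 2$ is a map $P:[0,1]\to\mathbb R^d$ that runs linearly, one after the other, through the $n-1$ edges $P_1,\dots,P_{n-1}$ between consecutive points of a sequence $p_1,\dots,p_n$. $P[s,t]$ is the subcurve from $s$ to $t$; its complexity is $2$ plus the number of vertices strictly in between. $\mathbb X^d_\ell$ is the set of polygonal curves of complexity at most $\ell$. The Fréchet distance is $d_{\mathcal F}(P,Q)=\inf_{f,g}\max_{t}\|P(f(t))-Q(g(t))\|$ over non-decreasing surjections $f,g:[0,1]\to[0,1]$, and for a set $\mathcal Q$ of curves $$\mathrm{Cov}_P(\mathcal Q,\Delta)=\bigcup_{Q\in\mathcal Q}\ \bigcup_{0\le s\le t\le 1,\ d_{\mathcal F}(P[s,t],Q)\le\Delta}[s,t].$$ Let $k_\Delta$ be the smallest size of a set $\mathcal C^*\subset\mathbb X^d_\ell$ with $\mathrm{Cov}_P(\mathcal C^*,\Delta)=[0,1]$. A polygonal curve $S$ is a *simplification* of $P$ if $d_{\mathcal F}(S,P)\le 2\Delta$ and for all $Q\in\mathbb X^d_\ell$ and $s\le t$ with $d_{\mathcal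 F}(Q,P[s,t])\le\Delta$ there is a subcurve $S[s',t']$ of complexity at most $\ell+2$ with $d_{\mathcal F}(P[s,t],S[s',t'])\le2\Delta$. **Free space.** For an edge $e:[0,1]\to\mathbb R^d$ of $S$ (parametrized linearly) let $A_e=\{(x,y)\in[0,1]^2:\|P(x)-e(y)\|\le4\Delta\}$. Its $i$-th cell is the part where $x$ belongs to the $i$-th edge of $P$. Let $l_i(y)$, $r_i(y)$ be the smallest and largest $x$ with $(x,y)$ in the $i$-th cell ($\infty$ if there is none). The extremal points of a cell are the endpoints of its sets of points of smallest $x$, largest $x$, smallest $y$ and largest $y$. For each edge $e$ of $S$ let $\mathcal E_e=\{\varepsilon_1<\varepsilon_2<\dots\}\subset[0,1]$ be a finite set that contains the $y$-coordinates of all extremal points of all cells of $A_e$. **Candidates.** $\mathcal C$ consists of (I) the subcurves of $S$ from its $i$-th to its $(i+2^m)$-th vertex, $0\le m\le\lfloor\log_2\ell\rfloor$, that have complexity at most $\ell$; (II) $e[0,\varepsilon_i]$, $e[\varepsilon_i,1]$ and their reversals; (III) $e[\varepsilon_i,\varepsilon_{i+2^m}]$, $0\le m\le\lfloor\log_2|\mathcal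 E_e|\rfloor$, and their reversals, for all edges $e$ of $S$. **Proxy $4\Delta$-coverage.** For candidates $c$ of type (I), $\widehat{\mathrm{Cov}}(c)=\mathrm{Cov}_P(\{c\},4\Delta)$. For a subedge $e[s,t]$, $s\le t$, consider the pairs $(i,j)$ for which some path in $A_e$, monotone in both coordinates, leads from a point at height $s$ with $x$ on the $i$-th edge of $P$ to a point at height $t$ with $x$ on the $j$-th edge. Let $\mathcal R$ be the set of the inclusion-maximal ones, where $(i,j)$ includes $(i',j')$ if $i\le i'$ and $j'\le j$. An index $i$ is *bad* if every topmost point of the $i$-th cell has $x\le l_i(s)$ and $x\le r_i(t)$, and every bottommost point has $x\ge l_i(s)$ and $x\ge r_i(t)$; otherwise it is good. Let $\widetilde{\mathcal G}$ result from $\{(i,j)\in\mathcal R: i<j\}$ by repeatedly merging pairs $(a,b),(c,d)$ into $(a,d)$ whenever $a<c<b<d$, or $b=c$ is good, and keeping the inclusion-maximal pairs. Put $\hat l_i=l_i(s)$, $\hat r_i=r_i(t)$ if $i$ is good, and $\hat l_i=r_i(s)$, $\hat r_i=l_i(t)$ if $i$ is bad. Then $$\widehat{\mathrm{Cov}}(e[s,t])=\bigcup_{(i,i)\in\mathcal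 R,\ i\text{ good}}[l_i(s),r_i(t)]\ \cup\bigcup_{(i,j)\in\widetilde{\mathcal G}}[\hat l_i,\hat r_j].$$ For a reversed subedge apply this to the reversed edge. The *atomic intervals* are the intervals into which $[0,1]$ is divided by all finite values $l_i(y)$ and $r_i(y)$, over all edges $e$ of $S$, all cells $i$ of $A_e$ and all $y\in\mathcal E_e$. **Theorem.** Let $P$ be a polygonal curve in $\mathbb R^d$, $\Delta>0$, $\ell\ge2$, $S$ a simplification of $P$, $\mathcal E_e$ as above, and $A\subset[0,1]$ finite. Consider any algorithm that starts with $R=\emptyset$ and, as long as $A\not\subset\bigcup_{r\in R}\widehat{\mathrm{Cov}}(r)$, adds to $R$ a candidate $c\in\mathcal C$ that maximizes $$\Big|\Big\{a\in A: a\in\widehat{\mathrm{Cov}}(c)\setminus\bigcup_{r\in R}\widehat{\mathrm{Cov}}(r)\Big\}\Big|.$$ Such a candidate always exists, and the algorithm terminates after at most $16(\ln|A|+1)\,k_\Delta$ iterations (after none if $A=\emptyset$, where $\ln 0$ is read as $0$). The resulting set satisfies $R\subset\mathbb X^d_\ell$ and $A\subset\mathrm{Cov}_P(R,4\Delta)$.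 If moreover $A$ contains the midpoint of every atomic interval, then $\mathrm{Cov}_P(R,4\Delta)=[0,1]$. -/

import Mathlib

open Set
open scoped ENNReal

noncomputable section

namespace SubtrajectoryCover

/-- Euclidean `d`-space. -/
abbrev Pt (d : ℕ) : Type := EuclideanSpace ℝ (Fin d)

/-- The defining data of a polygonal curve parametrized over `[0,1]`: `numEdges + 1` vertices, the
`i`-th of which is attained at the parameter `param i`. Consecutive vertices may coincide, and the
parameters of the vertices are arbitrary. -/
structure PolyCurve (d : ℕ) where
  numEdges : ℕ
  numEdges_pos : 0 < numEdges
  vertex : Fin (numEdges + 1) → Pt d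
  param : Fin (numEdges + 1) → ℝ
  param_strictMono : StrictMono param
  param_zero : param 0 = 0
  param_last : param (Fin.last numEdges) = 1

namespace PolyCurve

variable {d : ℕ}

/-- The complexity, i.e. the number of defining points. -/
def complexity (P : PolyCurve d) : ℕ := P.numEdges + 1

/-- The fraction of the `i`-th edge that has been traversed at parameter `x`. -/
def progress (P : PolyCurve d) (i : Fin P.numEdges) (x : ℝ) : ℝ :=
  max 0 (min 1 ((x - P.param i.castSucc) / (P.param i.succ - P.param i.castSucc)))

/-- The point of the curve at parameter `x`: the edges are concatenated and traversed linearly. -/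
def eval (P : PolyCurve d) (x : ℝ) : Pt d :=
  P.vertex 0 + ∑ i, P.progress i x • (P.vertex i.succ - P.vertex i.castSucc)

/-- The curve as a map on `[0,1]`. -/
def toMap (P : PolyCurve d) : unitInterval → Pt d := fun τ => P.eval τ

/-- The parameters at which the `i`-th edge is traversed. -/
def edgeParams (P : PolyCurve d) (i : Fin P.numEdges) : Set ℝ :=
  Icc (P.param i.castSucc) (P.param i.succ)

theorem sum_sub_castSucc {n : ℕ} (v : Fin (n + 1) → Pt d) (k : Fin (n + 1)) :
    v 0 + ∑ i : Fin n, (if i.castSucc < k then v i.succ - v i.castSucc else 0) = v k := by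
  induction n with
  | zero =>
    obtain rfl : k = 0 := Fin.ext (by omega)
    simp
  | succ n ih =>
    rw [Fin.sum_univ_castSucc]
    induction k using Fin.lastCases with
    | last =>
      have h := ih (fun i => v i.castSucc) (Fin.last n)
      simp only [Fin.castSucc_lt_last, if_true, Fin.castSucc_zero] at h ⊢
      rw [← add_assoc]
      simp only [← Fin.succ_castSucc] at h ⊢
      rw [h]
      simp
    | cast k =>
      have h := ih (fun i => v i.castSucc) k
      have h2 : ¬ ((Fin.last n).castSucc < k.castSucc) := by
        simpa using Fin.le_last k
      simp only [Fin.castSucc_zero, Fin.castSucc_lt_castSucc_iff] at h ⊢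
      simp only [← Fin.succ_castSucc] at h ⊢
      rw [if_neg (by simpa using Fin.le_last k), add_zero]
      exact h

/-- On the `i`-th edge, the curve interpolates linearly between the two endpoints of the edge. -/
theorem eval_of_mem (P : PolyCurve d) (i : Fin P.numEdges) {x : ℝ} (hx : x ∈ P.edgeParams i) :
    P.eval x = AffineMap.lineMap (P.vertex i.castSucc) (P.vertex i.succ)
      ((x - P.param i.castSucc) / (P.param i.succ - P.param i.castSucc)) := by
  have hpos : ∀ j : Fin P.numEdges, 0 < P.param j.succ - P.param j.castSucc := fun j =>
    sub_pos.2 (P.param_strictMono Fin.castSucc_lt_succ)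
  have hi : P.progress i x =
      (x - P.param i.castSucc) / (P.param i.succ - P.param i.castSucc) := by
    unfold progress
    rw [min_eq_right, max_eq_right]
    · exact div_nonneg (sub_nonneg.2 hx.1) (hpos i).le
    · rw [div_le_one (hpos i)]
      linarith [hx.2]
  have hother : ∀ j : Fin P.numEdges, j ≠ i → P.progress j x = if j < i then 1 else 0 := by
    intro j hj
    unfold progress
    split_ifs with h
    · have : P.param j.succ ≤ P.param i.castSucc := P.param_strictMono.monotone (by
        rw [Fin.le_def]; simp; exact h)
      rw [min_eq_left, max_eq_right zero_le_one]
      rw [one_le_div (hpos j)]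
      linarith [hx.1]
    · have h' : i < j := lt_of_le_of_ne (not_lt.1 h) (Ne.symm hj)
      have : P.param i.succ ≤ P.param j.castSucc := P.param_strictMono.monotone (by
        rw [Fin.le_def]; simp; exact h')
      have h0 : (x - P.param j.castSucc) / (P.param j.succ - P.param j.castSucc) ≤ 0 :=
        div_nonpos_of_nonpos_of_nonneg (by linarith [hx.2]) (hpos j).le
      rw [max_eq_left]
      exact (min_le_right _ _).trans h0
  have hsum : ∀ j : Fin P.numEdges,
      P.progress j x • (P.vertex j.succ - P.vertex j.castSucc) =
        (if j.castSucc < i.castSucc then P.vertex j.succ - P.vertex j.castSucc else 0) +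
        (if j = i then P.progress i x • (P.vertex i.succ - P.vertex i.castSucc) else 0) := by
    intro j
    rcases eq_or_ne j i with rfl | hj
    · simp
    · rw [hother j hj]
      by_cases h : j < i <;> simp [h, hj]
  unfold eval
  rw [Finset.sum_congr rfl fun j _ => hsum j, Finset.sum_add_distrib, ← add_assoc,
    sum_sub_castSucc P.vertex i.castSucc, Finset.sum_ite_eq' Finset.univ i, hi]
  simp [AffineMap.lineMap_apply, add_comm]

/-- The subcurve `P[s,t]`, as a map on `[0,1]`. -/
def subcurve (P : PolyCurve d) (s t : ℝ) : unitInterval → Pt d :=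
  fun τ => P.eval (s + τ * (t - s))

/-- The complexity of the subcurve `P[s,t]`: its two endpoints, and the vertices in between. -/
def subcurveComplexity (P : PolyCurve d) (s t : ℝ) : ℕ :=
  {i | s < P.param i ∧ P.param i < t}.ncard + 2

end PolyCurve

variable {d : ℕ}

/-- All polygonal curves in `ℝ^d` of complexity at most `ℓ`, as maps on `[0,1]`. -/
def curveSpace (d ℓ : ℕ) : Set (unitInterval → Pt d) :=
  {γ | ∃ Q : PolyCurve d, Q.complexity ≤ ℓ ∧ γ = Q.toMap}

/-- The continuous Fréchet distance. -/
def frechetDist (γ η : unitInterval → Pt d) : ℝ≥0∞ :=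
  ⨅ (f : unitInterval → unitInterval) (_ : Monotone f ∧ Function.Surjective f)
    (g : unitInterval → unitInterval) (_ : Monotone g ∧ Function.Surjective g),
    ⨆ τ, edist (γ (f τ)) (η (g τ))

/-- The `Δ`-coverage on `P` of a set `𝒬` of curves. -/
def cov (P : PolyCurve d) (𝒬 : Set (unitInterval → Pt d)) (Δ : ℝ) : Set ℝ :=
  {x | ∃ γ ∈ 𝒬, ∃ s t : ℝ, 0 ≤ s ∧ s ≤ t ∧ t ≤ 1 ∧
    frechetDist (P.subcurve s t) γ ≤ ENNReal.ofReal Δ ∧ x ∈ Icc s t}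

/-- The size of a smallest set of curves of complexity at most `ℓ` whose `Δ`-coverage on `P` is
all of `[0,1]`. -/
def coverNumber (P : PolyCurve d) (ℓ : ℕ) (Δ : ℝ) : ℕ :=
  sInf {k | ∃ C : Finset (unitInterval → Pt d),
    (C : Set (unitInterval → Pt d)) ⊆ curveSpace d ℓ ∧ C.card = k ∧
      cov P (C : Set (unitInterval → Pt d)) Δ = Icc 0 1}

/-- `S` is a simplification of `P` (with respect to `Δ` and `ℓ`). -/
def IsSimplification (P S : PolyCurve d) (Δ : ℝ) (ℓ : ℕ) : Prop :=
  frechetDist S.toMap P.toMap ≤ ENNReal.ofReal (2 * Δ) ∧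
  ∀ γ ∈ curveSpace d ℓ, ∀ s t : ℝ, 0 ≤ s → s ≤ t → t ≤ 1 →
    frechetDist γ (P.subcurve s t) ≤ ENNReal.ofReal Δ →
    ∃ s' t' : ℝ, 0 ≤ s' ∧ s' ≤ t' ∧ t' ≤ 1 ∧
      frechetDist (P.subcurve s t) (S.subcurve s' t') ≤ ENNReal.ofReal (2 * Δ) ∧
      S.subcurveComplexity s' t' ≤ ℓ + 2

/-! ### The free space of an edge and a curve

The edge is `e : y ↦ p + y (q - p)`, its reversal is obtained by exchanging `p` and `q`. Horizontal
coordinates refer to `P`, vertical ones to `e`, and `r` is the radius. -/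

/-- The `r`-free space of the edge from `p` to `q` and `P`. -/
def freeSpace (P : PolyCurve d) (r : ℝ) (p q : Pt d) : Set (ℝ × ℝ) :=
  {z | z.1 ∈ Icc (0 : ℝ) 1 ∧ z.2 ∈ Icc (0 : ℝ) 1 ∧
    dist (P.eval z.1) (AffineMap.lineMap p q z.2) ≤ r}

/-- The part of the free space in the `i`-th (closed) cell. -/
def cell (P : PolyCurve d) (r : ℝ) (p q : Pt d) (i : Fin P.numEdges) : Set (ℝ × ℝ) :=
  {z | z ∈ freeSpace P r p q ∧ z.1 ∈ P.edgeParams i}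

/-- The extremal points of a (convex, compact) planar set: the endpoints of the segments formed by
its points of minimal and maximal first coordinate, and of minimal and maximal second
coordinate. -/
def extremalPoints (K : Set (ℝ × ℝ)) : Set (ℝ × ℝ) :=
  {z | z ∈ K ∧
    (((∀ w ∈ K, z.1 ≤ w.1) ∨ (∀ w ∈ K, w.1 ≤ z.1)) ∧
      ((∀ w ∈ K, w.1 = z.1 → z.2 ≤ w.2) ∨ (∀ w ∈ K, w.1 = z.1 → w.2 ≤ z.2)) ∨
    ((∀ w ∈ K, z.2 ≤ w.2) ∨ (∀ w ∈ K, w.2 ≤ z.2)) ∧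
      ((∀ w ∈ K, w.2 = z.2 → z.1 ≤ w.1) ∨ (∀ w ∈ K, w.2 = z.2 → w.1 ≤ z.1)))}

/-- The `y`-coordinates of the extremal points of the free space of the edge and `P`. -/
def extremalHeights (P : PolyCurve d) (r : ℝ) (p q : Pt d) : Set ℝ :=
  {y | ∃ i x, (x, y) ∈ extremalPoints (cell P r p q i)}

/-- The free points of the `i`-th cell at height `y`. -/
def row (P : PolyCurve d) (r : ℝ) (p q : Pt d) (i : Fin P.numEdges) (y : ℝ) : Set ℝ :=
  {x | (x, y) ∈ cell P r p q i}

open Classical in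
/-- `l_i(y)`: the leftmost free point of the `i`-th cell at height `y`, or `∞`. -/
def leftEnd (P : PolyCurve d) (r : ℝ) (p q : Pt d) (i : Fin P.numEdges) (y : ℝ) : EReal :=
  if (row P r p q i y).Nonempty then ((sInf (row P r p q i y) : ℝ) : EReal) else ⊤

open Classical in
/-- `r_i(y)`: the rightmost free point of the `i`-th cell at height `y`, or `∞`. -/
def rightEnd (P : PolyCurve d) (r : ℝ) (p q : Pt d) (i : Fin P.numEdges) (y : ℝ) : EReal :=
  if (row P r p q i y).Nonempty then ((sSup (row P r p q i y) : ℝ) : EReal) else ⊤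

/-- The real numbers between two extended real numbers. -/
def span (a b : EReal) : Set ℝ := {x | a ≤ (x : EReal) ∧ (x : EReal) ≤ b}

/-- There is a path from `z` to `w` in `A` that is monotone in both coordinates. -/
def HasMonotonePath (A : Set (ℝ × ℝ)) (z w : ℝ × ℝ) : Prop :=
  ∃ γ : Path z w, Monotone γ ∧ ∀ τ, γ τ ∈ A

/-- There is a monotone path from the `i`-th cell at height `s` to the `j`-th cell at height `t`. -/
def Connects (P : PolyCurve d) (r : ℝ) (p q : Pt d) (s t : ℝ) (i j : Fin P.numEdges) : Prop :=
  ∃ s' ∈ P.edgeParams i, ∃ t' ∈ P.edgeParams j,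
    HasMonotonePath (freeSpace P r p q) (s', s) (t', t)

/-- `(i, j)` is in the combinatorial representation of the coverage of `e[s,t]`. -/
def InRep (P : PolyCurve d) (r : ℝ) (p q : Pt d) (s t : ℝ) (i j : Fin P.numEdges) : Prop :=
  Connects P r p q s t i j ∧
    ∀ i' j', Connects P r p q s t i' j' → i' ≤ i → j ≤ j' → i' = i ∧ j' = j

/-- The index `i` is bad for `e[s,t]`: every topmost point of the `i`-th cell is to the left of
`l_i(s)` and `r_i(t)`, and these are to the left of every bottommost point. -/
def Bad (P : PolyCurve d) (r : ℝ) (p q : Pt d) (s t : ℝ) (i : Fin P.numEdges) : Prop :=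
  (∀ z ∈ cell P r p q i, (∀ w ∈ cell P r p q i, w.2 ≤ z.2) →
    ((z.1 : ℝ) : EReal) ≤ leftEnd P r p q i s ∧ ((z.1 : ℝ) : EReal) ≤ rightEnd P r p q i t) ∧
  (∀ z ∈ cell P r p q i, (∀ w ∈ cell P r p q i, z.2 ≤ w.2) →
    leftEnd P r p q i s ≤ ((z.1 : ℝ) : EReal) ∧ rightEnd P r p q i t ≤ ((z.1 : ℝ) : EReal))

/-- The pairs that arise from the global group of `e[s,t]` by merging. -/
inductive Merged (P : PolyCurve d) (r : ℝ) (p q : Pt d) (s t : ℝ) :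
    Fin P.numEdges → Fin P.numEdges → Prop
  | base {a b : Fin P.numEdges} : InRep P r p q s t a b → a < b → Merged P r p q s t a b
  | overlap {a b a' b' : Fin P.numEdges} : Merged P r p q s t a b → Merged P r p q s t a' b' →
      a < a' → a' < b → b < b' → Merged P r p q s t a b'
  | touch {a b b' : Fin P.numEdges} : Merged P r p q s t a b → Merged P r p q s t b b' →
      ¬ Bad P r p q s t b → Merged P r p q s t a b'

/-- `(i, j)` is in the reduced global group of `e[s,t]`: no further merging enlarges it. -/
def InReduced (P : PolyCurve d) (r : ℝ) (p q : Pt d) (s t : ℝ) (i j : Fin P.numEdges) : Prop :=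
  Merged P r p q s t i j ∧
    ∀ i' j', Merged P r p q s t i' j' → i' ≤ i → j ≤ j' → i' = i ∧ j' = j

open Classical in
/-- The left endpoint used by the proxy coverage of `e[s,t]`. -/
def hatLeft (P : PolyCurve d) (r : ℝ) (p q : Pt d) (s t : ℝ) (i : Fin P.numEdges) : EReal :=
  if Bad P r p q s t i then rightEnd P r p q i s else leftEnd P r p q i s

open Classical in
/-- The right endpoint used by the proxy coverage of `e[s,t]`. -/
def hatRight (P : PolyCurve d) (r : ℝ) (p q : Pt d) (s t : ℝ) (j : Fin P.numEdges) : EReal :=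
  if Bad P r p q s t j then leftEnd P r p q j t else rightEnd P r p q j t

/-- The proxy coverage of the subedge `e[s,t]` of the edge `e` from `p` to `q`. -/
def proxySubedge (P : PolyCurve d) (r : ℝ) (p q : Pt d) (s t : ℝ) : Set ℝ :=
  {x | (∃ i, InRep P r p q s t i i ∧ ¬ Bad P r p q s t i ∧
      x ∈ span (leftEnd P r p q i s) (rightEnd P r p q i t)) ∨
    (∃ i j, InReduced P r p q s t i j ∧
      x ∈ span (hatLeft P r p q s t i) (hatRight P r p q s t j))}

/-! ### Candidates -/

/-- Subcurves of `S` of the kinds that occur as candidates: `vertices i j` is the subcurve from the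
`i`-th to the `j`-th vertex, and `subedge e s t b` is the subedge `e[s,t]` of the `e`-th edge (with
`s`, `t` relative to that edge), reversed if `b` is true. -/
inductive Candidate (S : PolyCurve d) : Type
  | vertices (i j : Fin (S.numEdges + 1)) : Candidate S
  | subedge (e : Fin S.numEdges) (s t : ℝ) (b : Bool) : Candidate S

/-- The curve that a candidate stands for. -/
def Candidate.curve {S : PolyCurve d} : Candidate S → unitInterval → Pt d
  | .vertices i j => S.subcurve (S.param i) (S.param j)
  | .subedge e s t false => fun τ =>
      AffineMap.lineMap (S.vertex e.castSucc) (S.vertex e.succ) (s + (τ : ℝ) * (t - s))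
  | .subedge e s t true => fun τ =>
      AffineMap.lineMap (S.vertex e.castSucc) (S.vertex e.succ) (t + (τ : ℝ) * (s - t))

/-- The proxy coverage of a candidate on `P` for radius `r`. -/
def Candidate.proxy {S : PolyCurve d} (P : PolyCurve d) (r : ℝ) : Candidate S → Set ℝ
  | .vertices i j => cov P {S.subcurve (S.param i) (S.param j)} r
  | .subedge e s t false => proxySubedge P r (S.vertex e.castSucc) (S.vertex e.succ) s t
  | .subedge e s t true =>
      proxySubedge P r (S.vertex e.succ) (S.vertex e.castSucc) (1 - t) (1 - s)

/-- The set of Type (I)-, (II)- and (III)-subcurves of `S` (of complexity at most `ℓ`) that are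
induced by the finite sets `E e` of heights on the edges `e` of `S`. The number of elements of
`E e` in `[y, y')` is the difference of the positions of `y` and `y'` in the sorted `E e`. -/
inductive IsCandidate {S : PolyCurve d} (ℓ : ℕ) (E : Fin S.numEdges → Finset ℝ) :
    Candidate S → Prop
  | typeI (i j : Fin (S.numEdges + 1)) (m : ℕ) : m ≤ Nat.log 2 ℓ → (j : ℕ) = i + 2 ^ m →
      2 ^ m + 1 ≤ ℓ → IsCandidate ℓ E (.vertices i j)
  | typeIIstart (e : Fin S.numEdges) (y : ℝ) (b : Bool) : y ∈ E e →
      IsCandidate ℓ E (.subedge e 0 y b)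
  | typeIIend (e : Fin S.numEdges) (y : ℝ) (b : Bool) : y ∈ E e →
      IsCandidate ℓ E (.subedge e y 1 b)
  | typeIII (e : Fin S.numEdges) (y y' : ℝ) (b : Bool) (m : ℕ) : y ∈ E e → y' ∈ E e →
      m ≤ Nat.log 2 (E e).card → {z ∈ E e | y ≤ z ∧ z < y'}.card = 2 ^ m →
      IsCandidate ℓ E (.subedge e y y' b)

/-! ### Atomic intervals -/

/-- The endpoints of the atomic intervals: `0`, `1`, and the points at which a horizontal line at
one of the heights in `E` enters or leaves the free space within a cell. -/
def breakpoints (P S : PolyCurve d) (r : ℝ) (E : Fin S.numEdges → Finset ℝ) : Set ℝ :=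
  {0, 1} ∪ {x | ∃ e, ∃ y ∈ E e, ∃ i,
    (x : EReal) = leftEnd P r (S.vertex e.castSucc) (S.vertex e.succ) i y ∨
    (x : EReal) = rightEnd P r (S.vertex e.castSucc) (S.vertex e.succ) i y}

/-- The midpoints of the atomic intervals. -/
def atomicMidpoints (P S : PolyCurve d) (r : ℝ) (E : Fin S.numEdges → Finset ℝ) : Set ℝ :=
  {x | ∃ a ∈ breakpoints P S r E, ∃ b ∈ breakpoints P S r E, a < b ∧
    (∀ c ∈ breakpoints P S r E, ¬ (a < c ∧ c < b)) ∧ x = (a + b) / 2}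

/-! ### The greedy algorithm -/

/-- The points of `A` that are in no proxy coverage of an element of `R`. -/
def uncovered {S : PolyCurve d} (P : PolyCurve d) (r : ℝ) (A : Finset ℝ)
    (R : List (Candidate S)) : Set ℝ :=
  {a | a ∈ A ∧ ∀ c ∈ R, a ∉ c.proxy P r}

/-- `R` lists the candidates (latest first) that have been chosen in some sequence of iterations of
the greedy algorithm: as long as a point of `A` is uncovered, add a candidate that covers the
largest number of uncovered points. -/
inductive GreedyRun {S : PolyCurve d} (P : PolyCurve d) (r : ℝ) (ℓ : ℕ)
    (E : Fin S.numEdges → Finset ℝ) (A : Finset ℝ) : List (Candidate S) → Prop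
  | start : GreedyRun P r ℓ E A []
  | step {R : List (Candidate S)} {c : Candidate S} : GreedyRun P r ℓ E A R →
      (uncovered P r A R).Nonempty → IsCandidate ℓ E c →
      (∀ c', IsCandidate ℓ E c' →
        (uncovered P r A R ∩ c'.proxy P r).ncard ≤ (uncovered P r A R ∩ c.proxy P r).ncard) →
      GreedyRun P r ℓ E A (c :: R)

end SubtrajectoryCover

end

namespace SubtrajectoryCover

variable {d : ℕ}

/-! The iteration bound is that of greedy set cover: if the proxy coverages of n candidates cover
`A`, every step gains at least 1/n of what is still uncovered, which limits the number of steps to n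
times the harmonic number of |A| (`GreedyRun.length_le`). The geometric content is that n = 16 k_Δ
candidates suffice (`coveredBy_coverNumber`), while proxies never claim too much
(`Candidate.proxy_subset_cov`).

Take a curve γ of an optimal cover and one piece P[s,t] within Δ of it. The simplification provides
S[s',t'] of complexity at most ℓ+2 within 2Δ of P[s,t]; by the triangle inequality it is within 4Δ
of every piece of P that γ matches. If s' < t', either S[s',t'] lies on one edge (8 candidates), or
it is cut at its first and last inner vertex into a suffix of an edge (4), a vertex-to-vertex part
of complexity at most ℓ (2) and a prefix of an edge (4); see `coveredBy_subcurve`. If s' = t', only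
points at distance strictly less than 4Δ are sure to be captured; equality in the triangle
inequality (`eq_of_dist_extremal`) shows that a second piece takes care of the others
(`coveredBy_cov`).

A subedge with arbitrary ends is compared with the heights in `E e`. The part between two such
heights is the union of two overlapping subedges spanning a power of two of heights. What remains at
either end lies in a strip between consecutive heights. No cell has an extremal point strictly
inside the strip, so convexity of the cells shows that the whole strip, traversed upwards or
downwards, covers as much (`covers_of_strip`).

The proxy can miss covered points only in bad cells. These lean to the left, so a reversed path
covers the missing points: apart from vertices of P and breakpoints, whatever e[s,t] covers is in
the proxy coverage of e[s,t] or of its reversal (`mem_proxySubedge_or_reversed`). The finitely many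
exceptions do no harm, because a proxy coverage is a union of closed intervals between breakpoints:
proxies that meet the interior of every atomic interval cover [0,1] (`proxies_meet`). The same fact
makes the midpoints sufficient at the end.

All of this happens in free spaces. A Fréchet distance is at most r exactly if a monotone path
exists (`frechetDist_reparam_le_iff`), which requires optimal matchings to exist. -/

/-! ### Monotone paths in planar sets -/

theorem hasMonotonePath_of_map {A : Set (ℝ × ℝ)} {f : ℝ → ℝ × ℝ} (hc : Continuous f)
    (hm : Monotone f) (hA : ∀ τ ∈ Icc (0 : ℝ) 1, f τ ∈ A) : HasMonotonePath A (f 0) (f 1) :=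
  ⟨⟨⟨fun τ => f τ, by fun_prop⟩, by simp, by simp⟩, fun a b h => hm h, fun τ => hA τ τ.2⟩

/-- Constant extension beyond the two ends keeps the path monotone and inside `A` at all real times,
so no interval conditions have to be carried along. -/
theorem HasMonotonePath.exists_map {A : Set (ℝ × ℝ)} {z w : ℝ × ℝ} (h : HasMonotonePath A z w) :
    ∃ f : ℝ → ℝ × ℝ, Continuous f ∧ Monotone f ∧ (∀ τ, f τ ∈ A) ∧ f 0 = z ∧ f 1 = w := by
  obtain ⟨γ, hm, hA⟩ := h
  refine ⟨γ.extend, γ.continuous_extend, ?_, fun τ => hA _, by simp, by simp⟩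
  intro a b hab
  exact hm (Set.monotone_projIcc _ hab)

theorem HasMonotonePath.le {A : Set (ℝ × ℝ)} {z w : ℝ × ℝ} (h : HasMonotonePath A z w) :
    z ≤ w := by
  obtain ⟨f, -, hm, -, rfl, rfl⟩ := h.exists_map
  exact hm zero_le_one

theorem HasMonotonePath.left_mem {A : Set (ℝ × ℝ)} {z w : ℝ × ℝ} (h : HasMonotonePath A z w) :
    z ∈ A := by
  obtain ⟨f, -, -, hA, rfl, rfl⟩ := h.exists_map
  exact hA 0

theorem HasMonotonePath.right_mem {A : Set (ℝ × ℝ)} {z w : ℝ × ℝ} (h : HasMonotonePath A z w) :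
    w ∈ A := by
  obtain ⟨f, -, -, hA, rfl, rfl⟩ := h.exists_map
  exact hA 1

theorem HasMonotonePath.trans {A : Set (ℝ × ℝ)} {z w v : ℝ × ℝ} (h : HasMonotonePath A z w)
    (h' : HasMonotonePath A w v) : HasMonotonePath A z v := by
  obtain ⟨γ, hm, hA⟩ := h
  obtain ⟨γ', hm', hA'⟩ := h'
  refine ⟨γ.trans γ', ?_, ?_⟩
  · intro a b hab
    have hab' : (a : ℝ) ≤ b := hab
    rw [Path.trans_apply, Path.trans_apply]
    split_ifs with h1 h2 h2
    · exact hm (Subtype.mk_le_mk.2 (by linarith))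
    · calc _ ≤ γ 1 := hm (Subtype.mk_le_mk.2 (by linarith))
        _ = γ' 0 := by simp
        _ ≤ _ := hm' (Subtype.mk_le_mk.2 (by push Not at h2; linarith))
    · exact absurd (hab'.trans h2) h1
    · exact hm' (Subtype.mk_le_mk.2 (by linarith))
  · intro τ
    rw [Path.trans_apply]
    split_ifs
    · exact hA _
    · exact hA' _

/-- The part of a monotone path before and after one of its points. -/
theorem hasMonotonePath_split {A : Set (ℝ × ℝ)} {f : ℝ → ℝ × ℝ} (hc : Continuous f)
    (hm : Monotone f) (hA : ∀ τ, f τ ∈ A) {σ : ℝ} (hσ : σ ∈ Icc (0 : ℝ) 1) :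
    HasMonotonePath A (f 0) (f σ) ∧ HasMonotonePath A (f σ) (f 1) := by
  constructor
  · have := hasMonotonePath_of_map (A := A) (f := fun τ => f (σ * τ)) (by fun_prop)
      (fun a b h => hm (mul_le_mul_of_nonneg_left h hσ.1)) (fun τ _ => hA _)
    simpa using this
  · have := hasMonotonePath_of_map (A := A) (f := fun τ => f (σ + (1 - σ) * τ)) (by fun_prop)
      (fun a b h => hm (by
        have := mul_le_mul_of_nonneg_left h (sub_nonneg.2 hσ.2)
        linarith)) (fun τ _ => hA _)
    simpa using this

theorem HasMonotonePath.split_snd {A : Set (ℝ × ℝ)} {z w : ℝ × ℝ} (h : HasMonotonePath A z w)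
    {y : ℝ} (h1 : z.2 ≤ y) (h2 : y ≤ w.2) :
    ∃ x, HasMonotonePath A z (x, y) ∧ HasMonotonePath A (x, y) w := by
  obtain ⟨f, hc, hm, hA, rfl, rfl⟩ := h.exists_map
  obtain ⟨σ, hσ, h⟩ := intermediate_value_Icc zero_le_one
    (continuous_snd.comp hc).continuousOn ⟨h1, h2⟩
  have := hasMonotonePath_split hc hm hA hσ
  have e : f σ = ((f σ).1, y) := Prod.ext rfl h
  exact ⟨(f σ).1, e ▸ this⟩

theorem HasMonotonePath.split_fst {A : Set (ℝ × ℝ)} {z w : ℝ × ℝ} (h : HasMonotonePath A z w)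
    {x : ℝ} (h1 : z.1 ≤ x) (h2 : x ≤ w.1) :
    ∃ y, HasMonotonePath A z (x, y) ∧ HasMonotonePath A (x, y) w := by
  obtain ⟨f, hc, hm, hA, rfl, rfl⟩ := h.exists_map
  obtain ⟨σ, hσ, h⟩ := intermediate_value_Icc zero_le_one
    (continuous_fst.comp hc).continuousOn ⟨h1, h2⟩
  have := hasMonotonePath_split hc hm hA hσ
  have e : f σ = (x, (f σ).2) := Prod.ext h rfl
  exact ⟨(f σ).2, e ▸ this⟩

/-- A monotone path stays in the box spanned by its ends, so `hB` is only needed there. This is what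
confines a path to a single edge of `S`. -/
theorem HasMonotonePath.map {A B : Set (ℝ × ℝ)} {z w : ℝ × ℝ} (h : HasMonotonePath A z w)
    {φ : ℝ × ℝ → ℝ × ℝ} (hφ : Continuous φ) (hm : Monotone φ)
    (hB : ∀ v ∈ A, z ≤ v → v ≤ w → φ v ∈ B) : HasMonotonePath B (φ z) (φ w) := by
  obtain ⟨f, hc, hf, hA, rfl, rfl⟩ := h.exists_map
  exact hasMonotonePath_of_map (f := fun τ => φ (f τ)) (hφ.comp hc) (hm.comp hf)
    fun τ hτ => hB _ (hA τ) (hf hτ.1) (hf hτ.2)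

theorem HasMonotonePath.mono {A B : Set (ℝ × ℝ)} {z w : ℝ × ℝ} (h : HasMonotonePath A z w)
    (hB : ∀ v ∈ A, z ≤ v → v ≤ w → v ∈ B) : HasMonotonePath B z w :=
  h.map continuous_id monotone_id hB

theorem hasMonotonePath_segment {K A : Set (ℝ × ℝ)} (hK : Convex ℝ K) (hKA : K ⊆ A)
    {z w : ℝ × ℝ} (hz : z ∈ K) (hw : w ∈ K) (h : z ≤ w) : HasMonotonePath A z w := by
  have := hasMonotonePath_of_map (A := A)
    (f := fun τ => (z.1 + τ * (w.1 - z.1), z.2 + τ * (w.2 - z.2))) (by fun_prop)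
    (fun a b hab => ⟨by
      have := mul_le_mul_of_nonneg_right hab (sub_nonneg.2 h.1); simpa using this, by
      have := mul_le_mul_of_nonneg_right hab (sub_nonneg.2 h.2); simpa using this⟩)
    (fun τ hτ => hKA (by
      have := hK hz hw (sub_nonneg.2 hτ.2) hτ.1 (by ring)
      convert this using 1
      ext <;> simp <;> ring))
  simpa using this

theorem hasMonotonePath_refl {A : Set (ℝ × ℝ)} {z : ℝ × ℝ} (hz : z ∈ A) :
    HasMonotonePath A z z :=
  hasMonotonePath_segment (convex_singleton z) (singleton_subset_iff.2 hz) rfl rfl le_rfl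

/-! ### The Fréchet distance -/

/-- The slack `c'` stands in for optimal matchings, which need not exist for arbitrary maps. -/
theorem frechetDist_le_iff {γ η : unitInterval → Pt d} {c : ℝ≥0∞} :
    frechetDist γ η ≤ c ↔ ∀ c', c < c' → ∃ f g : unitInterval → unitInterval,
      (Monotone f ∧ Function.Surjective f) ∧ (Monotone g ∧ Function.Surjective g) ∧
        ∀ τ, edist (γ (f τ)) (η (g τ)) ≤ c' := by
  unfold frechetDist
  constructor
  · intro h c' hc
    have := h.trans_lt hc
    simp only [iInf_lt_iff] at this
    obtain ⟨f, hf, g, hg, h⟩ := this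
    exact ⟨f, g, hf, hg, fun τ => (le_iSup (fun τ => edist (γ (f τ)) (η (g τ))) τ).trans h.le⟩
  · intro h
    refine le_of_forall_gt_imp_ge_of_dense fun c' hc => ?_
    obtain ⟨f, g, hf, hg, h⟩ := h c' hc
    exact (iInf₂_le f hf).trans ((iInf₂_le g hg).trans (iSup_le h))

theorem frechetDist_comm (γ η : unitInterval → Pt d) : frechetDist γ η = frechetDist η γ := by
  have : ∀ γ η : unitInterval → Pt d, frechetDist γ η ≤ frechetDist η γ := by
    intro γ η
    rw [frechetDist_le_iff]
    intro c hc
    obtain ⟨f, g, hf, hg, h⟩ := frechetDist_le_iff.1 le_rfl c hc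
    exact ⟨g, f, hg, hf, fun τ => (edist_comm _ _).trans_le (h τ)⟩
  exact le_antisymm (this _ _) (this _ _)

/-- Monotone functions that add up to `2 · id` are continuous. -/
theorem continuous_of_monotone_pair {f g : unitInterval → unitInterval}
    (hf : Monotone f) (hg : Monotone g) (h : ∀ τ, (f τ : ℝ) + g τ = 2 * τ) : Continuous f := by
  have hlip : ∀ a b : unitInterval, dist (f a) (f b) ≤ 2 * dist a b := by
    have key : ∀ a b : unitInterval, a ≤ b → dist (f a) (f b) ≤ 2 * dist a b := by
      intro a b hab
      have e1 : (f a : ℝ) ≤ f b := hf hab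
      have e2 : (g a : ℝ) ≤ g b := hg hab
      have e3 : (a : ℝ) ≤ b := hab
      rw [Subtype.dist_eq, Subtype.dist_eq, Real.dist_eq, Real.dist_eq,
        abs_of_nonpos (by linarith), abs_of_nonpos (by linarith)]
      have := h a
      have := h b
      linarith
    intro a b
    rcases le_total a b with hab | hab
    · exact key a b hab
    · rw [dist_comm, dist_comm a]
      exact key b a hab
  exact (LipschitzWith.of_dist_le_mul (K := 2) (by simpa using hlip)).continuous

theorem surjective_of_continuous {f : unitInterval → unitInterval} (hc : Continuous f)
    (h0 : f 0 = 0) (h1 : f 1 = 1) : Function.Surjective f := by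
  intro y
  obtain ⟨x, -, hx⟩ := intermediate_value_Icc (a := (0 : unitInterval)) (b := 1)
    zero_le_one hc.continuousOn (show y ∈ Icc (f 0) (f 1) by rw [h0, h1]; exact ⟨y.2.1, y.2.2⟩)
  exact ⟨x, hx⟩

theorem apply_endpoints_of_monotone_pair {f g : unitInterval → unitInterval}
    (h : ∀ τ, (f τ : ℝ) + g τ = 2 * τ) : f 0 = 0 ∧ f 1 = 1 := by
  have e0 := h 0
  have e1 := h 1
  simp only [Icc.coe_zero, Icc.coe_one] at e0 e1
  exact ⟨Subtype.ext (le_antisymm (by have := (g 0).2.1; simp; linarith) (f 0).2.1),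
    Subtype.ext (le_antisymm (f 1).2.2 (by have := (g 1).2.2; simp; linarith))⟩

theorem apply_endpoints_of_monotone_surjective {f : unitInterval → unitInterval}
    (hf : Monotone f) (hf' : Function.Surjective f) : f 0 = 0 ∧ f 1 = 1 := by
  obtain ⟨a, ha⟩ := hf' 0
  obtain ⟨b, hb⟩ := hf' 1
  exact ⟨le_antisymm ((hf (show 0 ≤ a from a.2.1)).trans ha.le) (f 0).2.1,
    le_antisymm (f 1).2.2 (hb.ge.trans (hf (show b ≤ 1 from b.2.2)))⟩

/-- Two monotone surjections have a common refinement. -/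
theorem exists_comp_eq_comp {f g : unitInterval → unitInterval}
    (hf : Monotone f) (hf' : Function.Surjective f)
    (hg : Monotone g) (hg' : Function.Surjective g) :
    ∃ h k : unitInterval → unitInterval, (Monotone h ∧ Function.Surjective h) ∧
      (Monotone k ∧ Function.Surjective k) ∧ ∀ τ, f (h τ) = g (k τ) := by
  have hfc := hf.continuous_of_surjective hf'
  have hgc := hg.continuous_of_surjective hg'
  obtain ⟨f0, f1⟩ := apply_endpoints_of_monotone_surjective hf hf'
  obtain ⟨g0, g1⟩ := apply_endpoints_of_monotone_surjective hg hg'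
  set F : ℝ → unitInterval := IccExtend zero_le_one f with hF
  set G : ℝ → unitInterval := IccExtend zero_le_one g with hG
  have hFc : Continuous F := hfc.Icc_extend'
  have hGc : Continuous G := hgc.Icc_extend'
  have hFm : Monotone F := hf.IccExtend _
  have hGm : Monotone G := hg.IccExtend _
  have F1 : F 1 = 1 := (IccExtend_right zero_le_one f).trans f1
  have G0 : G 0 = 0 := (IccExtend_left zero_le_one g).trans g0
  have F0 : F 0 = 0 := (IccExtend_left zero_le_one f).trans f0
  have G1 : G 1 = 1 := (IccExtend_right zero_le_one g).trans g1
  -- The refinement is a staircase in the square on which `F a = G b`. On the antidiagonal `a + b =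
  -- σ` it passes through the first point with `G b ≤ F a`.
  let T : ℝ → Set ℝ := fun σ => {a | a ∈ Icc (0 : ℝ) 1 ∧ σ - a ≤ 1 ∧ G (σ - a) ≤ F a}
  have hT : ∀ σ, IsClosed (T σ) := fun σ =>
    isClosed_Icc.inter (IsClosed.inter (s₁ := {a | σ - a ≤ 1}) (s₂ := {a | G (σ - a) ≤ F a})
      (isClosed_le (by fun_prop) (by fun_prop)) (isClosed_le (by fun_prop) hFc))
  have hbdd : ∀ σ, BddBelow (T σ) := fun σ => ⟨0, fun a ha => ha.1.1⟩
  have hmeet : ∀ σ ∈ Icc (0 : ℝ) 2, ∃ a ∈ T σ, a ≤ σ ∧ F a = G (σ - a) := by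
    intro σ hσ
    have hle : max 0 (σ - 1) ≤ min 1 σ := by
      simp only [max_le_iff, le_min_iff]
      refine ⟨⟨zero_le_one, ?_⟩, hσ.1, ?_⟩ <;> linarith [hσ.2]
    have h1 : F (max 0 (σ - 1)) ≤ G (σ - max 0 (σ - 1)) := by
      rcases max_cases 0 (σ - 1) with ⟨h, -⟩ | ⟨h, -⟩ <;> rw [h]
      · rw [F0]; exact (G _).2.1
      · rw [show σ - (σ - 1) = 1 by ring, G1]; exact (F _).2.2
    have h2 : G (σ - min 1 σ) ≤ F (min 1 σ) := by
      rcases min_cases 1 σ with ⟨h, -⟩ | ⟨h, -⟩ <;> rw [h]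
      · rw [F1]; exact (G _).2.2
      · rw [sub_self, G0]; exact (F _).2.1
    obtain ⟨a, ha, he⟩ := intermediate_value_Icc hle
      (f := fun a => (F a : ℝ) - G (σ - a)) (by fun_prop)
      (show (0 : ℝ) ∈ _ from ⟨sub_nonpos.2 h1, sub_nonneg.2 h2⟩)
    have he : F a = G (σ - a) := Subtype.ext (by simpa [sub_eq_zero] using he)
    have h3 := ha.1
    have h4 := ha.2
    simp only [max_le_iff, le_min_iff] at h3 h4
    exact ⟨a, ⟨⟨h3.1, h4.1⟩, by linarith, he.ge⟩, h4.2, he⟩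
  have hmem : ∀ σ ∈ Icc (0 : ℝ) 2, sInf (T σ) ∈ T σ := fun σ hσ =>
    (hT σ).csInf_mem (let ⟨a, ha, _⟩ := hmeet σ hσ; ⟨a, ha⟩) (hbdd σ)
  have hle : ∀ σ ∈ Icc (0 : ℝ) 2, sInf (T σ) ≤ σ := fun σ hσ =>
    let ⟨a, ha, h, _⟩ := hmeet σ hσ; (csInf_le (hbdd σ) ha).trans h
  -- The least point is not to the right of a point where both sides agree. As `F a` grows and `G (σ
  -- - a)` decreases with `a`, the opposite inequality follows.
  have heq : ∀ σ ∈ Icc (0 : ℝ) 2, F (sInf (T σ)) = G (σ - sInf (T σ)) := by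
    intro σ hσ
    obtain ⟨a, ha, -, h⟩ := hmeet σ hσ
    have hia := csInf_le (hbdd σ) ha
    exact le_antisymm ((hFm hia).trans (h.le.trans (hGm (by linarith)))) (hmem σ hσ).2.2
  have h2 : ∀ τ : unitInterval, 2 * (τ : ℝ) ∈ Icc (0 : ℝ) 2 := fun τ =>
    ⟨by linarith [τ.2.1], by linarith [τ.2.2]⟩
  let h : unitInterval → unitInterval := fun τ => ⟨sInf (T (2 * τ)), (hmem _ (h2 τ)).1⟩
  let k : unitInterval → unitInterval := fun τ =>
    ⟨2 * τ - sInf (T (2 * τ)), by linarith [hle _ (h2 τ)], (hmem _ (h2 τ)).2.1⟩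
  have hh : Monotone h := by
    intro a b hab
    have hab' : (a : ℝ) ≤ b := hab
    refine csInf_le_csInf (hbdd _) ⟨_, hmem _ (h2 b)⟩ ?_
    rintro x ⟨hx1, hx2, hx3⟩
    exact ⟨hx1, by linarith, (hGm (by linarith)).trans hx3⟩
  have hk : Monotone k := by
    intro a b hab
    have hab' : (a : ℝ) ≤ b := hab
    change 2 * (a : ℝ) - sInf (T (2 * a)) ≤ 2 * (b : ℝ) - sInf (T (2 * b))
    obtain ⟨m1, m2, m3⟩ := hmem _ (h2 a)
    -- Moving to the right by `2 * (b - a)` keeps the second coordinate, hence the defining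
    -- inequality of `T`. If this exceeds 1, the bound `h b ≤ 1` is enough.
    rcases le_total (sInf (T (2 * a)) + 2 * (b - a)) 1 with hc | hc
    · have : sInf (T (2 * a)) + 2 * (b - a) ∈ T (2 * (b : ℝ)) := by
        refine ⟨⟨by linarith [m1.1], hc⟩, by linarith, ?_⟩
        rw [show 2 * (b : ℝ) - (sInf (T (2 * a)) + 2 * (b - a)) = 2 * a - sInf (T (2 * a)) by ring]
        exact m3.trans (hFm (by linarith))
      linarith [csInf_le (hbdd _) this]
    · linarith [(hmem _ (h2 b)).1.2]
  have hsum : ∀ τ, (h τ : ℝ) + k τ = 2 * τ := fun τ => by simp [h, k]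
  have hsum' : ∀ τ, (k τ : ℝ) + h τ = 2 * τ := fun τ => by simp [h, k]
  refine ⟨h, k, ⟨hh, ?_⟩, ⟨hk, ?_⟩, fun τ => ?_⟩
  · exact surjective_of_continuous (continuous_of_monotone_pair hh hk hsum)
      (apply_endpoints_of_monotone_pair hsum).1 (apply_endpoints_of_monotone_pair hsum).2
  · exact surjective_of_continuous (continuous_of_monotone_pair hk hh hsum')
      (apply_endpoints_of_monotone_pair hsum').1 (apply_endpoints_of_monotone_pair hsum').2
  · have e1 : F (h τ) = f (h τ) := IccExtend_val zero_le_one f _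
    have e2 : G (k τ) = g (k τ) := IccExtend_val zero_le_one g _
    rw [← e1, ← e2]
    exact heq _ (h2 τ)

/-- Two matchings traverse the middle curve by different reparametrizations; a common refinement
synchronizes them there, after which the pointwise triangle inequality applies. -/
theorem frechetDist_triangle (γ η ζ : unitInterval → Pt d) :
    frechetDist γ ζ ≤ frechetDist γ η + frechetDist η ζ := by
  refine ENNReal.le_of_forall_pos_le_add fun ε hε hlt => ?_
  have hε2 : (0 : ℝ≥0∞) < (ε / 2 : NNReal) := by
    rw [ENNReal.coe_pos]; exact half_pos hε
  have h1 : frechetDist γ η < frechetDist γ η + (ε / 2 : NNReal) :=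
    ENNReal.lt_add_right (ne_top_of_le_ne_top hlt.ne le_self_add) hε2.ne'
  have h2 : frechetDist η ζ < frechetDist η ζ + (ε / 2 : NNReal) :=
    ENNReal.lt_add_right (ne_top_of_le_ne_top hlt.ne le_add_self) hε2.ne'
  obtain ⟨f1, g1, hf1, hg1, h1⟩ := frechetDist_le_iff.1 le_rfl _ h1
  obtain ⟨f2, g2, hf2, hg2, h2⟩ := frechetDist_le_iff.1 le_rfl _ h2
  obtain ⟨h, k, hh, hk, e⟩ := exists_comp_eq_comp hg1.1 hg1.2 hf2.1 hf2.2
  have : frechetDist γ ζ ≤ ⨆ τ, edist (γ (f1 (h τ))) (ζ (g2 (k τ))) :=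
    (iInf₂_le (f1 ∘ h) ⟨hf1.1.comp hh.1, hf1.2.comp hh.2⟩).trans
      (iInf₂_le (g2 ∘ k) ⟨hg2.1.comp hk.1, hg2.2.comp hk.2⟩)
  refine this.trans (iSup_le fun τ => ?_)
  calc edist (γ (f1 (h τ))) (ζ (g2 (k τ)))
      ≤ edist (γ (f1 (h τ))) (η (g1 (h τ))) + edist (η (f2 (k τ))) (ζ (g2 (k τ))) := by
        rw [← e]; exact edist_triangle _ _ _
    _ ≤ _ := add_le_add (h1 _) (h2 _)
    _ = _ := by
        have : (ε : ℝ≥0∞) = (ε / 2 : NNReal) + (ε / 2 : NNReal) := by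
          rw [← ENNReal.coe_add, add_halves]
        rw [this]; ring

/-- Monotone surjections can be reparametrized by their sum. -/
theorem exists_monotone_pair {f g : unitInterval → unitInterval}
    (hf : Monotone f) (hf' : Function.Surjective f)
    (hg : Monotone g) (hg' : Function.Surjective g) :
    ∃ σ : unitInterval → unitInterval, Monotone (f ∘ σ) ∧ Monotone (g ∘ σ) ∧
      ∀ τ, (f (σ τ) : ℝ) + g (σ τ) = 2 * τ := by
  have hfc := hf.continuous_of_surjective hf'
  have hgc := hg.continuous_of_surjective hg'
  obtain ⟨f0, f1⟩ := apply_endpoints_of_monotone_surjective hf hf'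
  obtain ⟨g0, g1⟩ := apply_endpoints_of_monotone_surjective hg hg'
  have : ∀ τ : unitInterval, ∃ σ : unitInterval, (f σ : ℝ) + g σ = 2 * τ := by
    intro τ
    obtain ⟨σ, -, h⟩ := intermediate_value_Icc (a := (0 : unitInterval)) (b := 1) zero_le_one
      (f := fun σ => (f σ : ℝ) + g σ) (by fun_prop)
      (show 2 * (τ : ℝ) ∈ _ by
        simp only [f0, f1, g0, g1, Icc.coe_zero, Icc.coe_one]
        exact ⟨by linarith [τ.2.1], by linarith [τ.2.2]⟩)
    exact ⟨σ, h⟩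
  choose σ hσ using this
  have hm : Monotone σ := by
    intro a b hab
    by_contra hlt
    have hab' : (a : ℝ) ≤ b := hab
    have e1 : (f (σ b) : ℝ) ≤ f (σ a) := hf (not_le.1 hlt).le
    have e2 : (g (σ b) : ℝ) ≤ g (σ a) := hg (not_le.1 hlt).le
    have e : a = b := Subtype.ext (by linarith [hσ a, hσ b])
    exact hlt (by rw [e])
  exact ⟨σ, hf.comp hm, hg.comp hm, hσ⟩

/-- A Fréchet matching of two continuous curves that attains the infimum. -/
theorem exists_matching {γ η : unitInterval → Pt d} (hγ : Continuous γ) (hη : Continuous η)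
    {r : ℝ} (hr : 0 ≤ r) (h : frechetDist γ η ≤ ENNReal.ofReal r) :
    ∃ f g : unitInterval → unitInterval, Monotone f ∧ Monotone g ∧ Continuous f ∧ Continuous g ∧
      f 0 = 0 ∧ f 1 = 1 ∧ g 0 = 0 ∧ g 1 = 1 ∧ ∀ τ, dist (γ (f τ)) (η (g τ)) ≤ r := by
  have hn : ∀ n : ℕ, ∃ z : (unitInterval → unitInterval) × (unitInterval → unitInterval),
      Monotone z.1 ∧ Monotone z.2 ∧ (∀ τ, (z.1 τ : ℝ) + z.2 τ = 2 * τ) ∧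
      ∀ τ, dist (γ (z.1 τ)) (η (z.2 τ)) ≤ r + 1 / (n + 1) := by
    intro n
    have hpos : (0 : ℝ) < 1 / (n + 1) := by positivity
    have hlt : ENNReal.ofReal r < ENNReal.ofReal (r + 1 / (n + 1)) :=
      (ENNReal.ofReal_lt_ofReal_iff (by linarith)).2 (by linarith)
    obtain ⟨f, g, hf, hg, hfg⟩ := frechetDist_le_iff.1 h _ hlt
    obtain ⟨σ, h1, h2, h3⟩ := exists_monotone_pair hf.1 hf.2 hg.1 hg.2
    refine ⟨(f ∘ σ, g ∘ σ), h1, h2, h3, fun τ => ?_⟩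
    have := hfg (σ τ)
    rwa [edist_dist, ENNReal.ofReal_le_ofReal_iff (by linarith)] at this
  choose z hz1 hz2 hz3 hz4 using hn
  -- Pointwise compactness suffices: the normalization `f + g = 2 · id` and monotonicity pass to the
  -- limit and force continuity there.
  obtain ⟨⟨f, g⟩, -, hlim⟩ := isCompact_univ.ultrafilter_le_nhds
    ((Filter.hyperfilter ℕ).map z) (by simp)
  have hlim : Filter.Tendsto z (Filter.hyperfilter ℕ) (nhds (f, g)) := hlim
  have hf : ∀ τ, Filter.Tendsto (fun n => (z n).1 τ) (Filter.hyperfilter ℕ) (nhds (f τ)) :=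
    fun τ => (((continuous_apply τ).comp continuous_fst).tendsto (f, g)).comp hlim
  have hg : ∀ τ, Filter.Tendsto (fun n => (z n).2 τ) (Filter.hyperfilter ℕ) (nhds (g τ)) :=
    fun τ => (((continuous_apply τ).comp continuous_snd).tendsto (f, g)).comp hlim
  have hfm : Monotone f := fun a b hab =>
    le_of_tendsto_of_tendsto' (hf a) (hf b) fun n => hz1 n hab
  have hgm : Monotone g := fun a b hab =>
    le_of_tendsto_of_tendsto' (hg a) (hg b) fun n => hz2 n hab
  have hsum : ∀ τ, (f τ : ℝ) + g τ = 2 * τ := by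
    intro τ
    have h1 := ((continuous_subtype_val.tendsto _).comp (hf τ)).add
      ((continuous_subtype_val.tendsto _).comp (hg τ))
    refine tendsto_nhds_unique h1 (tendsto_const_nhds.congr fun n => ?_)
    exact (hz3 n τ).symm
  have hsum' : ∀ τ, (g τ : ℝ) + f τ = 2 * τ := fun τ => by rw [add_comm]; exact hsum τ
  obtain ⟨f0, f1⟩ := apply_endpoints_of_monotone_pair hsum
  obtain ⟨g0, g1⟩ := apply_endpoints_of_monotone_pair hsum'
  refine ⟨f, g, hfm, hgm, continuous_of_monotone_pair hfm hgm hsum,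
    continuous_of_monotone_pair hgm hfm hsum', f0, f1, g0, g1, fun τ => ?_⟩
  have h1 : Filter.Tendsto (fun n : ℕ => r + 1 / ((n : ℝ) + 1)) (Filter.hyperfilter ℕ)
      (nhds (r + 0)) :=
    (tendsto_const_nhds.add tendsto_one_div_add_atTop_nhds_zero_nat).mono_left
      Nat.hyperfilter_le_atTop
  rw [add_zero] at h1
  exact le_of_tendsto_of_tendsto' (((hγ.tendsto _).comp (hf τ)).dist ((hη.tendsto _).comp (hg τ)))
    h1 fun n => hz4 n τ

/-- Curves parametrized over real intervals are at Fréchet distance at most `r` iff there is a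
monotone path through their free space. -/
theorem frechetDist_reparam_le_iff {α β : ℝ → Pt d} (hα : Continuous α) (hβ : Continuous β)
    {r : ℝ} (hr : 0 ≤ r) {s t s' t' : ℝ} (hst : s ≤ t) (hst' : s' ≤ t') :
    frechetDist (fun τ => α (s + τ * (t - s))) (fun τ => β (s' + τ * (t' - s'))) ≤
        ENNReal.ofReal r ↔
      HasMonotonePath {z | dist (α z.1) (β z.2) ≤ r} (s, s') (t, t') := by
  constructor
  · intro h
    obtain ⟨f, g, hf, hg, hfc, hgc, f0, f1, g0, g1, hd⟩ :=
      exists_matching (by fun_prop) (by fun_prop) hr h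
    refine ⟨⟨⟨fun τ => (s + f τ * (t - s), s' + g τ * (t' - s')), by fun_prop⟩,
      by simp [f0, g0], by simp [f1, g1]⟩, fun a b hab => ⟨?_, ?_⟩, fun τ => hd τ⟩
    · have := mul_le_mul_of_nonneg_right (Subtype.coe_le_coe.2 (hf hab)) (sub_nonneg.2 hst)
      simpa using this
    · have := mul_le_mul_of_nonneg_right (Subtype.coe_le_coe.2 (hg hab)) (sub_nonneg.2 hst')
      simpa using this
  · intro h
    obtain ⟨F, hc, hm, hA, e0, e1⟩ := h.exists_map
    have key : ∀ (a b : ℝ) (x : ℝ → ℝ), a ≤ b → Continuous x → Monotone x → x 0 = a → x 1 = b →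
        ∃ f : unitInterval → unitInterval, (Monotone f ∧ Function.Surjective f) ∧
          ∀ τ, a + f τ * (b - a) = x τ := by
      intro a b x hab hxc hxm h0 h1
      -- For a degenerate interval rescaling would divide by zero and not be surjective; as `x` is
      -- then constant on [0,1], the identity serves.
      rcases hab.eq_or_lt with rfl | hlt
      · refine ⟨id, ⟨monotone_id, Function.surjective_id⟩, fun τ => ?_⟩
        have u1 := hxm τ.2.1
        have u2 := hxm τ.2.2
        rw [h0] at u1
        rw [h1] at u2
        simp [le_antisymm u1 u2]
      · have hpos := sub_pos.2 hlt
        have hmem : ∀ τ : unitInterval, (x τ - a) / (b - a) ∈ Icc (0 : ℝ) 1 := fun τ => by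
          have u1 := hxm τ.2.1
          have u2 := hxm τ.2.2
          rw [h0] at u1
          rw [h1] at u2
          exact ⟨div_nonneg (by linarith) hpos.le, (div_le_one hpos).2 (by linarith)⟩
        refine ⟨fun τ => ⟨(x τ - a) / (b - a), hmem τ⟩, ⟨fun u v huv => ?_, ?_⟩, fun τ => ?_⟩
        · have := hxm (Subtype.coe_le_coe.2 huv)
          exact Subtype.mk_le_mk.2 (by gcongr)
        · refine surjective_of_continuous (by fun_prop) ?_ ?_
          · ext; simp [h0]
          · ext; simp [h1, hpos.ne']
        · simp only
          field_simp
          ring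
    obtain ⟨f, hf, ef⟩ := key s t (fun τ => (F τ).1) hst (by fun_prop)
      (fun a b hab => (hm hab).1) (by simp [e0]) (by simp [e1])
    obtain ⟨g, hg, eg⟩ := key s' t' (fun τ => (F τ).2) hst' (by fun_prop)
      (fun a b hab => (hm hab).2) (by simp [e0]) (by simp [e1])
    refine (iInf₂_le f hf).trans ((iInf₂_le g hg).trans (iSup_le fun τ => ?_))
    beta_reduce
    rw [ef, eg, edist_dist]
    exact ENNReal.ofReal_le_ofReal (hA τ)

/-! ### Parameters and edges of polygonal curves -/

namespace PolyCurve

theorem continuous_eval (P : PolyCurve d) : Continuous P.eval := by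
  unfold eval progress
  fun_prop

theorem param_mono (P : PolyCurve d) : Monotone P.param := P.param_strictMono.monotone

theorem param_mem (P : PolyCurve d) (i : Fin (P.numEdges + 1)) : P.param i ∈ Icc (0 : ℝ) 1 :=
  ⟨P.param_zero ▸ P.param_mono (Fin.zero_le i), P.param_last ▸ P.param_mono (Fin.le_last i)⟩

theorem edgeParams_subset (P : PolyCurve d) (i : Fin P.numEdges) :
    P.edgeParams i ⊆ Icc 0 1 := fun _ hx =>
  ⟨(P.param_mem _).1.trans hx.1, hx.2.trans (P.param_mem _).2⟩

theorem param_castSucc_lt (P : PolyCurve d) (i : Fin P.numEdges) :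
    P.param i.castSucc < P.param i.succ := P.param_strictMono Fin.castSucc_lt_succ

theorem param_succ_le (P : PolyCurve d) {i j : Fin P.numEdges} (h : i < j) :
    P.param i.succ ≤ P.param j.castSucc := P.param_mono (Fin.le_def.2 (by simpa using h))

/-- Every parameter lies on an edge, and the edge can be chosen to start strictly before it. -/
theorem exists_edge_Ioc (P : PolyCurve d) {x : ℝ} (h0 : 0 < x) (h1 : x ≤ 1) :
    ∃ i : Fin P.numEdges, P.param i.castSucc < x ∧ x ≤ P.param i.succ := by
  classical
  have hne : (Finset.univ.filter fun i : Fin (P.numEdges + 1) => x ≤ P.param i).Nonempty :=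
    ⟨Fin.last _, by simpa [P.param_last] using h1⟩
  obtain ⟨k, hk, hmin⟩ := Finset.exists_minimal hne
  rw [Finset.mem_filter] at hk
  have hk0 : k ≠ 0 := by
    rintro rfl
    exact absurd (hk.2.trans_eq P.param_zero) (not_le.2 h0)
  obtain ⟨i, rfl⟩ := Fin.exists_succ_eq.2 hk0
  refine ⟨i, ?_, hk.2⟩
  by_contra h
  have := hmin (y := i.castSucc) (by simpa using h) Fin.castSucc_lt_succ.le
  exact absurd this (not_le.2 Fin.castSucc_lt_succ)

theorem exists_edge (P : PolyCurve d) {x : ℝ} (hx : x ∈ Icc (0 : ℝ) 1) :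
    ∃ i : Fin P.numEdges, x ∈ P.edgeParams i := by
  rcases hx.1.eq_or_lt with rfl | h0
  · refine ⟨⟨0, P.numEdges_pos⟩, ?_, ?_⟩
    · exact P.param_zero.le
    · exact (P.param_mem _).1
  · obtain ⟨i, h1, h2⟩ := P.exists_edge_Ioc h0 hx.2
    exact ⟨i, h1.le, h2⟩

/-- The parameter on the curve of the point at fraction `y` of the `e`-th edge. -/
def edgeParam (P : PolyCurve d) (e : Fin P.numEdges) (y : ℝ) : ℝ :=
  P.param e.castSucc + y * (P.param e.succ - P.param e.castSucc)

theorem edgeParam_zero (P : PolyCurve d) (e : Fin P.numEdges) :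
    P.edgeParam e 0 = P.param e.castSucc := by simp [edgeParam]

theorem edgeParam_one (P : PolyCurve d) (e : Fin P.numEdges) :
    P.edgeParam e 1 = P.param e.succ := by simp [edgeParam]

theorem edgeParam_le_iff (P : PolyCurve d) (e : Fin P.numEdges) {y z : ℝ} :
    P.edgeParam e y ≤ P.edgeParam e z ↔ y ≤ z := by
  have := sub_pos.2 (P.param_castSucc_lt e)
  simp [edgeParam, mul_le_mul_iff_left₀ this]

theorem edgeParam_mem (P : PolyCurve d) (e : Fin P.numEdges) {y : ℝ} (hy : y ∈ Icc (0 : ℝ) 1) :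
    P.edgeParam e y ∈ P.edgeParams e := by
  constructor
  · rw [← edgeParam_zero, edgeParam_le_iff]; exact hy.1
  · rw [← edgeParam_one, edgeParam_le_iff]; exact hy.2

theorem exists_edgeParam_eq (P : PolyCurve d) (e : Fin P.numEdges) {x : ℝ}
    (hx : x ∈ P.edgeParams e) : ∃ y ∈ Icc (0 : ℝ) 1, P.edgeParam e y = x := by
  have h := sub_pos.2 (P.param_castSucc_lt e)
  refine ⟨(x - P.param e.castSucc) / (P.param e.succ - P.param e.castSucc), ⟨?_, ?_⟩, ?_⟩
  · exact div_nonneg (sub_nonneg.2 hx.1) h.le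
  · rw [div_le_one h]; linarith [hx.2]
  · unfold edgeParam; field_simp; ring

theorem eval_edgeParam (P : PolyCurve d) (e : Fin P.numEdges) {y : ℝ} (hy : y ∈ Icc (0 : ℝ) 1) :
    P.eval (P.edgeParam e y) =
      AffineMap.lineMap (P.vertex e.castSucc) (P.vertex e.succ) y := by
  rw [P.eval_of_mem e (P.edgeParam_mem e hy)]
  have h := sub_pos.2 (P.param_castSucc_lt e)
  congr 1
  unfold edgeParam
  field_simp
  ring

end PolyCurve

/-! ### The free space in a cell: reversal, convexity, compactness, ends of rows -/

section Cell
variable {P : PolyCurve d} {r : ℝ} {p q : Pt d}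

theorem cell_subset_freeSpace (i : Fin P.numEdges) : cell P r p q i ⊆ freeSpace P r p q :=
  fun _ h => h.1

theorem freeSpace_swap {x y : ℝ} : (x, y) ∈ freeSpace P r q p ↔ (x, 1 - y) ∈ freeSpace P r p q := by
  simp only [freeSpace, mem_ofPred_eq, AffineMap.lineMap_apply_one_sub, mem_Icc]
  constructor <;> rintro ⟨h1, ⟨h2, h3⟩, h4⟩ <;>
    exact ⟨h1, ⟨by linarith, by linarith⟩, h4⟩

theorem cell_swap {x y : ℝ} {i : Fin P.numEdges} :
    (x, y) ∈ cell P r q p i ↔ (x, 1 - y) ∈ cell P r p q i :=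
  and_congr_left' freeSpace_swap

theorem row_swap {y : ℝ} {i : Fin P.numEdges} : row P r q p i y = row P r p q i (1 - y) :=
  Set.ext fun _ => cell_swap

theorem leftEnd_swap {y : ℝ} {i : Fin P.numEdges} :
    leftEnd P r q p i y = leftEnd P r p q i (1 - y) := by
  unfold leftEnd; rw [row_swap]

theorem rightEnd_swap {y : ℝ} {i : Fin P.numEdges} :
    rightEnd P r q p i y = rightEnd P r p q i (1 - y) := by
  unfold rightEnd; rw [row_swap]

/-- Within a cell the difference of the two matched points is an affine function of (x, y), and
balls are convex. -/
theorem convex_cell (i : Fin P.numEdges) : Convex ℝ (cell P r p q i) := by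
  have h : cell P r p q i = {z : ℝ × ℝ | z.1 ∈ P.edgeParams i ∧ z.2 ∈ Icc (0 : ℝ) 1 ∧
      dist (AffineMap.lineMap (P.vertex i.castSucc) (P.vertex i.succ)
        ((z.1 - P.param i.castSucc) / (P.param i.succ - P.param i.castSucc)) : Pt d)
        (AffineMap.lineMap p q z.2) ≤ r} := by
    ext z
    simp only [cell, freeSpace, mem_ofPred_eq]
    constructor
    · rintro ⟨⟨-, h2, h3⟩, h4⟩
      exact ⟨h4, h2, by rwa [← P.eval_of_mem i h4]⟩
    · rintro ⟨h4, h2, h3⟩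
      exact ⟨⟨P.edgeParams_subset i h4, h2, by rwa [P.eval_of_mem i h4]⟩, h4⟩
  rw [h]
  have h1 : Convex ℝ {z : ℝ × ℝ | z.1 ∈ P.edgeParams i} :=
    (convex_Icc _ _).linear_preimage (LinearMap.fst ℝ ℝ ℝ)
  have h2 : Convex ℝ {z : ℝ × ℝ | z.2 ∈ Icc (0 : ℝ) 1} :=
    (convex_Icc _ _).linear_preimage (LinearMap.snd ℝ ℝ ℝ)
  refine h1.inter (h2.inter (t := {z : ℝ × ℝ | dist
        (AffineMap.lineMap (P.vertex i.castSucc) (P.vertex i.succ)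
        ((z.1 - P.param i.castSucc) / (P.param i.succ - P.param i.castSucc)) : Pt d)
        (AffineMap.lineMap p q z.2) ≤ r}) ?_)
  intro z hz w hw a b ha hb hab
  simp only [mem_ofPred_eq, dist_eq_norm] at hz hw ⊢
  have e : (AffineMap.lineMap (P.vertex i.castSucc) (P.vertex i.succ)
        (((a • z + b • w).1 - P.param i.castSucc) / (P.param i.succ - P.param i.castSucc)) : Pt d)
        - AffineMap.lineMap p q (a • z + b • w).2 =
      a • ((AffineMap.lineMap (P.vertex i.castSucc) (P.vertex i.succ)
        ((z.1 - P.param i.castSucc) / (P.param i.succ - P.param i.castSucc)) : Pt d)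
        - AffineMap.lineMap p q z.2) +
      b • ((AffineMap.lineMap (P.vertex i.castSucc) (P.vertex i.succ)
        ((w.1 - P.param i.castSucc) / (P.param i.succ - P.param i.castSucc)) : Pt d)
        - AffineMap.lineMap p q w.2) := by
    obtain rfl : b = 1 - a := by linarith
    have hne : P.param i.succ - P.param i.castSucc ≠ 0 := (sub_pos.2 (P.param_castSucc_lt i)).ne'
    simp only [AffineMap.lineMap_apply, Prod.fst_add, Prod.snd_add, Prod.smul_fst, Prod.smul_snd,
      smul_eq_mul, vsub_eq_sub, vadd_eq_add]
    ext k
    simp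
    field_simp
    ring
  rw [e]
  calc _ ≤ a * r + b * r := by
        refine (norm_add_le _ _).trans (add_le_add ?_ ?_) <;> rw [norm_smul, Real.norm_eq_abs]
        · rw [abs_of_nonneg ha]; exact mul_le_mul_of_nonneg_left hz ha
        · rw [abs_of_nonneg hb]; exact mul_le_mul_of_nonneg_left hw hb
    _ = r := by rw [← add_mul, hab, one_mul]

theorem isClosed_freeSpace : IsClosed (freeSpace P r p q) := by
  have := P.continuous_eval
  have h2 : Continuous fun y : ℝ => (AffineMap.lineMap p q y : Pt d) :=
    AffineMap.lineMap_continuous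
  exact (isClosed_Icc.preimage continuous_fst).inter
    ((isClosed_Icc.preimage continuous_snd).inter
      (isClosed_le (Continuous.dist (by fun_prop) (h2.comp continuous_snd)) continuous_const))

theorem isCompact_cell (i : Fin P.numEdges) : IsCompact (cell P r p q i) := by
  have h : IsCompact (Icc (0 : ℝ) 1 ×ˢ Icc (0 : ℝ) 1) := isCompact_Icc.prod isCompact_Icc
  refine h.of_isClosed_subset ?_ fun z hz => ⟨hz.1.1, hz.1.2.1⟩
  exact isClosed_freeSpace.inter (isClosed_Icc.preimage continuous_fst)

theorem isCompact_row (i : Fin P.numEdges) (y : ℝ) : IsCompact (row P r p q i y) := by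
  have h : row P r p q i y = Prod.fst '' (cell P r p q i ∩ {z | z.2 = y}) := by
    ext x
    constructor
    · intro h
      exact ⟨(x, y), ⟨h, rfl⟩, rfl⟩
    · rintro ⟨⟨a, b⟩, ⟨h, rfl⟩, rfl⟩
      exact h
  rw [h]
  exact ((isCompact_cell i).inter_right (isClosed_eq continuous_snd continuous_const)).image
    continuous_fst

/-- If the row is not empty, its left end belongs to it. -/
theorem exists_leftEnd_eq {i : Fin P.numEdges} {y : ℝ} (h : (row P r p q i y).Nonempty) :
    ∃ x, (x, y) ∈ cell P r p q i ∧ leftEnd P r p q i y = (x : EReal) ∧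
      ∀ x', (x', y) ∈ cell P r p q i → x ≤ x' := by
  refine ⟨sInf (row P r p q i y), (isCompact_row i y).sInf_mem h, ?_, fun x' hx' =>
    csInf_le (isCompact_row i y).bddBelow hx'⟩
  unfold leftEnd; rw [if_pos h]

theorem exists_rightEnd_eq {i : Fin P.numEdges} {y : ℝ} (h : (row P r p q i y).Nonempty) :
    ∃ x, (x, y) ∈ cell P r p q i ∧ rightEnd P r p q i y = (x : EReal) ∧
      ∀ x', (x', y) ∈ cell P r p q i → x' ≤ x := by
  refine ⟨sSup (row P r p q i y), (isCompact_row i y).sSup_mem h, ?_, fun x' hx' =>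
    le_csSup (isCompact_row i y).bddAbove hx'⟩
  unfold rightEnd; rw [if_pos h]

theorem row_nonempty_of_leftEnd_le {i : Fin P.numEdges} {y x : ℝ}
    (h : leftEnd P r p q i y ≤ (x : EReal)) : (row P r p q i y).Nonempty := by
  by_contra hne
  unfold leftEnd at h
  rw [if_neg hne] at h
  exact absurd h (by simp)

theorem row_nonempty_of_rightEnd_le {i : Fin P.numEdges} {y x : ℝ}
    (h : rightEnd P r p q i y ≤ (x : EReal)) : (row P r p q i y).Nonempty := by
  by_contra hne
  unfold rightEnd at h
  rw [if_neg hne] at h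
  exact absurd h (by simp)

end Cell

/-- A convex planar set that has points below and above a height has a point at that height. -/
theorem exists_mem_at_height {K : Set (ℝ × ℝ)} (hK : Convex ℝ K) {x₁ y₁ x₂ y₂ y : ℝ}
    (h₁ : (x₁, y₁) ∈ K) (h₂ : (x₂, y₂) ∈ K) (hy₁ : y₁ ≤ y) (hy₂ : y ≤ y₂) :
    ∃ x, (x, y) ∈ K ∧ min x₁ x₂ ≤ x ∧ x ≤ max x₁ x₂ := by
  rcases (hy₁.trans hy₂).eq_or_lt with rfl | hlt
  · obtain rfl := le_antisymm hy₁ hy₂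
    exact ⟨x₁, h₁, min_le_left _ _, le_max_left _ _⟩
  · have hpos := sub_pos.2 hlt
    set a := (y - y₁) / (y₂ - y₁) with ha
    have ha0 : 0 ≤ a := div_nonneg (by linarith) hpos.le
    have ha1 : a ≤ 1 := (div_le_one hpos).2 (by linarith)
    have hmem := hK h₁ h₂ (sub_nonneg.2 ha1) ha0 (by ring)
    have hy : a * (y₂ - y₁) = y - y₁ := div_mul_cancel₀ _ hpos.ne'
    refine ⟨(1 - a) * x₁ + a * x₂, ?_, ?_, ?_⟩
    · convert hmem using 1
      ext
      · simp
      · simp; linarith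
    · have h1 := min_le_left x₁ x₂
      have h2 := min_le_right x₁ x₂
      nlinarith
    · have h1 := le_max_left x₁ x₂
      have h2 := le_max_right x₁ x₂
      nlinarith

/-- Lexicographic minimization over a compact set. -/
theorem exists_lex_min {K : Set (ℝ × ℝ)} (hK : IsCompact K) (hne : K.Nonempty)
    {f g : ℝ × ℝ → ℝ} (hf : Continuous f) (hg : Continuous g) :
    ∃ z ∈ K, (∀ w ∈ K, f z ≤ f w) ∧ ∀ w ∈ K, f w = f z → g z ≤ g w := by
  obtain ⟨z, hz, hzm⟩ := hK.exists_isMinOn hne hf.continuousOn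
  obtain ⟨w, ⟨hw, hwe⟩, hwm⟩ := (hK.inter_right (isClosed_eq hf (continuous_const (y := f z)))
    ).exists_isMinOn ⟨z, hz, rfl⟩ hg.continuousOn
  have hwe : f w = f z := hwe
  exact ⟨w, hw, fun v hv => hwe ▸ hzm hv, fun v hv h => hwm ⟨hv, h.trans hwe⟩⟩

/-! ### Extremal points of cells -/

section Extremal
variable {P : PolyCurve d} {r : ℝ} {p q : Pt d} {i : Fin P.numEdges}

/-- Breaking ties by the other coordinate yields an endpoint of the segment of leftmost points, so
that its height counts as extremal. The other three directions are analogous. -/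
theorem exists_leftmost (h : (cell P r p q i).Nonempty) :
    ∃ x y, (x, y) ∈ cell P r p q i ∧ (∀ w ∈ cell P r p q i, x ≤ w.1) ∧
      y ∈ extremalHeights P r p q := by
  obtain ⟨⟨x, y⟩, hz, h1, h2⟩ := exists_lex_min (isCompact_cell i) h continuous_fst continuous_snd
  exact ⟨x, y, hz, h1, i, x, hz, Or.inl ⟨Or.inl h1, Or.inl h2⟩⟩

theorem exists_rightmost (h : (cell P r p q i).Nonempty) :
    ∃ x y, (x, y) ∈ cell P r p q i ∧ (∀ w ∈ cell P r p q i, w.1 ≤ x) ∧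
      y ∈ extremalHeights P r p q := by
  obtain ⟨⟨x, y⟩, hz, h1, h2⟩ :=
    exists_lex_min (isCompact_cell i) h continuous_fst.neg continuous_snd
  simp only [Pi.neg_apply, neg_le_neg_iff, neg_inj] at h1 h2
  exact ⟨x, y, hz, h1, i, x, hz, Or.inl ⟨Or.inr h1, Or.inl h2⟩⟩

theorem exists_bottommost (h : (cell P r p q i).Nonempty) :
    ∃ x y, (x, y) ∈ cell P r p q i ∧ (∀ w ∈ cell P r p q i, y ≤ w.2) ∧
      y ∈ extremalHeights P r p q := by
  obtain ⟨⟨x, y⟩, hz, h1, h2⟩ := exists_lex_min (isCompact_cell i) h continuous_snd continuous_fst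
  exact ⟨x, y, hz, h1, i, x, hz, Or.inr ⟨Or.inl h1, Or.inl h2⟩⟩

theorem exists_topmost (h : (cell P r p q i).Nonempty) :
    ∃ x y, (x, y) ∈ cell P r p q i ∧ (∀ w ∈ cell P r p q i, w.2 ≤ y) ∧
      y ∈ extremalHeights P r p q := by
  obtain ⟨⟨x, y⟩, hz, h1, h2⟩ :=
    exists_lex_min (isCompact_cell i) h continuous_snd.neg continuous_fst
  simp only [Pi.neg_apply, neg_le_neg_iff, neg_inj] at h1 h2
  exact ⟨x, y, hz, h1, i, x, hz, Or.inr ⟨Or.inr h1, Or.inl h2⟩⟩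

end Extremal

/-- The abscissa `x` is covered by a monotone path in `A` from height `s` to height `t`. -/
def Covers (A : Set (ℝ × ℝ)) (s t x : ℝ) : Prop :=
  ∃ x₁ x₂, x₁ ≤ x ∧ x ≤ x₂ ∧ HasMonotonePath A (x₁, s) (x₂, t)

/-! ### Soundness of the proxy coverage -/

section
variable {P : PolyCurve d} {r : ℝ} {p q : Pt d}

theorem cell_path {i : Fin P.numEdges} {x y x' y' : ℝ} (h : (x, y) ∈ cell P r p q i)
    (h' : (x', y') ∈ cell P r p q i) (hx : x ≤ x') (hy : y ≤ y') :
    HasMonotonePath (freeSpace P r p q) (x, y) (x', y') :=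
  hasMonotonePath_segment (convex_cell i) (cell_subset_freeSpace i) h h' ⟨hx, hy⟩

/-- A path between different cells leaves the first through its right side and enters the last
through its left side. By convexity its ends can then be exchanged for any other free points of
these two cells at the same heights. -/
theorem exists_crossing {a b : Fin P.numEdges} (hab : a < b) {x₁ x₂ s t : ℝ}
    (hx₁ : x₁ ∈ P.edgeParams a) (hx₂ : x₂ ∈ P.edgeParams b)
    (h : HasMonotonePath (freeSpace P r p q) (x₁, s) (x₂, t)) :
    ∃ y y', s ≤ y ∧ y ≤ y' ∧ y' ≤ t ∧ (P.param a.succ, y) ∈ cell P r p q a ∧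
      (P.param b.castSucc, y') ∈ cell P r p q b ∧
      HasMonotonePath (freeSpace P r p q) (P.param a.succ, y) (P.param b.castSucc, y') := by
  have hle := P.param_succ_le hab
  obtain ⟨y, h1, h2⟩ := h.split_fst (x := P.param a.succ) hx₁.2 (hle.trans hx₂.1)
  obtain ⟨y', h3, h4⟩ := h2.split_fst (x := P.param b.castSucc) hle hx₂.1
  exact ⟨y, y', h1.le.2, h3.le.2, h4.le.2, ⟨h3.left_mem, (P.param_castSucc_lt a).le, le_rfl⟩,
    ⟨h3.right_mem, le_rfl, (P.param_castSucc_lt b).le⟩, h3⟩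

theorem leftEnd_le_of_mem {i : Fin P.numEdges} {x y : ℝ} (h : (x, y) ∈ cell P r p q i) :
    leftEnd P r p q i y ≤ (x : EReal) := by
  obtain ⟨z, -, hz, hm⟩ := exists_leftEnd_eq ⟨x, h⟩
  rw [hz]
  exact EReal.coe_le_coe_iff.2 (hm x h)

theorem le_rightEnd_of_mem {i : Fin P.numEdges} {x y : ℝ} (h : (x, y) ∈ cell P r p q i) :
    (x : EReal) ≤ rightEnd P r p q i y := by
  obtain ⟨z, -, hz, hm⟩ := exists_rightEnd_eq ⟨x, h⟩
  rw [hz]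
  exact EReal.coe_le_coe_iff.2 (hm x h)

/-- An index is bad if the cell connects its left boundary to height `t` and height `s` to its
right boundary, while the row at height `t` is to the left of the row at height `s`. -/
theorem bad_of_rows_lt {s t : ℝ} {b : Fin P.numEdges} {y y' w w' : ℝ} (hw : (w, s) ∈ cell P r p q b)
    (hw' : (w', t) ∈ cell P r p q b) (hl : leftEnd P r p q b s = (w : EReal))
    (hr : rightEnd P r p q b t = (w' : EReal)) (hlt : w' < w)
    (hleft : (P.param b.castSucc, y) ∈ cell P r p q b) (hy : s ≤ y)
    (hright : (P.param b.succ, y') ∈ cell P r p q b) (hy' : y' ≤ t) : Bad P r p q s t b := by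
  constructor
  · rintro ⟨x, h⟩ hz hmax
    -- The segment from the point on the right side up to the topmost point meets height `t` no
    -- further left than the topmost point, whose abscissa is thus at most `r_b(t)`.
    obtain ⟨v, hv, hv1, -⟩ := exists_mem_at_height (convex_cell b) hright hz hy' (hmax _ hw')
    rw [min_eq_right hz.2.2] at hv1
    have hxv : (x : EReal) ≤ (w' : EReal) :=
      (EReal.coe_le_coe_iff.2 hv1).trans (hr ▸ le_rightEnd_of_mem hv)
    rw [hl, hr]
    exact ⟨hxv.trans (EReal.coe_le_coe_iff.2 hlt.le), hxv⟩
  · rintro ⟨x, h⟩ hz hmin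
    obtain ⟨v, hv, -, hv1⟩ := exists_mem_at_height (convex_cell b) hz hleft (hmin _ hw) hy
    rw [max_eq_left hz.2.1] at hv1
    have hxv : (w : EReal) ≤ (x : EReal) :=
      (hl ▸ leftEnd_le_of_mem hv).trans (EReal.coe_le_coe_iff.2 hv1)
    rw [hl, hr]
    exact ⟨hxv, (EReal.coe_le_coe_iff.2 hlt.le).trans hxv⟩

/-- Merging creates no path from the first cell to the last one; it only keeps the covered intervals
free of gaps, hence `Covers` pointwise. The points on the right side of cell `a` and the left side
of cell `b` are part of the induction because the touching case needs them: a gap inside the shared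
cell would make that cell bad. -/
theorem Merged.spec {s t : ℝ} {a b : Fin P.numEdges} (h : Merged P r p q s t a b) :
    a < b ∧ (∃ z, (z, s) ∈ cell P r p q a) ∧ (∃ z, (z, t) ∈ cell P r p q b) ∧
      (∃ y, (P.param a.succ, y) ∈ cell P r p q a ∧ y ≤ t) ∧
      (∃ y, (P.param b.castSucc, y) ∈ cell P r p q b ∧ s ≤ y) ∧
      ∀ z z' x, (z, s) ∈ cell P r p q a → (z', t) ∈ cell P r p q b → z ≤ x → x ≤ z' →
        Covers (freeSpace P r p q) s t x := by
  induction h with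
  | base hrep hab =>
    obtain ⟨⟨x₁, hx₁, x₂, hx₂, hpath⟩, -⟩ := hrep
    obtain ⟨y, y', h1, h2, h3, h4, h5, h6⟩ := exists_crossing hab hx₁ hx₂ hpath
    refine ⟨hab, ⟨x₁, hpath.left_mem, hx₁⟩, ⟨x₂, hpath.right_mem, hx₂⟩, ⟨y, h4, h2.trans h3⟩,
      ⟨y', h5, h1.trans h2⟩, fun z z' x hz hz' hx hx' => ⟨z, z', hx, hx', ?_⟩⟩
    exact ((cell_path hz h4 hz.2.2 h1).trans h6).trans (cell_path h5 hz' hz'.2.1 h3)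
  | overlap _ _ h1 h2 h3 ih ih' =>
    obtain ⟨-, e2, ⟨w', hw'⟩, e4, -, e6⟩ := ih
    obtain ⟨-, ⟨w, hw⟩, f3, -, f5, f6⟩ := ih'
    refine ⟨h1.trans (h2.trans h3), e2, f3, e4, f5, fun z z' x hz hz' hx hx' => ?_⟩
    -- `w` lies in an earlier cell than `w'`, so the intervals ending at `w'` and starting at `w`
    -- leave no gap.
    rcases le_total x w' with h | h
    · exact e6 z w' x hz hw' hx h
    · exact f6 w z' x hw hz'
        ((hw.2.2.trans (P.param_succ_le h2)).trans (hw'.2.1.trans h)) hx'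
  | touch _ _ hgood ih ih' =>
    obtain ⟨e1, e2, ⟨w', hw'⟩, e4, ⟨y, e5, e5'⟩, e6⟩ := ih
    obtain ⟨f1, ⟨w, hw⟩, f3, ⟨y', f4, f4'⟩, f5, f6⟩ := ih'
    refine ⟨e1.trans f1, e2, f3, e4, f5, fun z z' x hz hz' hx hx' => ?_⟩
    obtain ⟨u, hu, hul, -⟩ := exists_leftEnd_eq ⟨w, hw⟩
    obtain ⟨u', hu', hur, -⟩ := exists_rightEnd_eq ⟨w', hw'⟩
    -- The two intervals end at `r_b(t)` and start at `l_b(s)`; a gap between these contradicts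
    -- goodness of the shared index.
    rcases lt_or_ge u' u with hlt | hle
    · exact absurd (bad_of_rows_lt hu hu' hul hur hlt e5 e5' f4 f4') hgood
    rcases le_total x u' with h | h
    · exact e6 z u' x hz hu' hx h
    · exact f6 u z' x hu hz' (hle.trans h) hx'

theorem mem_span_iff {a b x : ℝ} : x ∈ span (a : EReal) (b : EReal) ↔ x ∈ Icc a b := by
  simp [span]

theorem exists_hatLeft_eq {s t : ℝ} {a : Fin P.numEdges} (h : ∃ z, (z, s) ∈ cell P r p q a) :
    ∃ z, (z, s) ∈ cell P r p q a ∧ hatLeft P r p q s t a = (z : EReal) ∧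
      ((z : EReal) = leftEnd P r p q a s ∨ (z : EReal) = rightEnd P r p q a s) := by
  obtain ⟨u, hu, hul, -⟩ := exists_leftEnd_eq h
  obtain ⟨v, hv, hvr, -⟩ := exists_rightEnd_eq h
  unfold hatLeft
  split_ifs
  · exact ⟨v, hv, hvr, Or.inr hvr.symm⟩
  · exact ⟨u, hu, hul, Or.inl hul.symm⟩

theorem exists_hatRight_eq {s t : ℝ} {a : Fin P.numEdges} (h : ∃ z, (z, t) ∈ cell P r p q a) :
    ∃ z, (z, t) ∈ cell P r p q a ∧ hatRight P r p q s t a = (z : EReal) ∧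
      ((z : EReal) = leftEnd P r p q a t ∨ (z : EReal) = rightEnd P r p q a t) := by
  obtain ⟨u, hu, hul, -⟩ := exists_leftEnd_eq h
  obtain ⟨v, hv, hvr, -⟩ := exists_rightEnd_eq h
  unfold hatRight
  split_ifs
  · exact ⟨u, hu, hul, Or.inl hul.symm⟩
  · exact ⟨v, hv, hvr, Or.inr hvr.symm⟩

/-- The proxy coverage of a subedge is a union of intervals between ends of rows, and contained in
the coverage. -/
theorem exists_Icc_of_mem_proxySubedge {s t x : ℝ} (h : x ∈ proxySubedge P r p q s t) :
    ∃ i j z z', (z, s) ∈ cell P r p q i ∧ (z', t) ∈ cell P r p q j ∧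
      ((z : EReal) = leftEnd P r p q i s ∨ (z : EReal) = rightEnd P r p q i s) ∧
      ((z' : EReal) = leftEnd P r p q j t ∨ (z' : EReal) = rightEnd P r p q j t) ∧
      x ∈ Icc z z' ∧ Icc z z' ⊆ proxySubedge P r p q s t ∧
      ∀ x' ∈ Icc z z', Covers (freeSpace P r p q) s t x' := by
  rcases h with ⟨i, hrep, hgood, hx⟩ | ⟨i, j, hred, hx⟩
  · obtain ⟨⟨x₁, hx₁, x₂, hx₂, hpath⟩, -⟩ := id hrep
    obtain ⟨u, hu, hul, -⟩ := exists_leftEnd_eq ⟨x₁, hpath.left_mem, hx₁⟩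
    obtain ⟨v, hv, hvr, -⟩ := exists_rightEnd_eq ⟨x₂, hpath.right_mem, hx₂⟩
    rw [hul, hvr, mem_span_iff] at hx
    refine ⟨i, i, u, v, hu, hv, Or.inl hul.symm, Or.inr hvr.symm, hx,
      fun x' hx' => Or.inl ⟨i, hrep, hgood, ?_⟩, fun x' hx' => ⟨u, v, hx'.1, hx'.2, ?_⟩⟩
    · rwa [hul, hvr, mem_span_iff]
    · exact cell_path hu hv (hx.1.trans hx.2) hpath.le.2
  · obtain ⟨-, h2, h3, -, -, h6⟩ := hred.1.spec
    obtain ⟨u, hu, hul, hu'⟩ := exists_hatLeft_eq (t := t) h2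
    obtain ⟨v, hv, hvr, hv'⟩ := exists_hatRight_eq (s := s) h3
    rw [hul, hvr, mem_span_iff] at hx
    refine ⟨i, j, u, v, hu, hv, hu', hv', hx, fun x' hx' => Or.inr ⟨i, j, hred, ?_⟩,
      fun x' hx' => h6 u v x' hu hv hx'.1 hx'.2⟩
    rwa [hul, hvr, mem_span_iff]

/-! ### Completeness of the proxy coverage -/

theorem exists_le_maximal_pair {n : ℕ} {R : Fin n → Fin n → Prop} {i j : Fin n} (h : R i j) :
    ∃ a b, a ≤ i ∧ j ≤ b ∧ R a b ∧ ∀ i' j', R i' j' → i' ≤ a → b ≤ j' → i' = a ∧ j' = b := by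
  obtain ⟨⟨a, b⟩, hle, hmax⟩ := (Set.toFinite
    {z : (Fin n)ᵒᵈ × Fin n | R (OrderDual.ofDual z.1) z.2}).exists_le_maximal
    (a := (OrderDual.toDual i, j)) h
  refine ⟨OrderDual.ofDual a, b, hle.1, hle.2, hmax.prop, fun i' j' h' hi hj => ?_⟩
  have := hmax.eq_of_le (y := (OrderDual.toDual i', j')) h' ⟨hi, hj⟩
  rw [Prod.mk.injEq] at this
  exact ⟨this.1 ▸ rfl, this.2.symm⟩

/-- A point in the interior of the `k`-th edge that is covered is in the proxy coverage, or the
index `k` is bad. -/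
theorem mem_proxySubedge_or_bad {s t x : ℝ} {i j k : Fin P.numEdges}
    (hx : x ∈ Ioo (P.param k.castSucc) (P.param k.succ)) (hij : Connects P r p q s t i j)
    (hik : i ≤ k) (hkj : k ≤ j)
    (hl : i = k → ∃ z ≤ x, (z, s) ∈ cell P r p q k)
    (hr : j = k → ∃ z ≥ x, (z, t) ∈ cell P r p q k) :
    x ∈ proxySubedge P r p q s t ∨ Bad P r p q s t k ∧
      (∃ z ≤ x, (z, s) ∈ cell P r p q k ∨ (z, t) ∈ cell P r p q k) ∧
      (∃ z ≥ x, (z, s) ∈ cell P r p q k ∨ (z, t) ∈ cell P r p q k) := by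
  by_cases hbad : Bad P r p q s t k ∧
      (∃ z ≤ x, (z, s) ∈ cell P r p q k ∨ (z, t) ∈ cell P r p q k) ∧
      (∃ z ≥ x, (z, s) ∈ cell P r p q k ∨ (z, t) ∈ cell P r p q k)
  · exact Or.inr hbad
  left
  obtain ⟨a, b, hai, hjb, hab, hmax⟩ := exists_le_maximal_pair hij
  have hl' : a = k → ∃ z ≤ x, (z, s) ∈ cell P r p q k := fun h =>
    hl (le_antisymm hik (h ▸ hai))
  have hr' : b = k → ∃ z ≥ x, (z, t) ∈ cell P r p q k := fun h =>
    hr (le_antisymm (h ▸ hjb) hkj)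
  rcases (hai.trans (hik.trans (hkj.trans hjb))).eq_or_lt with rfl | hlt
  · obtain rfl : a = k := le_antisymm (hai.trans hik) (hkj.trans hjb)
    obtain ⟨z, hz, hz'⟩ := hl' rfl
    obtain ⟨w, hw, hw'⟩ := hr' rfl
    refine Or.inl ⟨a, ⟨hab, hmax⟩, fun hb => hbad ⟨hb, ⟨z, hz, Or.inl hz'⟩, ⟨w, hw, Or.inr hw'⟩⟩,
      (leftEnd_le_of_mem hz').trans (EReal.coe_le_coe_iff.2 hz),
      (EReal.coe_le_coe_iff.2 hw).trans (le_rightEnd_of_mem hw')⟩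
  · obtain ⟨a', b', haa, hbb, hm, hmax'⟩ := exists_le_maximal_pair
      (R := Merged P r p q s t) (Merged.base ⟨hab, hmax⟩ hlt)
    refine Or.inr ⟨a', b', ⟨hm, hmax'⟩, ?_, ?_⟩
    · rcases (haa.trans (hai.trans hik)).eq_or_lt with h | h
      · obtain rfl : a = k := le_antisymm (hai.trans hik) (h ▸ haa)
        obtain rfl := h
        obtain ⟨z, hz, hz'⟩ := hl' rfl
        unfold hatLeft
        split_ifs with hb
        -- If `x` were to the left of `r_k(s)`, the row at height `s` would have points on both
        -- sides of `x`, which is the excluded alternative `hbad`.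
        · obtain ⟨v, hv, hvr, hv'⟩ := exists_rightEnd_eq ⟨z, hz'⟩
          rw [hvr, EReal.coe_le_coe_iff]
          by_contra hlt
          exact hbad ⟨hb, ⟨z, hz, Or.inl hz'⟩, ⟨v, (not_le.1 hlt).le, Or.inl hv⟩⟩
        · exact (leftEnd_le_of_mem hz').trans (EReal.coe_le_coe_iff.2 hz)
      · obtain ⟨z, hz, hzl, -⟩ := exists_hatLeft_eq (t := t) hm.spec.2.1
        rw [hzl, EReal.coe_le_coe_iff]
        exact hz.2.2.trans ((P.param_succ_le h).trans hx.1.le)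
    · rcases ((hkj.trans hjb).trans hbb).eq_or_lt with h | h
      · obtain rfl : b = k := le_antisymm (h ▸ hbb) (hkj.trans hjb)
        obtain rfl := h
        obtain ⟨z, hz, hz'⟩ := hr' rfl
        unfold hatRight
        split_ifs with hb
        · obtain ⟨v, hv, hvr, hv'⟩ := exists_leftEnd_eq ⟨z, hz'⟩
          rw [hvr, EReal.coe_le_coe_iff]
          by_contra hlt
          exact hbad ⟨hb, ⟨v, (not_le.1 hlt).le, Or.inr hv⟩, ⟨z, hz, Or.inr hz'⟩⟩
        · exact (EReal.coe_le_coe_iff.2 hz).trans (le_rightEnd_of_mem hz')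
      · obtain ⟨z, hz, hzl, -⟩ := exists_hatRight_eq (s := s) hm.spec.2.2.1
        rw [hzl, EReal.coe_le_coe_iff]
        exact hx.2.le.trans ((P.param_succ_le h).trans hz.2.1)

/-- In a bad cell, a reversed monotone path covers everything between points at the two heights. -/
theorem Bad.exists_reversed {s t x : ℝ} {k : Fin P.numEdges} (h : Bad P r p q s t k)
    (hst : s ≤ t) (hl : ∃ z ≤ x, (z, s) ∈ cell P r p q k ∨ (z, t) ∈ cell P r p q k)
    (hr : ∃ z ≥ x, (z, s) ∈ cell P r p q k ∨ (z, t) ∈ cell P r p q k) :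
    (∃ z ≤ x, (z, t) ∈ cell P r p q k) ∧ (∃ z ≥ x, (z, s) ∈ cell P r p q k) := by
  obtain ⟨z, hzx, hz⟩ := hl
  obtain ⟨w, hxw, hw⟩ := hr
  have hne : (cell P r p q k).Nonempty := hz.elim (fun h => ⟨_, h⟩) fun h => ⟨_, h⟩
  obtain ⟨xT, yT, hT, hTm, -⟩ := exists_topmost hne
  obtain ⟨xB, yB, hB, hBm, -⟩ := exists_bottommost hne
  obtain ⟨h1, h2⟩ := h.1 _ hT hTm
  obtain ⟨h3, h4⟩ := h.2 _ hB hBm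
  obtain ⟨u, hu⟩ := row_nonempty_of_leftEnd_le h3
  obtain ⟨v, hv⟩ := row_nonempty_of_rightEnd_le h4
  constructor
  · rcases hz with hz | hz
    -- The topmost point is to the left of `l_k(s)`, so the segment from `(z, s)` up to it meets
    -- height `t` to the left of `z`.
    · have hTz : xT ≤ z := EReal.coe_le_coe_iff.1 (h1.trans (leftEnd_le_of_mem hz))
      obtain ⟨m, hm, -, hm'⟩ := exists_mem_at_height (convex_cell k) hz hT hst (hTm _ hv)
      rw [max_eq_left hTz] at hm'
      exact ⟨m, hm'.trans hzx, hm⟩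
    · exact ⟨z, hzx, hz⟩
  · rcases hw with hw | hw
    · exact ⟨w, hxw, hw⟩
    · have hBw : w ≤ xB := EReal.coe_le_coe_iff.1 ((le_rightEnd_of_mem hw).trans h4)
      obtain ⟨m, hm, hm', -⟩ := exists_mem_at_height (convex_cell k) hB hw (hBm _ hu) hst
      rw [min_eq_right hBw] at hm'
      exact ⟨m, hxw.trans hm', hm⟩

/-- Every covered point is in the proxy coverage of the subedge or its reversal, except for
the ends of rows and vertices. -/
theorem mem_proxySubedge_or_reversed {s t x : ℝ} (hx : x ∉ range P.param)
    (hlt : ∀ k, (x : EReal) ≠ leftEnd P r p q k t)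
    (h : Covers (freeSpace P r p q) s t x) :
    x ∈ proxySubedge P r p q s t ∨ x ∈ proxySubedge P r q p (1 - t) (1 - s) := by
  obtain ⟨x₁, x₂, h1, h2, hpath⟩ := h
  have m1 := hpath.left_mem
  have m2 := hpath.right_mem
  have hst : s ≤ t := hpath.le.2
  have hx01 : x ∈ Icc (0 : ℝ) 1 := ⟨m1.1.1.trans h1, h2.trans m2.1.2⟩
  obtain ⟨k, hk1, hk2⟩ := P.exists_edge hx01
  have hk : x ∈ Ioo (P.param k.castSucc) (P.param k.succ) :=
    ⟨lt_of_le_of_ne hk1 fun h => hx ⟨_, h⟩, lt_of_le_of_ne hk2 fun h => hx ⟨_, h.symm⟩⟩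
  obtain ⟨i, hi, hik⟩ : ∃ i, x₁ ∈ P.edgeParams i ∧ i ≤ k := by
    obtain ⟨i, hi⟩ := P.exists_edge m1.1
    refine ⟨i, hi, not_lt.1 fun hlt => ?_⟩
    exact absurd (hk.2.trans_le ((P.param_succ_le hlt).trans hi.1)) (not_lt.2 h1)
  obtain ⟨j, hj, hkj⟩ : ∃ j, x₂ ∈ P.edgeParams j ∧ k ≤ j := by
    obtain ⟨j, hj⟩ := P.exists_edge m2.1
    refine ⟨j, hj, not_lt.1 fun hlt => ?_⟩
    exact absurd ((hj.2.trans (P.param_succ_le hlt)).trans_lt hk.1) (not_lt.2 h2)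
  rcases mem_proxySubedge_or_bad hk ⟨x₁, hi, x₂, hj, hpath⟩ hik hkj
    (fun h => ⟨x₁, h1, m1, h ▸ hi⟩) (fun h => ⟨x₂, h2, m2, h ▸ hj⟩) with h | ⟨hbad, hl, hr⟩
  · exact Or.inl h
  right
  obtain ⟨⟨z, hzx, hz⟩, ⟨w, hxw, hw⟩⟩ := hbad.exists_reversed hst hl hr
  have hz' : (z, 1 - t) ∈ cell P r q p k := cell_swap.2 (by rwa [sub_sub_cancel])
  have hw' : (w, 1 - s) ∈ cell P r q p k := cell_swap.2 (by rwa [sub_sub_cancel])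
  rcases mem_proxySubedge_or_bad (p := q) (q := p) (s := 1 - t) (t := 1 - s) hk
    ⟨z, hz.2, w, hw.2, cell_path hz' hw' (hzx.trans hxw) (by linarith)⟩ le_rfl le_rfl
    (fun _ => ⟨z, hzx, hz'⟩) (fun _ => ⟨w, hxw, hw'⟩) with h | ⟨hbad', -, -⟩
  · exact h
  -- Reversal exchanges topmost and bottommost points. Badness in both directions therefore gives
  -- opposite inequalities, and the chain below pins `x` to `l_k(t)`, which is excluded.
  exfalso
  obtain ⟨xT, yT, hT, hTm, -⟩ := exists_topmost ⟨_, hz⟩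
  obtain ⟨xB, yB, hB, hBm, -⟩ := exists_bottommost ⟨_, hz⟩
  obtain ⟨h1, h2⟩ := hbad.1 _ hT hTm
  obtain ⟨h3, h4⟩ := hbad.2 _ hB hBm
  obtain ⟨h5, h6⟩ := hbad'.1 (xB, 1 - yB) (cell_swap.2 (by rwa [sub_sub_cancel]))
    fun v hv => by have := hBm _ (cell_swap.1 hv); simp only at this ⊢; linarith
  obtain ⟨h7, h8⟩ := hbad'.2 (xT, 1 - yT) (cell_swap.2 (by rwa [sub_sub_cancel]))
    fun v hv => by have := hTm _ (cell_swap.1 hv); simp only at this ⊢; linarith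
  rw [leftEnd_swap, sub_sub_cancel] at h5 h7
  rw [rightEnd_swap, sub_sub_cancel] at h6 h8
  refine hlt k (le_antisymm ?_ ?_)
  · calc (x : EReal) ≤ (w : EReal) := EReal.coe_le_coe_iff.2 hxw
      _ ≤ rightEnd P r p q k s := le_rightEnd_of_mem hw
      _ ≤ (xT : EReal) := h8
      _ ≤ leftEnd P r p q k s := h1
      _ ≤ (xB : EReal) := h3
      _ ≤ leftEnd P r p q k t := h5
  · exact (leftEnd_le_of_mem hz).trans (EReal.coe_le_coe_iff.2 hzx)

end

/-! ### Finite sets of heights, and cutting paths at a height -/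

/-- `ε < ε'` are consecutive elements of `E`. -/
structure Consecutive (E : Finset ℝ) (ε ε' : ℝ) : Prop where
  left_mem : ε ∈ E
  right_mem : ε' ∈ E
  lt : ε < ε'
  le_or_le : ∀ y ∈ E, y ≤ ε ∨ ε' ≤ y

theorem exists_consecutive {E : Finset ℝ} {u y₀ y₁ : ℝ} (hu : u ∉ E) (h₀ : y₀ ∈ E) (h₁ : y₁ ∈ E)
    (h₀u : y₀ ≤ u) (hu₁ : u ≤ y₁) : ∃ ε ε', Consecutive E ε ε' ∧ ε < u ∧ u < ε' := by
  have hne : ∀ y ∈ E, y ≠ u := fun y hy h => hu (h ▸ hy)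
  obtain ⟨ε, hε, hmax⟩ := (E.filter (· ≤ u)).exists_max_image id ⟨y₀, by simp [h₀, h₀u]⟩
  obtain ⟨ε', hε', hmin⟩ := (E.filter (u ≤ ·)).exists_min_image id ⟨y₁, by simp [h₁, hu₁]⟩
  simp only [Finset.mem_filter, id, and_imp] at hε hε' hmax hmin
  have h1 := lt_of_le_of_ne hε.2 (hne ε hε.1)
  have h2 := lt_of_le_of_ne hε'.2 (hne ε' hε'.1).symm
  refine ⟨ε, ε', ⟨hε.1, hε'.1, h1.trans h2, fun y hy => ?_⟩, h1, h2⟩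
  exact (le_total y u).imp (hmax y hy) (hmin y hy)

/-- The first element of a finite set after one of its elements. -/
theorem exists_consecutive_right {E : Finset ℝ} {ε y : ℝ} (hε : ε ∈ E) (hy : y ∈ E) (h : ε < y) :
    ∃ ε', Consecutive E ε ε' := by
  obtain ⟨ε', hε', hmin⟩ := (E.filter (ε < ·)).exists_min_image id ⟨y, by simp [hy, h]⟩
  simp only [Finset.mem_filter, id, and_imp] at hε' hmin
  exact ⟨ε', hε, hε'.1, hε'.2, fun z hz => (le_or_gt z ε).imp_right (hmin z hz)⟩

theorem exists_consecutive_left {E : Finset ℝ} {ε y : ℝ} (hε : ε ∈ E) (hy : y ∈ E) (h : y < ε) :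
    ∃ ε', Consecutive E ε' ε := by
  obtain ⟨ε', hε', hmax⟩ := (E.filter (· < ε)).exists_max_image id ⟨y, by simp [hy, h]⟩
  simp only [Finset.mem_filter, id, and_imp] at hε' hmax
  exact ⟨ε', hε'.1, hε, hε'.2, fun z hz => (lt_or_ge z ε).imp_left (hmax z hz)⟩

theorem Consecutive.card_filter {E : Finset ℝ} {ε ε' : ℝ} (h : Consecutive E ε ε') :
    {z ∈ E | ε ≤ z ∧ z < ε'}.card = 1 := by
  rw [Finset.card_eq_one]
  refine ⟨ε, Finset.ext fun z => ?_⟩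
  simp only [Finset.mem_filter, Finset.mem_singleton]
  constructor
  · rintro ⟨hz, h1, h2⟩
    exact ((h.le_or_le z hz).resolve_right (not_le.2 h2)).antisymm h1
  · rintro rfl
    exact ⟨h.left_mem, le_rfl, h.lt⟩

/-- Passing to the next element raises the count by exactly one, so every intermediate count occurs.
-/
theorem exists_card_filter_eq {E : Finset ℝ} {a b : ℝ} (ha : a ∈ E) (hb : b ∈ E) (hab : a ≤ b)
    (k : ℕ) (hk : k ≤ {z ∈ E | a ≤ z ∧ z < b}.card) :
    ∃ c ∈ E, a ≤ c ∧ c ≤ b ∧ {z ∈ E | a ≤ z ∧ z < c}.card = k := by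
  induction k with
  | zero => exact ⟨a, ha, le_rfl, hab, by simp⟩
  | succ k ih =>
    obtain ⟨c, hc, hac, hcb, hcard⟩ := ih (by omega)
    have hlt : c < b := lt_of_le_of_ne hcb (by rintro rfl; omega)
    obtain ⟨c', h⟩ := exists_consecutive_right hc hb hlt
    refine ⟨c', h.right_mem, hac.trans h.lt.le,
      (h.le_or_le b hb).resolve_left (not_le.2 hlt), ?_⟩
    have : {z ∈ E | a ≤ z ∧ z < c'} = {z ∈ E | a ≤ z ∧ z < c} ∪ {z ∈ E | c ≤ z ∧ z < c'} := by
      ext z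
      simp only [Finset.mem_filter, Finset.mem_union]
      constructor
      · rintro ⟨h1, h2, h3⟩
        exact (lt_or_ge z c).imp (fun h => ⟨h1, h2, h⟩) fun h => ⟨h1, h, h3⟩
      · rintro (⟨h1, h2, h3⟩ | ⟨h1, h2, h3⟩)
        · exact ⟨h1, h2, h3.trans h.lt⟩
        · exact ⟨h1, hac.trans h2, h3⟩
    rw [this, Finset.card_union_of_disjoint, hcard, h.card_filter]
    rw [Finset.disjoint_left]
    intro z hz hz'
    rw [Finset.mem_filter] at hz hz'
    exact absurd hz.2.2 (not_lt.2 hz'.2.1)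

/-- An interval of a finite set is the union of two subintervals whose size is a power of two. -/
theorem exists_dyadic_split {E : Finset ℝ} {a b : ℝ} (ha : a ∈ E) (hb : b ∈ E) (hab : a < b) :
    ∃ c ∈ E, ∃ c' ∈ E, ∃ m ≤ Nat.log 2 E.card, a ≤ c' ∧ c' ≤ c ∧ c ≤ b ∧
      {z ∈ E | a ≤ z ∧ z < c}.card = 2 ^ m ∧ {z ∈ E | c' ≤ z ∧ z < b}.card = 2 ^ m := by
  set n := {z ∈ E | a ≤ z ∧ z < b}.card with hn
  have hn0 : n ≠ 0 := Finset.card_ne_zero_of_mem (a := a) (by simp [ha, hab])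
  have h1 : 2 ^ Nat.log 2 n ≤ n := Nat.pow_log_le_self 2 hn0
  have h2 : n < 2 ^ (Nat.log 2 n + 1) := Nat.lt_pow_succ_log_self (by norm_num) n
  rw [pow_succ] at h2
  obtain ⟨c, hc, hac, hcb, hcc⟩ := exists_card_filter_eq ha hb hab.le (2 ^ Nat.log 2 n) h1
  -- With `2 ^ m` the largest power of two up to `n`, the second block consists of the last `2 ^ m`
  -- steps; the blocks leave no gap because `n < 2 * 2 ^ m`.
  obtain ⟨c', hc', hac', hcb', hcc'⟩ :=
    exists_card_filter_eq ha hb hab.le (n - 2 ^ Nat.log 2 n) (Nat.sub_le _ _)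
  refine ⟨c, hc, c', hc', Nat.log 2 n, Nat.log_mono_right (Finset.card_filter_le _ _), hac', ?_,
    hcb, hcc, ?_⟩
  · by_contra hlt
    have : {z ∈ E | a ≤ z ∧ z < c}.card ≤ {z ∈ E | a ≤ z ∧ z < c'}.card := by
      refine Finset.card_le_card fun z hz => ?_
      rw [Finset.mem_filter] at hz ⊢
      exact ⟨hz.1, hz.2.1, hz.2.2.trans (not_le.1 hlt)⟩
    omega
  · have : {z ∈ E | a ≤ z ∧ z < b} = {z ∈ E | a ≤ z ∧ z < c'} ∪ {z ∈ E | c' ≤ z ∧ z < b} := by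
      ext z
      simp only [Finset.mem_filter, Finset.mem_union]
      constructor
      · rintro ⟨h1, h2, h3⟩
        exact (lt_or_ge z c').imp (fun h => ⟨h1, h2, h⟩) fun h => ⟨h1, h, h3⟩
      · rintro (⟨h1, h2, h3⟩ | ⟨h1, h2, h3⟩)
        · exact ⟨h1, h2, h3.trans_le hcb'⟩
        · exact ⟨h1, hac'.trans h2, h3⟩
    have hd : Disjoint {z ∈ E | a ≤ z ∧ z < c'} {z ∈ E | c' ≤ z ∧ z < b} := by
      rw [Finset.disjoint_left]
      intro z hz hz'
      rw [Finset.mem_filter] at hz hz'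
      exact absurd hz.2.2 (not_lt.2 hz'.2.1)
    rw [this, Finset.card_union_of_disjoint hd, hcc'] at hn
    omega

/-- `x` lies on one side of the point where the path reaches height `a`. The strict inequality
records that the lower piece is never a single height. -/
theorem Covers.split_left {A : Set (ℝ × ℝ)} {u v a x : ℝ} (h : Covers A u v x) (hu : u ≤ a)
    (hv : a ≤ v) : u < a ∧ Covers A u a x ∨ Covers A a v x := by
  rcases hu.eq_or_lt with rfl | hlt
  · exact Or.inr h
  obtain ⟨x₁, x₂, h1, h2, h⟩ := h
  obtain ⟨z, hz, hz'⟩ := h.split_snd hu hv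
  rcases le_total x z with hx | hx
  · exact Or.inl ⟨hlt, x₁, z, h1, hx, hz⟩
  · exact Or.inr ⟨z, x₂, hx, h2, hz'⟩

theorem Covers.split_right {A : Set (ℝ × ℝ)} {u v b x : ℝ} (h : Covers A u v x) (hu : u ≤ b)
    (hv : b ≤ v) : Covers A u b x ∨ b < v ∧ Covers A b v x := by
  rcases hv.eq_or_lt with rfl | hlt
  · exact Or.inl h
  obtain ⟨x₁, x₂, h1, h2, h⟩ := h
  obtain ⟨z, hz, hz'⟩ := h.split_snd hu hv
  rcases le_total x z with hx | hx
  · exact Or.inl ⟨x₁, z, h1, hx, hz⟩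
  · exact Or.inr ⟨hlt, z, x₂, hx, h2, hz'⟩

/-- Cutting at height `a` decides which piece covers `x`; the upper piece is then prolonged
downwards to `b` along the path. -/
theorem Covers.split_overlap {A : Set (ℝ × ℝ)} {u v a b x : ℝ} (h : Covers A u v x) (hu : u ≤ b)
    (hba : b ≤ a) (hv : a ≤ v) : Covers A u a x ∨ Covers A b v x := by
  obtain ⟨x₁, x₂, h1, h2, h⟩ := h
  obtain ⟨z, hz, hz'⟩ := h.split_snd hu (hba.trans hv)
  obtain ⟨w, hw, hw'⟩ := hz'.split_snd hba hv
  rcases le_total x w with hx | hx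
  · exact Or.inl ⟨x₁, w, h1, hx, hz.trans hw⟩
  · exact Or.inr ⟨z, x₂, hw.le.1.trans hx, h2, hz'⟩

/-- A vertex lies on two edges, so independent choices may come in the wrong order; in that case the
edge chosen for `x₂` contains both points. -/
theorem PolyCurve.exists_edges_le (P : PolyCurve d) {x₁ x₂ : ℝ} (h₁ : x₁ ∈ Icc (0 : ℝ) 1)
    (h₂ : x₂ ∈ Icc (0 : ℝ) 1) (h : x₁ ≤ x₂) :
    ∃ i j, i ≤ j ∧ x₁ ∈ P.edgeParams i ∧ x₂ ∈ P.edgeParams j := by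
  obtain ⟨i, hi⟩ := P.exists_edge h₁
  obtain ⟨j, hj⟩ := P.exists_edge h₂
  rcases le_or_gt i j with hij | hij
  · exact ⟨i, j, hij, hi, hj⟩
  · exact ⟨j, j, le_rfl, ⟨(P.param_castSucc_lt j).le.trans ((P.param_succ_le hij).trans hi.1),
      h.trans hj.2⟩, hj⟩

/-! ### Strips between consecutive heights -/

section Strip
variable {P : PolyCurve d} {r : ℝ} {p q : Pt d} {E : Finset ℝ} {ε ε' : ℝ}

theorem reversed_cell_path {i : Fin P.numEdges} {x x' y y' : ℝ} (h : (x, y') ∈ cell P r p q i)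
    (h' : (x', y) ∈ cell P r p q i) (hx : x ≤ x') (hy : y ≤ y') :
    HasMonotonePath (freeSpace P r q p) (x, 1 - y') (x', 1 - y) :=
  cell_path (i := i) (cell_swap.2 (by rwa [sub_sub_cancel])) (cell_swap.2 (by rwa [sub_sub_cancel]))
    hx (by linarith)

/-- A cell that meets the interior of a strip between consecutive heights meets both of its
boundary lines. -/
theorem rows_nonempty_of_consecutive (hE : extremalHeights P r p q ⊆ E) (h : Consecutive E ε ε')
    {i : Fin P.numEdges} {x u : ℝ} (hx : (x, u) ∈ cell P r p q i) (hu : ε < u) (hu' : u < ε') :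
    (∃ z, (z, ε) ∈ cell P r p q i) ∧ ∃ z, (z, ε') ∈ cell P r p q i := by
  obtain ⟨xB, yB, hB, hBm, hBE⟩ := exists_bottommost ⟨_, hx⟩
  obtain ⟨xT, yT, hT, hTm, hTE⟩ := exists_topmost ⟨_, hx⟩
  have h1 : yB ≤ ε := (h.le_or_le yB (hE hBE)).resolve_right
    (not_le.2 ((hBm _ hx).trans_lt hu'))
  have h2 : ε' ≤ yT := (h.le_or_le yT (hE hTE)).resolve_left
    (not_le.2 (hu.trans_le (hTm _ hx)))
  obtain ⟨z, hz, -⟩ := exists_mem_at_height (convex_cell i) hB hx h1 hu.le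
  obtain ⟨z', hz', -⟩ := exists_mem_at_height (convex_cell i) hx hT hu'.le h2
  exact ⟨⟨z, hz⟩, ⟨z', hz'⟩⟩

/-- The leftmost point of the cell is not strictly inside the strip, so the segment that joins it to
`(x, u)` meets one of the two boundary lines, to the left of `x`. -/
theorem exists_left_of_consecutive (hE : extremalHeights P r p q ⊆ E) (h : Consecutive E ε ε')
    {i : Fin P.numEdges} {x u : ℝ} (hx : (x, u) ∈ cell P r p q i) (hu : ε < u) (hu' : u < ε') :
    ∃ z ≤ x, (z, ε) ∈ cell P r p q i ∨ (z, ε') ∈ cell P r p q i := by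
  obtain ⟨xL, yL, hL, hLm, hLE⟩ := exists_leftmost ⟨_, hx⟩
  have hxx : xL ≤ x := hLm _ hx
  rcases h.le_or_le yL (hE hLE) with h1 | h1
  · obtain ⟨z, hz, -, hz'⟩ := exists_mem_at_height (convex_cell i) hL hx h1 hu.le
    exact ⟨z, by rwa [max_eq_right hxx] at hz', Or.inl hz⟩
  · obtain ⟨z, hz, -, hz'⟩ := exists_mem_at_height (convex_cell i) hx hL hu'.le h1
    exact ⟨z, by rwa [max_eq_left hxx] at hz', Or.inr hz⟩

theorem exists_right_of_consecutive (hE : extremalHeights P r p q ⊆ E) (h : Consecutive E ε ε')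
    {i : Fin P.numEdges} {x u : ℝ} (hx : (x, u) ∈ cell P r p q i) (hu : ε < u) (hu' : u < ε') :
    ∃ z ≥ x, (z, ε) ∈ cell P r p q i ∨ (z, ε') ∈ cell P r p q i := by
  obtain ⟨xR, yR, hR, hRm, hRE⟩ := exists_rightmost ⟨_, hx⟩
  have hxx : x ≤ xR := hRm _ hx
  rcases h.le_or_le yR (hE hRE) with h1 | h1
  · obtain ⟨z, hz, hz', -⟩ := exists_mem_at_height (convex_cell i) hR hx h1 hu.le
    exact ⟨z, by rwa [min_eq_right hxx] at hz', Or.inl hz⟩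
  · obtain ⟨z, hz, hz', -⟩ := exists_mem_at_height (convex_cell i) hx hR hu'.le h1
    exact ⟨z, by rwa [min_eq_left hxx] at hz', Or.inr hz⟩

/-- What a subedge in a strip between consecutive heights covers is covered by the subedge between
these two heights or its reversal. -/
theorem covers_of_strip (hE : extremalHeights P r p q ⊆ E) (h : Consecutive E ε ε') {u v x : ℝ}
    (hu : ε ≤ u) (hv : v ≤ ε') (hin : u ∈ Ioo ε ε' ∨ v ∈ Ioo ε ε')
    (hx : Covers (freeSpace P r p q) u v x) :
    Covers (freeSpace P r p q) ε ε' x ∨ Covers (freeSpace P r q p) (1 - ε') (1 - ε) x := by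
  obtain ⟨x₁, x₂, hx1, hx2, hpath⟩ := hx
  have huv : u ≤ v := hpath.le.2
  have m1 := hpath.left_mem
  have m2 := hpath.right_mem
  obtain ⟨i, j, hij, hi, hj⟩ := P.exists_edges_le m1.1 m2.1 hpath.le.1
  have c1 : (x₁, u) ∈ cell P r p q i := ⟨m1, hi⟩
  have c2 : (x₂, v) ∈ cell P r p q j := ⟨m2, hj⟩
  have hu' : u = ε ∨ ε < u ∧ u < ε' := by
    rcases hu.eq_or_lt with h | h
    · exact Or.inl h.symm
    · refine Or.inr ⟨h, ?_⟩
      rcases hin with h' | h'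
      · exact h'.2
      · exact huv.trans_lt h'.2
  have hv' : v = ε' ∨ ε < v ∧ v < ε' := by
    rcases hv.eq_or_lt with h | h
    · exact Or.inl h
    · refine Or.inr ⟨?_, h⟩
      rcases hin with h' | h'
      · exact h'.1.trans_le huv
      · exact h'.1
  have hL : ∃ z ≤ x, (z, ε) ∈ cell P r p q i ∨ (z, ε') ∈ cell P r p q i := by
    rcases hu' with rfl | hu'
    · exact ⟨x₁, hx1, Or.inl c1⟩
    · obtain ⟨z, hz, hz'⟩ := exists_left_of_consecutive hE h c1 hu'.1 hu'.2
      exact ⟨z, hz.trans hx1, hz'⟩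
  have hR : ∃ z ≥ x, (z, ε) ∈ cell P r p q j ∨ (z, ε') ∈ cell P r p q j := by
    rcases hv' with rfl | hv'
    · exact ⟨x₂, hx2, Or.inr c2⟩
    · obtain ⟨z, hz, hz'⟩ := exists_right_of_consecutive hE h c2 hv'.1 hv'.2
      exact ⟨z, hx2.trans hz, hz'⟩
  obtain ⟨z, hzx, hz⟩ := hL
  obtain ⟨w, hxw, hw⟩ := hR
  rcases hij.eq_or_lt with rfl | hij
  · obtain ⟨⟨a, ha⟩, ⟨b, hb⟩⟩ :
        (∃ z, (z, ε) ∈ cell P r p q i) ∧ ∃ z, (z, ε') ∈ cell P r p q i := by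
      rcases hin with h' | h'
      · exact rows_nonempty_of_consecutive hE h c1 h'.1 h'.2
      · exact rows_nonempty_of_consecutive hE h c2 h'.1 h'.2
    have fwd : ∀ z w, z ≤ x → x ≤ w → (z, ε) ∈ cell P r p q i → (w, ε') ∈ cell P r p q i →
        Covers (freeSpace P r p q) ε ε' x := fun z w hz hw h1 h2 =>
      ⟨z, w, hz, hw, cell_path h1 h2 (hz.trans hw) h.lt.le⟩
    have bwd : ∀ z w, z ≤ x → x ≤ w → (z, ε') ∈ cell P r p q i → (w, ε) ∈ cell P r p q i →
        Covers (freeSpace P r q p) (1 - ε') (1 - ε) x := fun z w hz hw h1 h2 =>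
      ⟨z, w, hz, hw, reversed_cell_path h1 h2 (hz.trans hw) h.lt.le⟩
    -- If `z` and `w` are on different lines, they determine the direction. If both are on the same
    -- line, any point of the cell on the other line is left or right of `x` and is combined with
    -- `w` or `z` accordingly.
    rcases hz with hz | hz <;> rcases hw with hw | hw
    · rcases le_total b x with hbx | hbx
      · exact Or.inr (bwd b w hbx hxw hb hw)
      · exact Or.inl (fwd z b hzx hbx hz hb)
    · exact Or.inl (fwd z w hzx hxw hz hw)
    · exact Or.inr (bwd z w hzx hxw hz hw)
    · rcases le_total a x with hax | hax
      · exact Or.inl (fwd a w hax hxw ha hw)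
      · exact Or.inr (bwd z a hzx hax hz ha)
  · by_cases hrev : Covers (freeSpace P r q p) (1 - ε') (1 - ε) x
    · exact Or.inr hrev
    left
    obtain ⟨y, y', h1, h2, h3, h4, h5, h6⟩ := exists_crossing hij hi hj hpath
    -- If the left point is only known at height `ε'` while a point at height `ε` is to the right of
    -- `x`, this one cell already lets the reversed strip cover `x`.
    obtain ⟨z, hzx, hz⟩ : ∃ z ≤ x, (z, ε) ∈ cell P r p q i := by
      rcases hz with hz | hz
      · exact ⟨z, hzx, hz⟩
      rcases hu' with rfl | hu'
      · exact ⟨x₁, hx1, c1⟩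
      obtain ⟨⟨a, ha⟩, -⟩ := rows_nonempty_of_consecutive hE h c1 hu'.1 hu'.2
      refine ⟨a, not_lt.1 fun hlt => hrev ?_, ha⟩
      exact ⟨z, a, hzx, hlt.le, reversed_cell_path hz ha (hzx.trans hlt.le) h.lt.le⟩
    obtain ⟨w, hxw, hw⟩ : ∃ w ≥ x, (w, ε') ∈ cell P r p q j := by
      rcases hw with hw | hw
      swap
      · exact ⟨w, hxw, hw⟩
      rcases hv' with rfl | hv'
      · exact ⟨x₂, hx2, c2⟩
      obtain ⟨-, ⟨a, ha⟩⟩ := rows_nonempty_of_consecutive hE h c2 hv'.1 hv'.2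
      refine ⟨a, not_lt.1 fun hlt => hrev ?_, ha⟩
      exact ⟨a, w, hlt.le, hxw, reversed_cell_path ha hw (hlt.le.trans hxw) h.lt.le⟩
    exact ⟨z, w, hzx, hxw, ((cell_path hz h4 hz.2.2 (hu.trans h1)).trans h6).trans
      (cell_path h5 hw hw.2.1 (h3.trans hv))⟩

/-- A free point whose distance is less than the radius is covered by the subedge that ends or the
subedge that starts at its height. -/
theorem covers_of_dist_lt (hE : extremalHeights P r p q ⊆ E) {x w : ℝ} (hw : w ∈ E)
    (hw01 : w ∈ Icc (0 : ℝ) 1) (hx01 : x ∈ Icc (0 : ℝ) 1)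
    (hx : dist (P.eval x) (AffineMap.lineMap p q w) < r) :
    (∃ ε, Consecutive E ε w ∧ (Covers (freeSpace P r p q) ε w x ∨
      Covers (freeSpace P r q p) (1 - w) (1 - ε) x)) ∨
    ∃ ε, Consecutive E w ε ∧ (Covers (freeSpace P r p q) w ε x ∨
      Covers (freeSpace P r q p) (1 - ε) (1 - w) x) := by
  obtain ⟨k, hk⟩ := P.exists_edge hx01
  have hxw : (x, w) ∈ cell P r p q k := ⟨⟨hx01, hw01, hx.le⟩, hk⟩
  -- Strictness leaves room for a second free height `y`. The cell then extends beyond `w` on the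
  -- side of `y`, so `E` has a neighbour of `w` there and the cell reaches it.
  obtain ⟨y, hy01, hyw, hy⟩ : ∃ y ∈ Icc (0 : ℝ) 1, y ≠ w ∧
      dist (P.eval x) (AffineMap.lineMap p q y) < r := by
    have hc : Continuous fun y : ℝ => dist (P.eval x) (AffineMap.lineMap p q y) :=
      continuous_const.dist AffineMap.lineMap_continuous
    obtain ⟨δ, hδ, hball⟩ := Metric.isOpen_iff.1 (isOpen_lt hc continuous_const) w hx
    have hmem : ∀ y, |y - w| < δ → dist (P.eval x) (AffineMap.lineMap p q y) < r := fun y hy =>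
      hball (by rwa [Metric.mem_ball, Real.dist_eq])
    rcases le_or_gt w (1 / 2) with h | h
    · refine ⟨w + min (δ / 2) (1 / 2), ⟨?_, ?_⟩, ?_, hmem _ ?_⟩
      · have : 0 < min (δ / 2) (1 / 2) := by positivity
        linarith [hw01.1]
      · linarith [min_le_right (δ / 2) (1 / 2)]
      · have : 0 < min (δ / 2) (1 / 2) := by positivity
        linarith
      · have : 0 < min (δ / 2) (1 / 2) := by positivity
        rw [add_sub_cancel_left, abs_of_pos this]
        linarith [min_le_left (δ / 2) (1 / 2)]
    · refine ⟨w - min (δ / 2) (1 / 2), ⟨?_, ?_⟩, ?_, hmem _ ?_⟩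
      · linarith [min_le_right (δ / 2) (1 / 2)]
      · have : 0 < min (δ / 2) (1 / 2) := by positivity
        linarith [hw01.2]
      · have : 0 < min (δ / 2) (1 / 2) := by positivity
        linarith
      · have : 0 < min (δ / 2) (1 / 2) := by positivity
        rw [sub_sub_cancel_left, abs_neg, abs_of_pos this]
        linarith [min_le_left (δ / 2) (1 / 2)]
  have hxy : (x, y) ∈ cell P r p q k := ⟨⟨hx01, hy01, hy.le⟩, hk⟩
  rcases hyw.lt_or_gt with hlt | hlt
  · obtain ⟨xB, yB, hB, hBm, hBE⟩ := exists_bottommost ⟨_, hxw⟩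
    obtain ⟨ε, hε⟩ := exists_consecutive_left hw (hE hBE) ((hBm _ hxy).trans_lt hlt)
    obtain ⟨z, hz, -⟩ := exists_mem_at_height (convex_cell k) hB hxw
      ((hε.le_or_le yB (hE hBE)).resolve_right (not_le.2 ((hBm _ hxy).trans_lt hlt))) hε.lt.le
    refine Or.inl ⟨ε, hε, (le_total z x).imp (fun h => ?_) fun h => ?_⟩
    · exact ⟨z, x, h, le_rfl, cell_path hz hxw h hε.lt.le⟩
    · exact ⟨x, z, le_rfl, h, reversed_cell_path hxw hz h hε.lt.le⟩
  · obtain ⟨xT, yT, hT, hTm, hTE⟩ := exists_topmost ⟨_, hxw⟩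
    obtain ⟨ε, hε⟩ := exists_consecutive_right hw (hE hTE) (lt_of_lt_of_le hlt (hTm _ hxy))
    obtain ⟨z, hz, -⟩ := exists_mem_at_height (convex_cell k) hxw hT hε.lt.le
      ((hε.le_or_le yT (hE hTE)).resolve_left (not_le.2 (lt_of_lt_of_le hlt (hTm _ hxy))))
    refine Or.inr ⟨ε, hε, (le_total x z).imp (fun h => ?_) fun h => ?_⟩
    · exact ⟨x, z, le_rfl, h, cell_path hxw hz h hε.lt.le⟩
    · exact ⟨z, x, h, le_rfl, reversed_cell_path hz hxw h hε.lt.le⟩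

end Strip

/-! ### Coverings by a bounded number of candidates -/

/-- The free space of the edge `e` of `S`. -/
abbrev edgeSpace (P S : PolyCurve d) (r : ℝ) (e : Fin S.numEdges) : Set (ℝ × ℝ) :=
  freeSpace P r (S.vertex e.castSucc) (S.vertex e.succ)

/-- The free space of the reversal of the edge `e` of `S`. -/
abbrev edgeSpaceRev (P S : PolyCurve d) (r : ℝ) (e : Fin S.numEdges) : Set (ℝ × ℝ) :=
  freeSpace P r (S.vertex e.succ) (S.vertex e.castSucc)

/-- The free space of two polygonal curves. -/
def curveSpaceFree (P S : PolyCurve d) (r : ℝ) : Set (ℝ × ℝ) :=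
  {z | z.1 ∈ Icc (0 : ℝ) 1 ∧ z.2 ∈ Icc (0 : ℝ) 1 ∧ dist (P.eval z.1) (S.eval z.2) ≤ r}

/-- The parameters that are neither vertices nor breakpoints. -/
def generic (P S : PolyCurve d) (r : ℝ) (E : Fin S.numEdges → Finset ℝ) : Set ℝ :=
  {x | x ∉ range P.param ∧ x ∉ breakpoints P S r E}

/-- The set `X` is covered by the proxy coverages of at most `n` candidates. -/
def CoveredBy (P : PolyCurve d) {S : PolyCurve d} (r : ℝ) (ℓ : ℕ) (E : Fin S.numEdges → Finset ℝ)
    (n : ℕ) (X : Set ℝ) : Prop :=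
  ∃ L : List (Candidate S), L.length ≤ n ∧ (∀ c ∈ L, IsCandidate ℓ E c) ∧
    ∀ x ∈ X, ∃ c ∈ L, x ∈ c.proxy P r

section
variable {P S : PolyCurve d} {r : ℝ} {ℓ : ℕ} {E : Fin S.numEdges → Finset ℝ}

theorem CoveredBy.mono {n m : ℕ} {X Y : Set ℝ} (h : CoveredBy P r ℓ E n X) (hnm : n ≤ m)
    (hYX : Y ⊆ X) : CoveredBy P r ℓ E m Y :=
  let ⟨L, h1, h2, h3⟩ := h
  ⟨L, h1.trans hnm, h2, fun x hx => h3 x (hYX hx)⟩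

theorem CoveredBy.union {n m : ℕ} {X Y : Set ℝ} (h : CoveredBy P r ℓ E n X)
    (h' : CoveredBy P r ℓ E m Y) : CoveredBy P r ℓ E (n + m) (X ∪ Y) := by
  obtain ⟨L, h1, h2, h3⟩ := h
  obtain ⟨L', h1', h2', h3'⟩ := h'
  refine ⟨L ++ L', by rw [List.length_append]; omega, fun c hc => ?_, fun x hx => ?_⟩
  · exact (List.mem_append.1 hc).elim (h2 c) (h2' c)
  · rcases hx with hx | hx
    · obtain ⟨c, hc, hxc⟩ := h3 x hx
      exact ⟨c, List.mem_append.2 (Or.inl hc), hxc⟩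
    · obtain ⟨c, hc, hxc⟩ := h3' x hx
      exact ⟨c, List.mem_append.2 (Or.inr hc), hxc⟩

theorem coveredBy_empty : CoveredBy P r ℓ E 0 ∅ :=
  ⟨[], le_rfl, by simp, by simp⟩

/-! ### Subcurves of an edge -/

/-- A free point at height 0 or 1 is bottommost or topmost in its cell. Hence the ends 0 and 1 of
Type (II) candidates produce no row ends besides breakpoints. -/
theorem height_mem {p q : Pt d} {F : Finset ℝ} (hF : extremalHeights P r p q ⊆ F)
    {i : Fin P.numEdges} {x y : ℝ} (hx : (x, y) ∈ cell P r p q i)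
    (hy : y ∈ F ∨ y = 0 ∨ y = 1) : y ∈ F := by
  rcases hy with hy | rfl | rfl
  · exact hy
  · obtain ⟨z, y, hz, hm, hy⟩ := exists_bottommost ⟨_, hx⟩
    obtain rfl : (0 : ℝ) = y := le_antisymm hz.1.2.1.1 (hm _ hx)
    exact hF hy
  · obtain ⟨z, y, hz, hm, hy⟩ := exists_topmost ⟨_, hx⟩
    obtain rfl : (1 : ℝ) = y := le_antisymm (hm _ hx) hz.1.2.1.2
    exact hF hy

variable (hE : ∀ e, extremalHeights P r (S.vertex e.castSucc) (S.vertex e.succ) ⊆ (E e : Set ℝ))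

include hE

theorem leftEnd_ne_of_generic {x y : ℝ} {e : Fin S.numEdges} (hx : x ∈ generic P S r E)
    (hy : y ∈ E e ∨ y = 0 ∨ y = 1) (k : Fin P.numEdges) :
    (x : EReal) ≠ leftEnd P r (S.vertex e.castSucc) (S.vertex e.succ) k y := fun h => by
  obtain ⟨z, hz⟩ := row_nonempty_of_leftEnd_le h.ge
  exact hx.2 (Or.inr ⟨e, y, height_mem (hE e) hz hy, k, Or.inl h⟩)

/-- The two candidates are the subedge and its reversal: each makes up for what the proxy of the
other loses in bad cells. -/
theorem coveredBy_pair {e : Fin S.numEdges} {s t : ℝ} (hs : s ∈ E e ∨ s = 0 ∨ s = 1)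
    (ht : t ∈ E e ∨ t = 0 ∨ t = 1) (hc : ∀ b, IsCandidate ℓ E (.subedge e s t b)) :
    CoveredBy P r ℓ E 2 {x | x ∈ generic P S r E ∧ (Covers (edgeSpace P S r e) s t x ∨
      Covers (edgeSpaceRev P S r e) (1 - t) (1 - s) x)} := by
  refine ⟨[.subedge e s t false, .subedge e s t true], le_rfl, by simp [hc], ?_⟩
  rintro x ⟨hx, h | h⟩
  · rcases mem_proxySubedge_or_reversed hx.1 (leftEnd_ne_of_generic hE hx ht) h with h | h
    · exact ⟨.subedge e s t false, by simp, h⟩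
    · exact ⟨.subedge e s t true, by simp, h⟩
  · have hne (k) : (x : EReal) ≠
        leftEnd P r (S.vertex e.succ) (S.vertex e.castSucc) k (1 - s) := by
      rw [leftEnd_swap, sub_sub_cancel]
      exact leftEnd_ne_of_generic hE hx hs k
    rcases mem_proxySubedge_or_reversed hx.1 hne h with h | h
    · exact ⟨.subedge e s t true, by simp, h⟩
    · rw [sub_sub_cancel, sub_sub_cancel] at h
      exact ⟨.subedge e s t false, by simp, h⟩

theorem coveredBy_consecutive {e : Fin S.numEdges} {ε ε' : ℝ} (h : Consecutive (E e) ε ε') :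
    CoveredBy P r ℓ E 2 {x | x ∈ generic P S r E ∧ (Covers (edgeSpace P S r e) ε ε' x ∨
      Covers (edgeSpaceRev P S r e) (1 - ε') (1 - ε) x)} :=
  coveredBy_pair hE (Or.inl h.left_mem) (Or.inl h.right_mem) fun b =>
    .typeIII e ε ε' b 0 h.left_mem h.right_mem (Nat.zero_le _) h.card_filter

/-- Subedges that start or end at `u` and have no element of `E e` in their interior. -/
theorem coveredBy_strip {e : Fin S.numEdges} {u : ℝ} (hu : u ∉ E e) :
    CoveredBy P r ℓ E 2 {x | x ∈ generic P S r E ∧ ∃ a b, a ≤ u ∧ u ≤ b ∧ (a = u ∨ b = u) ∧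
      (∀ y ∈ E e, ¬ (a < y ∧ y < b)) ∧ Covers (edgeSpace P S r e) a b x} := by
  by_cases h : ∃ ε ε', Consecutive (E e) ε ε' ∧ ε < u ∧ u < ε'
  · obtain ⟨ε, ε', h, h1, h2⟩ := h
    refine (coveredBy_consecutive hE h).mono le_rfl ?_
    rintro x ⟨hx, a, b, ha, hb, hab, hno, hcov⟩
    refine ⟨hx, covers_of_strip (hE e) h ?_ ?_ ?_ hcov⟩
    · exact not_lt.1 fun hlt => hno ε h.left_mem ⟨hlt, h1.trans_le hb⟩
    · exact not_lt.1 fun hlt => hno ε' h.right_mem ⟨ha.trans_lt h2, hlt⟩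
    · rcases hab with rfl | rfl
      · exact Or.inl ⟨h1, h2⟩
      · exact Or.inr ⟨h1, h2⟩
  -- A cell that meets height `u` would have its extremal heights below and above `u`, hence
  -- neighbours of `u` in `E e`. Here there are none, so nothing is covered.
  · refine coveredBy_empty.mono (Nat.zero_le _) ?_
    rintro x ⟨-, a, b, -, -, hab, -, x₁, x₂, -, -, hpath⟩
    obtain ⟨z, hz⟩ : ∃ z, (z, u) ∈ edgeSpace P S r e := by
      rcases hab with rfl | rfl
      · exact ⟨x₁, hpath.left_mem⟩
      · exact ⟨x₂, hpath.right_mem⟩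
    obtain ⟨k, hk⟩ := P.exists_edge hz.1
    have hzk : (z, u) ∈ cell P r (S.vertex e.castSucc) (S.vertex e.succ) k := ⟨hz, hk⟩
    obtain ⟨_, yB, _, hBm, hBE⟩ := exists_bottommost ⟨_, hzk⟩
    obtain ⟨_, yT, _, hTm, hTE⟩ := exists_topmost ⟨_, hzk⟩
    exact h (exists_consecutive hu (hE e hBE) (hE e hTE) (hBm _ hzk) (hTm _ hzk))

/-- Two overlapping blocks of a power of two of heights, each in both directions. -/
theorem coveredBy_between {e : Fin S.numEdges} {a b : ℝ} (ha : a ∈ E e) (hb : b ∈ E e)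
    (hab : a < b) :
    CoveredBy P r ℓ E 4 {x | x ∈ generic P S r E ∧ Covers (edgeSpace P S r e) a b x} := by
  obtain ⟨c, hc, c', hc', m, hm, h1, h2, h3, h4, h5⟩ := exists_dyadic_split ha hb hab
  refine ((coveredBy_pair (ℓ := ℓ) hE (Or.inl ha) (Or.inl hc) fun i =>
    .typeIII e a c i m ha hc hm h4).union (coveredBy_pair hE (Or.inl hc') (Or.inl hb) fun i =>
    .typeIII e c' b i m hc' hb hm h5)).mono le_rfl ?_
  rintro x ⟨hx, h⟩
  exact (h.split_overlap h1 h2 h3).imp (fun h => ⟨hx, Or.inl h⟩) fun h => ⟨hx, Or.inl h⟩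

/-- Between the lowest height `a` and the highest height `b` of `E e` in [u, v] four candidates
suffice; the two remainders lie in strips, at two candidates each. -/
theorem coveredBy_subedge {e : Fin S.numEdges} {u v : ℝ} (huv : u < v) :
    CoveredBy P r ℓ E 8 {x | x ∈ generic P S r E ∧ Covers (edgeSpace P S r e) u v x} := by
  rcases (((E e).filter fun y => u ≤ y ∧ y ≤ v)).eq_empty_or_nonempty with hemp | hne
  · have hno : ∀ y ∈ E e, ¬ (u ≤ y ∧ y ≤ v) := by simpa [Finset.filter_eq_empty_iff] using hemp
    have hu : u ∉ E e := fun h => hno u h ⟨le_rfl, huv.le⟩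
    refine (coveredBy_strip hE hu).mono (by norm_num) ?_
    rintro x ⟨hx, h⟩
    exact ⟨hx, u, v, le_rfl, huv.le, Or.inl rfl, fun y hy h => hno y hy ⟨h.1.le, h.2.le⟩, h⟩
  obtain ⟨a, ha, hmin⟩ := Finset.exists_min_image _ id hne
  obtain ⟨b, hb, hmax⟩ := Finset.exists_max_image _ id hne
  have hab : a ≤ b := hmin b hb
  simp only [Finset.mem_filter, id, and_imp] at ha hb hmin hmax
  have key1 : CoveredBy P r ℓ E 2 {x | x ∈ generic P S r E ∧ u < a ∧
      Covers (edgeSpace P S r e) u a x} := by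
    by_cases h : u < a
    · refine (coveredBy_strip (e := e) hE (u := u) fun hu => ?_).mono le_rfl ?_
      · exact absurd (hmin u hu le_rfl huv.le) (not_le.2 h)
      · rintro x ⟨hx, -, hcov⟩
        refine ⟨hx, u, a, le_rfl, h.le, Or.inl rfl, fun y hy hlt => ?_, hcov⟩
        exact absurd (hmin y hy hlt.1.le (hlt.2.le.trans ha.2.2)) (not_le.2 hlt.2)
    · exact coveredBy_empty.mono (Nat.zero_le _) fun x hx => absurd hx.2.1 h
  have key2 : CoveredBy P r ℓ E 2 {x | x ∈ generic P S r E ∧ b < v ∧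
      Covers (edgeSpace P S r e) b v x} := by
    by_cases h : b < v
    · refine (coveredBy_strip (e := e) hE (u := v) fun hv => ?_).mono le_rfl ?_
      · exact absurd (hmax v hv huv.le le_rfl) (not_le.2 h)
      · rintro x ⟨hx, -, hcov⟩
        refine ⟨hx, b, v, h.le, le_rfl, Or.inr rfl, fun y hy hlt => ?_, hcov⟩
        exact absurd (hmax y hy (hb.2.1.trans hlt.1.le) hlt.2.le) (not_le.2 hlt.1)
    · exact coveredBy_empty.mono (Nat.zero_le _) fun x hx => absurd hx.2.1 h
  -- With a single height in [u, v] there is no middle part. That height may be `u` or `v`, and then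
  -- `u < v` makes the one remaining piece nondegenerate.
  rcases hab.eq_or_lt with rfl | hab
  · refine (key1.union key2).mono (by norm_num) ?_
    rintro x ⟨hx, h⟩
    rcases ha.2.2.eq_or_lt with rfl | hlt
    · exact Or.inl ⟨hx, huv, h⟩
    · rcases ha.2.1.eq_or_lt with rfl | hlt'
      · exact Or.inr ⟨hx, huv, h⟩
      · rcases h.split_right ha.2.1 ha.2.2 with h | h
        · exact Or.inl ⟨hx, hlt', h⟩
        · exact Or.inr ⟨hx, h⟩
  · refine ((key1.union key2).union (coveredBy_between hE ha.1 hb.1 hab)).mono (by norm_num) ?_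
    rintro x ⟨hx, h⟩
    rcases h.split_left ha.2.1 ha.2.2 with h | h
    · exact Or.inl (Or.inl ⟨hx, h⟩)
    · rcases h.split_right hab.le hb.2.2 with h | h
      · exact Or.inr ⟨hx, h⟩
      · exact Or.inl (Or.inr ⟨hx, h⟩)

/-- The candidates are the strips on both sides of `u`, or the one strip containing it. At distance
exactly `r` a free point may be isolated in its column, and then these strips may miss it; hence the
strict inequality. -/
theorem coveredBy_point {e : Fin S.numEdges} {u : ℝ} (hu01 : u ∈ Icc (0 : ℝ) 1) :
    CoveredBy P r ℓ E 4 {x | x ∈ generic P S r E ∧ Covers (edgeSpace P S r e) u u x ∧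
      dist (P.eval x) (AffineMap.lineMap (S.vertex e.castSucc) (S.vertex e.succ) u) < r} := by
  by_cases hu : u ∈ E e
  · have key1 : CoveredBy P r ℓ E 2 {x | x ∈ generic P S r E ∧ ∃ ε, Consecutive (E e) ε u ∧
        (Covers (edgeSpace P S r e) ε u x ∨
          Covers (edgeSpaceRev P S r e) (1 - u) (1 - ε) x)} := by
      by_cases h : ∃ ε, Consecutive (E e) ε u
      · obtain ⟨ε, hε⟩ := h
        refine (coveredBy_consecutive hE hε).mono le_rfl ?_
        rintro x ⟨hx, ε', hε', h⟩
        obtain rfl : ε' = ε := le_antisymm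
          ((hε.le_or_le _ hε'.left_mem).resolve_right (not_le.2 hε'.lt))
          ((hε'.le_or_le _ hε.left_mem).resolve_right (not_le.2 hε.lt))
        exact ⟨hx, h⟩
      · exact coveredBy_empty.mono (Nat.zero_le _) fun x ⟨_, ε, hε, _⟩ => h ⟨ε, hε⟩
    have key2 : CoveredBy P r ℓ E 2 {x | x ∈ generic P S r E ∧ ∃ ε, Consecutive (E e) u ε ∧
        (Covers (edgeSpace P S r e) u ε x ∨
          Covers (edgeSpaceRev P S r e) (1 - ε) (1 - u) x)} := by
      by_cases h : ∃ ε, Consecutive (E e) u ε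
      · obtain ⟨ε, hε⟩ := h
        refine (coveredBy_consecutive hE hε).mono le_rfl ?_
        rintro x ⟨hx, ε', hε', h⟩
        obtain rfl : ε' = ε := le_antisymm
          ((hε'.le_or_le _ hε.right_mem).resolve_left (not_le.2 hε.lt))
          ((hε.le_or_le _ hε'.right_mem).resolve_left (not_le.2 hε'.lt))
        exact ⟨hx, h⟩
      · exact coveredBy_empty.mono (Nat.zero_le _) fun x ⟨_, ε, hε, _⟩ => h ⟨ε, hε⟩
    refine (key1.union key2).mono le_rfl ?_
    rintro x ⟨hx, ⟨x₁, x₂, h1, h2, hpath⟩, hlt⟩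
    exact (covers_of_dist_lt (hE e) hu hu01
      ⟨hpath.left_mem.1.1.trans h1, h2.trans hpath.right_mem.1.2⟩ hlt).imp
      (fun h => ⟨hx, h⟩) fun h => ⟨hx, h⟩
  · refine (coveredBy_strip hE hu).mono (by norm_num) ?_
    rintro x ⟨hx, h, -⟩
    exact ⟨hx, u, u, le_rfl, le_rfl, Or.inl rfl, fun y _ h => absurd (h.1.trans h.2) (lt_irrefl _),
      h⟩

/-- Up to the first height of `E e` after `u` the subedge stays in a strip, and from there on it is
of Type (II). If there is no such height, the row at height 1 is empty. The lemma on prefixes is the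
mirror image. -/
theorem coveredBy_suffix {e : Fin S.numEdges} {u : ℝ} :
    CoveredBy P r ℓ E 4 {x | x ∈ generic P S r E ∧ Covers (edgeSpace P S r e) u 1 x} := by
  have hII : ∀ y ∈ E e, CoveredBy P r ℓ E 2 {x | x ∈ generic P S r E ∧
      (Covers (edgeSpace P S r e) y 1 x ∨
        Covers (edgeSpaceRev P S r e) (1 - 1) (1 - y) x)} := fun y hy =>
    coveredBy_pair hE (Or.inl hy) (Or.inr (Or.inr rfl)) fun b => .typeIIend e y b hy
  by_cases hu : u ∈ E e
  · exact (hII u hu).mono (by norm_num) fun x hx => ⟨hx.1, Or.inl hx.2⟩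
  rcases (((E e).filter fun y => u ≤ y ∧ y ≤ 1)).eq_empty_or_nonempty with hemp | hne
  · have hno : ∀ y ∈ E e, ¬ (u ≤ y ∧ y ≤ 1) := by simpa [Finset.filter_eq_empty_iff] using hemp
    refine coveredBy_empty.mono (Nat.zero_le _) ?_
    rintro x ⟨-, x₁, x₂, -, -, hpath⟩
    obtain ⟨k, hk⟩ := P.exists_edge hpath.right_mem.1
    have hz : (x₂, (1 : ℝ)) ∈ cell P r (S.vertex e.castSucc) (S.vertex e.succ) k :=
      ⟨hpath.right_mem, hk⟩
    exact hno 1 (height_mem (hE e) hz (Or.inr (Or.inr rfl))) ⟨hpath.le.2, le_rfl⟩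
  obtain ⟨a, ha, hmin⟩ := Finset.exists_min_image _ id hne
  simp only [Finset.mem_filter, id, and_imp] at ha hmin
  refine ((coveredBy_strip hE hu).union (hII a ha.1)).mono le_rfl ?_
  rintro x ⟨hx, h⟩
  rcases h.split_left ha.2.1 ha.2.2 with ⟨hlt, h⟩ | h
  · refine Or.inl ⟨hx, u, a, le_rfl, hlt.le, Or.inl rfl, fun y hy hlt => ?_, h⟩
    exact absurd (hmin y hy hlt.1.le (hlt.2.le.trans ha.2.2)) (not_le.2 hlt.2)
  · exact Or.inr ⟨hx, Or.inl h⟩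

theorem coveredBy_prefix {e : Fin S.numEdges} {v : ℝ} :
    CoveredBy P r ℓ E 4 {x | x ∈ generic P S r E ∧ Covers (edgeSpace P S r e) 0 v x} := by
  have hII : ∀ y ∈ E e, CoveredBy P r ℓ E 2 {x | x ∈ generic P S r E ∧
      (Covers (edgeSpace P S r e) 0 y x ∨
        Covers (edgeSpaceRev P S r e) (1 - y) (1 - 0) x)} := fun y hy =>
    coveredBy_pair hE (Or.inr (Or.inl rfl)) (Or.inl hy) fun b => .typeIIstart e y b hy
  by_cases hv : v ∈ E e
  · exact (hII v hv).mono (by norm_num) fun x hx => ⟨hx.1, Or.inl hx.2⟩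
  rcases (((E e).filter fun y => 0 ≤ y ∧ y ≤ v)).eq_empty_or_nonempty with hemp | hne
  · have hno : ∀ y ∈ E e, ¬ (0 ≤ y ∧ y ≤ v) := by simpa [Finset.filter_eq_empty_iff] using hemp
    refine coveredBy_empty.mono (Nat.zero_le _) ?_
    rintro x ⟨-, x₁, x₂, -, -, hpath⟩
    obtain ⟨k, hk⟩ := P.exists_edge hpath.left_mem.1
    have hz : (x₁, (0 : ℝ)) ∈ cell P r (S.vertex e.castSucc) (S.vertex e.succ) k :=
      ⟨hpath.left_mem, hk⟩
    exact hno 0 (height_mem (hE e) hz (Or.inr (Or.inl rfl))) ⟨le_rfl, hpath.le.2⟩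
  obtain ⟨b, hb, hmax⟩ := Finset.exists_max_image _ id hne
  simp only [Finset.mem_filter, id, and_imp] at hb hmax
  refine ((coveredBy_strip hE hv).union (hII b hb.1)).mono le_rfl ?_
  rintro x ⟨hx, h⟩
  rcases h.split_right hb.2.1 hb.2.2 with h | ⟨hlt, h⟩
  · exact Or.inr ⟨hx, Or.inl h⟩
  · refine Or.inl ⟨hx, b, v, hlt.le, le_rfl, Or.inr rfl, fun y hy hlt => ?_, h⟩
    exact absurd (hmax y hy (hb.2.1.trans hlt.1.le) hlt.2.le) (not_le.2 hlt.1)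

end

/-! ### From edges of `S` to subcurves of `S` -/

theorem PolyCurve.exists_edge_Ico (P : PolyCurve d) {x : ℝ} (h0 : 0 ≤ x) (h1 : x < 1) :
    ∃ i : Fin P.numEdges, P.param i.castSucc ≤ x ∧ x < P.param i.succ := by
  classical
  have hne : (Finset.univ.filter fun i : Fin (P.numEdges + 1) => P.param i ≤ x).Nonempty :=
    ⟨0, by simpa [P.param_zero] using h0⟩
  obtain ⟨k, hk, hmax⟩ := Finset.exists_maximal hne
  rw [Finset.mem_filter] at hk
  have hk0 : k ≠ Fin.last _ := by
    rintro rfl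
    exact absurd (P.param_last.ge.trans hk.2) (not_le.2 h1)
  obtain ⟨i, rfl⟩ := Fin.exists_castSucc_eq.2 hk0
  refine ⟨i, hk.2, ?_⟩
  by_contra h
  have := hmax (y := i.succ) (by simpa using h) Fin.castSucc_lt_succ.le
  exact absurd this (not_le.2 Fin.castSucc_lt_succ)

section
variable {P S : PolyCurve d} {r : ℝ}

/-- An increasing affine change of the vertical coordinate; monotonicity keeps the path within the
heights of the edge `e`. -/
theorem hasMonotonePath_edge_iff {e : Fin S.numEdges} {x₁ x₂ u v : ℝ}
    (hu : u ∈ Icc (0 : ℝ) 1) (hv : v ∈ Icc (0 : ℝ) 1) :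
    HasMonotonePath (curveSpaceFree P S r) (x₁, S.edgeParam e u) (x₂, S.edgeParam e v) ↔
      HasMonotonePath (edgeSpace P S r e) (x₁, u) (x₂, v) := by
  have hpos := sub_pos.2 (S.param_castSucc_lt e)
  constructor
  · intro h
    have := h.map (B := edgeSpace P S r e) (φ := fun z => (z.1, (z.2 - S.param e.castSucc) /
      (S.param e.succ - S.param e.castSucc))) (by fun_prop)
      (fun a b hab => ⟨hab.1, div_le_div_of_nonneg_right (sub_le_sub_right hab.2 _) hpos.le⟩) ?_
    · simpa [PolyCurve.edgeParam, hpos.ne'] using this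
    · rintro ⟨x, y⟩ ⟨h1, h2, h3⟩ hl hr
      have hy : y ∈ S.edgeParams e :=
        ⟨(S.edgeParam_mem e hu).1.trans hl.2, hr.2.trans (S.edgeParam_mem e hv).2⟩
      refine ⟨h1, ⟨div_nonneg (sub_nonneg.2 hy.1) hpos.le, (div_le_one hpos).2 ?_⟩, ?_⟩
      · simp only; linarith [hy.2]
      · rwa [S.eval_of_mem e hy] at h3
  · intro h
    refine h.map (φ := fun z => (z.1, S.edgeParam e z.2)) ?_ ?_ ?_
    · unfold PolyCurve.edgeParam; fun_prop
    · exact fun a b hab => ⟨hab.1, (S.edgeParam_le_iff e).2 hab.2⟩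
    · rintro ⟨x, y⟩ ⟨h1, h2, h3⟩ - -
      refine ⟨h1, S.edgeParams_subset e (S.edgeParam_mem e h2), ?_⟩
      simp only
      rwa [S.eval_edgeParam e h2]

theorem covers_edge_iff {e : Fin S.numEdges} {u v x : ℝ}
    (hu : u ∈ Icc (0 : ℝ) 1) (hv : v ∈ Icc (0 : ℝ) 1) :
    Covers (curveSpaceFree P S r) (S.edgeParam e u) (S.edgeParam e v) x ↔
      Covers (edgeSpace P S r e) u v x :=
  exists_congr fun _ => exists_congr fun _ => and_congr_right fun _ => and_congr_right fun _ =>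
    hasMonotonePath_edge_iff hu hv

/-- Free-space characterization of the Fréchet distance of two subcurves. -/
theorem frechetDist_subcurve_le_iff (hr : 0 ≤ r) {s t s' t' : ℝ} (hs : 0 ≤ s) (hst : s ≤ t)
    (ht : t ≤ 1) (hs' : 0 ≤ s') (hst' : s' ≤ t') (ht' : t' ≤ 1) :
    frechetDist (P.subcurve s t) (S.subcurve s' t') ≤ ENNReal.ofReal r ↔
      HasMonotonePath (curveSpaceFree P S r) (s, s') (t, t') := by
  refine (frechetDist_reparam_le_iff P.continuous_eval S.continuous_eval hr hst hst').trans
    ⟨fun h => h.mono fun _ hv h1 h2 => ?_, fun h => h.mono fun _ hv _ _ => hv.2.2⟩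
  exact ⟨⟨hs.trans h1.1, h2.1.trans ht⟩, ⟨hs'.trans h1.2, h2.2.trans ht'⟩, hv⟩

theorem frechetDist_segment_le (hr : 0 ≤ r) {p q : Pt d} {s t s' t' : ℝ}
    (h : HasMonotonePath (freeSpace P r p q) (s, s') (t, t')) :
    frechetDist (P.subcurve s t)
      (fun τ : unitInterval => AffineMap.lineMap p q (s' + (τ : ℝ) * (t' - s'))) ≤
        ENNReal.ofReal r :=
  (frechetDist_reparam_le_iff (β := fun y => AffineMap.lineMap p q y) P.continuous_eval
    AffineMap.lineMap_continuous hr h.le.1 h.le.2).2 (h.mono fun _ hv _ _ => hv.2.2)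

theorem mem_cov_segment (hr : 0 ≤ r) {p q : Pt d} {s t x : ℝ}
    (h : Covers (freeSpace P r p q) s t x) :
    x ∈ cov P {fun τ : unitInterval => AffineMap.lineMap p q (s + (τ : ℝ) * (t - s))} r := by
  obtain ⟨x₁, x₂, h1, h2, hpath⟩ := h
  exact ⟨_, rfl, x₁, x₂, hpath.left_mem.1.1, h1.trans h2, hpath.right_mem.1.2,
    frechetDist_segment_le hr hpath, h1, h2⟩

theorem cov_mono {𝒬 𝒬' : Set (unitInterval → Pt d)} (h : 𝒬 ⊆ 𝒬') : cov P 𝒬 r ⊆ cov P 𝒬' r :=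
  fun _ ⟨γ, hγ, h'⟩ => ⟨γ, h hγ, h'⟩

theorem cov_subset_Icc {𝒬 : Set (unitInterval → Pt d)} : cov P 𝒬 r ⊆ Icc 0 1 :=
  fun _ ⟨_, _, _, _, hs, _, ht, _, hx⟩ => ⟨hs.trans hx.1, hx.2.trans ht⟩

/-- The proxy coverage is contained in the coverage. -/
theorem Candidate.proxy_subset_cov (hr : 0 ≤ r) (c : Candidate S) :
    c.proxy P r ⊆ cov P {c.curve} r := by
  intro x hx
  match c with
  | .vertices i j => exact hx
  | .subedge e s t false =>
    obtain ⟨-, -, z, z', -, -, -, -, hxz, -, hcov⟩ := exists_Icc_of_mem_proxySubedge hx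
    exact mem_cov_segment hr (hcov x hxz)
  | .subedge e s t true =>
    obtain ⟨-, -, z, z', -, -, -, -, hxz, -, hcov⟩ := exists_Icc_of_mem_proxySubedge hx
    have := mem_cov_segment hr (hcov x hxz)
    convert this using 2
    congr 1
    ext1 τ
    simp only [Candidate.curve]
    rw [← AffineMap.lineMap_apply_one_sub]
    congr 1
    ring

theorem mem_cov_vertices_iff (hr : 0 ≤ r) {i j : Fin (S.numEdges + 1)} (hij : i ≤ j) {x : ℝ} :
    x ∈ cov P {S.subcurve (S.param i) (S.param j)} r ↔
      Covers (curveSpaceFree P S r) (S.param i) (S.param j) x := by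
  constructor
  · rintro ⟨γ, rfl, s, t, hs, hst, ht, hd, hx⟩
    exact ⟨s, t, hx.1, hx.2, (frechetDist_subcurve_le_iff hr hs hst ht (S.param_mem _).1
      (S.param_mono hij) (S.param_mem _).2).1 hd⟩
  · rintro ⟨x₁, x₂, h1, h2, hpath⟩
    exact ⟨_, rfl, x₁, x₂, hpath.left_mem.1.1, h1.trans h2, hpath.right_mem.1.2,
      (frechetDist_subcurve_le_iff hr hpath.left_mem.1.1 (h1.trans h2) hpath.right_mem.1.2
      (S.param_mem _).1 (S.param_mono hij) (S.param_mem _).2).2 hpath, h1, h2⟩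

variable {ℓ : ℕ} {E : Fin S.numEdges → Finset ℝ}

/-- Two overlapping runs of a power of two of edges. No exceptional points occur, since the proxy of
a Type (I) candidate is its true coverage. -/
theorem coveredBy_vertices (hr : 0 ≤ r) {i j : Fin (S.numEdges + 1)} (hij : i < j)
    (hcard : (j : ℕ) + 1 ≤ i + ℓ) :
    CoveredBy P r ℓ E 2 {x | Covers (curveSpaceFree P S r) (S.param i) (S.param j) x} := by
  have hij' : (i : ℕ) < j := hij
  set n := (j : ℕ) - i with hn
  have hn0 : n ≠ 0 := by omega
  have h1 : 2 ^ Nat.log 2 n ≤ n := Nat.pow_log_le_self 2 hn0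
  have h2 : n < 2 ^ (Nat.log 2 n + 1) := Nat.lt_pow_succ_log_self (by norm_num) n
  rw [pow_succ] at h2
  have hlog : Nat.log 2 n ≤ Nat.log 2 ℓ := Nat.log_mono_right (by omega)
  have hj := j.2
  let a : Fin (S.numEdges + 1) := ⟨i + 2 ^ Nat.log 2 n, by omega⟩
  let b : Fin (S.numEdges + 1) := ⟨j - 2 ^ Nat.log 2 n, by omega⟩
  have hia : i ≤ a := Fin.le_def.2 (by simp [a])
  have hib : i ≤ b := Fin.le_def.2 (by simp only [b]; omega)
  have hba : b ≤ a := Fin.le_def.2 (by simp only [a, b]; omega)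
  have haj : a ≤ j := Fin.le_def.2 (by simp only [a]; omega)
  refine ⟨[.vertices i a, .vertices b j], le_rfl, ?_, fun x hx => ?_⟩
  · simp only [List.mem_cons, List.not_mem_nil, or_false, forall_eq_or_imp, forall_eq]
    exact ⟨.typeI i a _ hlog rfl (by omega), .typeI b j _ hlog (by simp only [b]; omega) (by omega)⟩
  · rcases Covers.split_overlap hx (S.param_mono hib) (S.param_mono hba) (S.param_mono haj) with
      h | h
    · exact ⟨.vertices i a, by simp, (mem_cov_vertices_iff hr hia).2 h⟩
    · exact ⟨.vertices b j, by simp, (mem_cov_vertices_iff hr (hba.trans haj)).2 h⟩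

variable (hE : ∀ e, extremalHeights P r (S.vertex e.castSucc) (S.vertex e.succ) ⊆ (E e : Set ℝ))

include hE

/-- What a subcurve of `S` of small complexity covers is covered by ten proxy coverages. -/
theorem coveredBy_subcurve (hr : 0 ≤ r) {s' t' : ℝ} (hs : 0 ≤ s') (hst : s' < t') (ht : t' ≤ 1)
    (hcompl : S.subcurveComplexity s' t' ≤ ℓ + 2) :
    CoveredBy P r ℓ E 10 {x | x ∈ generic P S r E ∧ Covers (curveSpaceFree P S r) s' t' x} := by
  obtain ⟨e, he, he'⟩ := S.exists_edge_Ioc (hs.trans_lt hst) ht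
  obtain ⟨v, hv, rfl⟩ := S.exists_edgeParam_eq e ⟨he.le, he'⟩
  rcases le_or_gt (S.param e.castSucc) s' with h | h
  · obtain ⟨u, hu, rfl⟩ := S.exists_edgeParam_eq e ⟨h, hst.le.trans he'⟩
    refine (coveredBy_subedge hE (e := e) (u := u) (v := v) ?_).mono (by norm_num) ?_
    · exact not_le.1 fun hle => absurd ((S.edgeParam_le_iff e).2 hle) (not_le.2 hst)
    · rintro x ⟨hx, h⟩
      exact ⟨hx, (covers_edge_iff hu hv).1 h⟩
  obtain ⟨f, hf, hf'⟩ := S.exists_edge_Ico hs (hst.trans_le ht)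
  obtain ⟨u, hu, rfl⟩ := S.exists_edgeParam_eq f ⟨hf, hf'.le⟩
  have hfe : f < e := Fin.castSucc_lt_castSucc_iff.1
    (S.param_strictMono.lt_iff_lt.1 (hf.trans_lt h))
  have hle : f.succ ≤ e.castSucc := Fin.le_def.2 (by simpa using hfe)
  have hfirst : ∀ {x}, Covers (curveSpaceFree P S r) (S.edgeParam f u) (S.param f.succ) x →
      Covers (edgeSpace P S r f) u 1 x := fun {x} hx => by
    rw [← S.edgeParam_one] at hx
    exact (covers_edge_iff hu ⟨zero_le_one, le_rfl⟩).1 hx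
  have hlast : ∀ {x}, Covers (curveSpaceFree P S r) (S.param e.castSucc) (S.edgeParam e v) x →
      Covers (edgeSpace P S r e) 0 v x := fun {x} hx => by
    rw [← S.edgeParam_zero] at hx
    exact (covers_edge_iff ⟨le_rfl, zero_le_one⟩ hv).1 hx
  have hfirst4 := coveredBy_suffix (ℓ := ℓ) hE (e := f) (u := u)
  have hlast4 := coveredBy_prefix (ℓ := ℓ) hE (e := e) (v := v)
  rcases hle.eq_or_lt with heq | hlt
  · refine (hfirst4.union hlast4).mono (by norm_num) ?_
    rintro x ⟨hx, hcov⟩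
    rcases hcov.split_right hf'.le (heq ▸ he.le) with h | ⟨-, h⟩
    · exact Or.inl ⟨hx, hfirst h⟩
    · rw [heq] at h
      exact Or.inr ⟨hx, hlast h⟩
  -- The half-open choices of `f` and `e` put all vertices from `f.succ` to `e.castSucc` strictly
  -- inside the subcurve, and at most `ℓ` vertices are there, as the complexity counts two more.
  · have hcard : (e.castSucc : ℕ) + 1 ≤ f.succ + ℓ := by
      unfold PolyCurve.subcurveComplexity at hcompl
      have hsub : (Finset.Icc f.succ e.castSucc : Set (Fin (S.numEdges + 1))) ⊆
          {i | S.edgeParam f u < S.param i ∧ S.param i < S.edgeParam e v} := by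
        intro i hi
        rw [Finset.coe_Icc] at hi
        exact ⟨hf'.trans_le (S.param_mono hi.1), (S.param_mono hi.2).trans_lt he⟩
      have := Set.ncard_le_ncard hsub (Set.toFinite _)
      rw [Set.ncard_coe_finset, Fin.card_Icc] at this
      omega
    refine ((hfirst4.union hlast4).union (coveredBy_vertices hr hlt hcard)).mono le_rfl ?_
    rintro x ⟨hx, hcov⟩
    rcases hcov.split_right hf'.le ((S.param_mono hle).trans he.le) with h | ⟨-, h⟩
    · exact Or.inl (Or.inl ⟨hx, hfirst h⟩)
    rcases h.split_right (S.param_mono hle) he.le with h | ⟨-, h⟩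
    · exact Or.inr h
    · exact Or.inl (Or.inr ⟨hx, hlast h⟩)

theorem coveredBy_subcurve_point {s' : ℝ} (hs : s' ∈ Icc (0 : ℝ) 1) :
    CoveredBy P r ℓ E 4 {x | x ∈ generic P S r E ∧ Covers (curveSpaceFree P S r) s' s' x ∧
      dist (P.eval x) (S.eval s') < r} := by
  obtain ⟨e, he⟩ := S.exists_edge hs
  obtain ⟨u, hu, rfl⟩ := S.exists_edgeParam_eq e he
  refine (coveredBy_point hE (e := e) hu).mono le_rfl ?_
  rintro x ⟨hx, h, hlt⟩
  exact ⟨hx, (covers_edge_iff hu hu).1 h, by rwa [← S.eval_edgeParam e hu]⟩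

/-- The proxy coverage of a candidate is a union of intervals between breakpoints. -/
theorem IsCandidate.exists_Icc_of_mem_proxy (hr : 0 ≤ r) {c : Candidate S}
    (hc : IsCandidate ℓ E c) {x : ℝ} (hx : x ∈ c.proxy P r) :
    ∃ a ∈ breakpoints P S r E, ∃ b ∈ breakpoints P S r E, x ∈ Icc a b ∧ Icc a b ⊆ c.proxy P r := by
  have hsub : ∀ (e : Fin S.numEdges) (s t : ℝ) (b : Bool), (s ∈ E e ∨ s = 0 ∨ s = 1) →
      (t ∈ E e ∨ t = 0 ∨ t = 1) → x ∈ (Candidate.subedge e s t b).proxy P r →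
      ∃ a' ∈ breakpoints P S r E, ∃ b' ∈ breakpoints P S r E, x ∈ Icc a' b' ∧
        Icc a' b' ⊆ (Candidate.subedge e s t b).proxy P r := by
    intro e s t b hs ht hx
    cases b with
    | false =>
      obtain ⟨i, j, z, z', hz, hz', h, h', hxz, hsub, -⟩ := exists_Icc_of_mem_proxySubedge hx
      exact ⟨z, Or.inr ⟨e, s, height_mem (hE e) hz hs, i, h⟩, z',
        Or.inr ⟨e, t, height_mem (hE e) hz' ht, j, h'⟩, hxz, hsub⟩
    | true =>
      obtain ⟨i, j, z, z', hz, hz', h, h', hxz, hsub, -⟩ := exists_Icc_of_mem_proxySubedge hx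
      rw [cell_swap, sub_sub_cancel] at hz hz'
      rw [leftEnd_swap, rightEnd_swap, sub_sub_cancel] at h h'
      exact ⟨z, Or.inr ⟨e, t, height_mem (hE e) hz ht, i, h⟩, z',
        Or.inr ⟨e, s, height_mem (hE e) hz' hs, j, h'⟩, hxz, hsub⟩
  cases hc with
  | typeI i j m h1 h2 h3 =>
    have hij : i < j := Fin.lt_def.2 (by rw [h2]; have := Nat.two_pow_pos m; omega)
    obtain ⟨x₁, x₂, hx1, hx2, hpath⟩ := (mem_cov_vertices_iff hr hij.le).1 hx
    obtain ⟨e, rfl⟩ := Fin.exists_castSucc_eq.2 (ne_of_lt (hij.trans_le (Fin.le_last j)))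
    obtain ⟨f, rfl⟩ := Fin.exists_succ_eq.2 (ne_of_gt ((Fin.zero_le _).trans_lt hij))
    have p1 := hasMonotonePath_refl hpath.left_mem
    have p2 := hasMonotonePath_refl hpath.right_mem
    rw [← S.edgeParam_zero, hasMonotonePath_edge_iff ⟨le_rfl, zero_le_one⟩ ⟨le_rfl, zero_le_one⟩]
      at p1
    rw [← S.edgeParam_one, hasMonotonePath_edge_iff ⟨zero_le_one, le_rfl⟩ ⟨zero_le_one, le_rfl⟩]
      at p2
    obtain ⟨k, hk⟩ := P.exists_edge p1.left_mem.1
    obtain ⟨k', hk'⟩ := P.exists_edge p2.left_mem.1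
    have c1 : (x₁, (0 : ℝ)) ∈ cell P r (S.vertex e.castSucc) (S.vertex e.succ) k :=
      ⟨p1.left_mem, hk⟩
    have c2 : (x₂, (1 : ℝ)) ∈ cell P r (S.vertex f.castSucc) (S.vertex f.succ) k' :=
      ⟨p2.left_mem, hk'⟩
    -- The path is prolonged horizontally at both ends: back to the left end of its row at the start
    -- of the first edge, on to the right end of its row at the end of the last one.
    obtain ⟨a, ha, hal, ham⟩ := exists_leftEnd_eq ⟨x₁, c1⟩
    obtain ⟨b, hb, hbr, hbm⟩ := exists_rightEnd_eq ⟨x₂, c2⟩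
    have q1 := (hasMonotonePath_edge_iff ⟨le_rfl, zero_le_one⟩ ⟨le_rfl, zero_le_one⟩).2
      (cell_path ha c1 (ham _ c1) le_rfl)
    have q2 := (hasMonotonePath_edge_iff ⟨zero_le_one, le_rfl⟩ ⟨zero_le_one, le_rfl⟩).2
      (cell_path c2 hb (hbm _ c2) le_rfl)
    rw [S.edgeParam_zero] at q1
    rw [S.edgeParam_one] at q2
    refine ⟨a, Or.inr ⟨e, 0, height_mem (hE e) c1 (Or.inr (Or.inl rfl)), k, Or.inl hal.symm⟩, b,
      Or.inr ⟨f, 1, height_mem (hE f) c2 (Or.inr (Or.inr rfl)), k', Or.inr hbr.symm⟩,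
      ⟨(ham _ c1).trans hx1, hx2.trans (hbm _ c2)⟩, fun x' hx' => ?_⟩
    exact (mem_cov_vertices_iff hr hij.le).2 ⟨a, b, hx'.1, hx'.2, (q1.trans hpath).trans q2⟩
  | typeIIstart e y b hy => exact hsub e 0 y b (Or.inr (Or.inl rfl)) (Or.inl hy) hx
  | typeIIend e y b hy => exact hsub e y 1 b (Or.inl hy) (Or.inr (Or.inr rfl)) hx
  | typeIII e y y' b m hy hy' _ _ => exact hsub e y y' b (Or.inl hy) (Or.inl hy') hx

end

/-! ### Curves of bounded complexity -/

/-- The segment from `p` to `q` as a polygonal curve. -/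
noncomputable def PolyCurve.segment (p q : Pt d) : PolyCurve d where
  numEdges := 1
  numEdges_pos := one_pos
  vertex := ![p, q]
  param := ![0, 1]
  param_strictMono := by
    intro a b hab
    fin_cases a <;> fin_cases b <;> simp_all
  param_zero := rfl
  param_last := rfl

theorem PolyCurve.segment_toMap (p q : Pt d) :
    (PolyCurve.segment p q).toMap = fun τ : unitInterval => AffineMap.lineMap p q (τ : ℝ) := by
  ext1 τ
  have h := (PolyCurve.segment p q).eval_of_mem (0 : Fin 1) (x := τ) ⟨τ.2.1, τ.2.2⟩
  refine h.trans ?_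
  simp [PolyCurve.segment]

theorem lineMap_mem_curveSpace {ℓ : ℕ} (hℓ : 2 ≤ ℓ) (p q : Pt d) :
    (fun τ : unitInterval => AffineMap.lineMap p q (τ : ℝ)) ∈ curveSpace d ℓ :=
  ⟨PolyCurve.segment p q, hℓ, (PolyCurve.segment_toMap p q).symm⟩

/-- The subcurve from the `i`-th to the `(i + n)`-th vertex as a polygonal curve. -/
noncomputable def PolyCurve.ofVertices (S : PolyCurve d) (i n : ℕ) (hn : 0 < n) (h : i + n < S.numEdges + 1) :
    PolyCurve d where
  numEdges := n
  numEdges_pos := hn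
  vertex k := S.vertex ⟨i + k, by omega⟩
  param k := (S.param ⟨i + k, by omega⟩ - S.param ⟨i, by omega⟩) /
    (S.param ⟨i + n, h⟩ - S.param ⟨i, by omega⟩)
  param_strictMono := by
    intro a b hab
    have h1 : 0 < S.param ⟨i + n, h⟩ - S.param ⟨i, by omega⟩ :=
      sub_pos.2 (S.param_strictMono (Fin.mk_lt_mk.2 (by omega)))
    have h2 : S.param ⟨i + a, by omega⟩ < S.param ⟨i + b, by omega⟩ :=
      S.param_strictMono (Fin.mk_lt_mk.2 (by have : (a : ℕ) < b := hab; omega))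
    exact div_lt_div_of_pos_right (by linarith) h1
  param_zero := by simp
  param_last := by
    have h1 : 0 < S.param ⟨i + n, h⟩ - S.param ⟨i, by omega⟩ :=
      sub_pos.2 (S.param_strictMono (Fin.mk_lt_mk.2 (by omega)))
    simp [h1.ne']

theorem PolyCurve.ofVertices_toMap (S : PolyCurve d) (i n : ℕ) (hn : 0 < n)
    (h : i + n < S.numEdges + 1) :
    (S.ofVertices i n hn h).toMap =
      S.subcurve (S.param ⟨i, by omega⟩) (S.param ⟨i + n, h⟩) := by
  ext1 τ
  have hpos : 0 < S.param ⟨i + n, h⟩ - S.param ⟨i, by omega⟩ :=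
    sub_pos.2 (S.param_strictMono (Fin.mk_lt_mk.2 (by omega)))
  obtain ⟨k, hk⟩ := (S.ofVertices i n hn h).exists_edge τ.2
  have hkn : (k : ℕ) < n := k.2
  let e : Fin S.numEdges := ⟨i + k, by omega⟩
  have hk1 : (S.param e.castSucc - S.param ⟨i, by omega⟩) /
      (S.param ⟨i + n, h⟩ - S.param ⟨i, by omega⟩) ≤ τ := hk.1
  have hk2 : (τ : ℝ) ≤ (S.param e.succ - S.param ⟨i, by omega⟩) /
      (S.param ⟨i + n, h⟩ - S.param ⟨i, by omega⟩) := hk.2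
  rw [div_le_iff₀ hpos] at hk1
  rw [le_div_iff₀ hpos] at hk2
  have hmem : S.param ⟨i, by omega⟩ + τ * (S.param ⟨i + n, h⟩ - S.param ⟨i, by omega⟩) ∈
      S.edgeParams e := ⟨by linarith, by linarith⟩
  unfold toMap subcurve
  rw [S.eval_of_mem e hmem, (S.ofVertices i n hn h).eval_of_mem k hk]
  change AffineMap.lineMap (S.vertex e.castSucc) (S.vertex e.succ)
    ((τ - (S.param e.castSucc - S.param ⟨i, by omega⟩) /
      (S.param ⟨i + n, h⟩ - S.param ⟨i, by omega⟩)) /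
      ((S.param e.succ - S.param ⟨i, by omega⟩) /
      (S.param ⟨i + n, h⟩ - S.param ⟨i, by omega⟩) -
      (S.param e.castSucc - S.param ⟨i, by omega⟩) /
      (S.param ⟨i + n, h⟩ - S.param ⟨i, by omega⟩))) = _
  have he := sub_pos.2 (S.param_castSucc_lt e)
  congr 1
  have e1 : (S.param e.succ - S.param ⟨i, by omega⟩) /
      (S.param ⟨i + n, h⟩ - S.param ⟨i, by omega⟩) -
      (S.param e.castSucc - S.param ⟨i, by omega⟩) /
      (S.param ⟨i + n, h⟩ - S.param ⟨i, by omega⟩) =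
      (S.param e.succ - S.param e.castSucc) /
      (S.param ⟨i + n, h⟩ - S.param ⟨i, by omega⟩) := by
    rw [← sub_div]; congr 1; ring
  rw [e1]
  field_simp
  ring

theorem IsCandidate.curve_mem {S : PolyCurve d} {ℓ : ℕ} (hℓ : 2 ≤ ℓ)
    {E : Fin S.numEdges → Finset ℝ} {c : Candidate S} (hc : IsCandidate ℓ E c) :
    c.curve ∈ curveSpace d ℓ := by
  have hsub : ∀ (e : Fin S.numEdges) (s t : ℝ) (b : Bool),
      (Candidate.subedge e s t b).curve ∈ curveSpace d ℓ := by
    have key : ∀ (p q : Pt d) (s t : ℝ), (fun τ : unitInterval =>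
        (AffineMap.lineMap p q (s + (τ : ℝ) * (t - s)) : Pt d)) ∈ curveSpace d ℓ := by
      intro p q s t
      convert lineMap_mem_curveSpace hℓ (AffineMap.lineMap p q s) (AffineMap.lineMap p q t)
        using 2 with τ
      simp only [AffineMap.lineMap_apply, vsub_eq_sub, vadd_eq_add]
      module
    intro e s t b
    cases b
    · exact key _ _ s t
    · exact key _ _ t s
  cases hc with
  | typeI i j m h1 h2 h3 =>
    have hj := j.2
    have hji : j = ⟨i + 2 ^ m, by omega⟩ := Fin.ext h2
    refine ⟨S.ofVertices i (2 ^ m) (Nat.two_pow_pos m) (by omega), h3, ?_⟩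
    rw [S.ofVertices_toMap i (2 ^ m) (Nat.two_pow_pos m) (by omega), ← hji]
    rfl
  | typeIIstart e y b hy => exact hsub _ _ _ _
  | typeIIend e y b hy => exact hsub _ _ _ _
  | typeIII e y y' b m hy hy' _ _ => exact hsub _ _ _ _

theorem frechetDist_self (γ : unitInterval → Pt d) : frechetDist γ γ = 0 := by
  refine le_antisymm (frechetDist_le_iff.2 fun c hc => ?_) zero_le
  exact ⟨id, id, ⟨monotone_id, Function.surjective_id⟩, ⟨monotone_id, Function.surjective_id⟩,
    fun τ => by simp⟩

/-- The edges of `P` form a cover, so the infimum in `coverNumber` is attained and is not the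
default value 0 of an empty set. -/
theorem exists_cover (P : PolyCurve d) {ℓ : ℕ} (hℓ : 2 ≤ ℓ) (Δ : ℝ) :
    ∃ C : Finset (unitInterval → Pt d), (C : Set (unitInterval → Pt d)) ⊆ curveSpace d ℓ ∧
      C.card = coverNumber P ℓ Δ ∧ cov P (C : Set (unitInterval → Pt d)) Δ = Icc 0 1 := by
  classical
  refine Nat.sInf_mem (s := {k | ∃ C : Finset (unitInterval → Pt d),
    (C : Set (unitInterval → Pt d)) ⊆ curveSpace d ℓ ∧ C.card = k ∧
      cov P (C : Set (unitInterval → Pt d)) Δ = Icc 0 1}) ?_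
  let f : Fin P.numEdges → unitInterval → Pt d := fun i τ =>
    AffineMap.lineMap (P.vertex i.castSucc) (P.vertex i.succ) (τ : ℝ)
  refine ⟨_, Finset.univ.image f, ?_, rfl, cov_subset_Icc.antisymm fun x hx => ?_⟩
  · intro γ hγ
    rw [Finset.mem_coe, Finset.mem_image] at hγ
    obtain ⟨i, -, rfl⟩ := hγ
    exact lineMap_mem_curveSpace hℓ _ _
  · obtain ⟨i, hi⟩ := P.exists_edge hx
    refine ⟨f i, by simp, P.param i.castSucc, P.param i.succ, (P.param_mem _).1,
      (P.param_castSucc_lt i).le, (P.param_mem _).2, ?_, hi⟩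
    have : P.subcurve (P.param i.castSucc) (P.param i.succ) = f i := by
      ext1 τ
      exact P.eval_edgeParam i τ.2
    rw [this, frechetDist_self]
    exact zero_le

/-! ### The coverage of one curve -/

/-- Equality in the triangle inequality places `z` at a quarter of the segment from `x` to `y`, by
strict convexity, so `x` and `z` determine `y`. -/
theorem eq_of_dist_extremal {x y y' z : Pt d} {δ : ℝ} (hxz : dist x z ≤ δ)
    (hy : dist z y ≤ 3 * δ) (hy' : dist z y' ≤ 3 * δ) (h : 4 * δ ≤ dist x y)
    (h' : 4 * δ ≤ dist x y') : y = y' := by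
  have key : ∀ w : Pt d, dist z w ≤ 3 * δ → 4 * δ ≤ dist x w →
      z = AffineMap.lineMap x w (1 / 4 : ℝ) := by
    intro w h1 h2
    have := dist_triangle x z w
    exact eq_lineMap_of_dist_eq_mul_of_dist_eq_mul (by linarith) (by linarith)
  have h1 := key y hy h
  rw [key y' hy' h'] at h1
  simp only [AffineMap.lineMap_apply, vsub_eq_sub, vadd_eq_add, add_left_inj] at h1
  have h2 := smul_right_injective (Pt d) (by norm_num : (1 / 4 : ℝ) ≠ 0) h1
  simpa using h2.symm

section
variable {P S : PolyCurve d} {Δ : ℝ} {ℓ : ℕ} {E : Fin S.numEdges → Finset ℝ}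

theorem PolyCurve.toMap_eq_subcurve (Q : PolyCurve d) : Q.toMap = Q.subcurve 0 1 := by
  ext1 τ
  simp [PolyCurve.toMap, PolyCurve.subcurve]

/-- A covered point is matched to a point of the curve, which is matched to a point of every other
covered piece. -/
theorem exists_matched (hΔ : 0 ≤ Δ) {γ : unitInterval → Pt d} (hγ : γ ∈ curveSpace d ℓ) {x : ℝ}
    (hx : x ∈ cov P {γ} Δ) :
    ∃ z, dist (P.eval x) z ≤ Δ ∧ ∀ s t, 0 ≤ s → s ≤ t → t ≤ 1 →
      frechetDist (P.subcurve s t) γ ≤ ENNReal.ofReal Δ →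
        ∃ x' ∈ Icc s t, dist z (P.eval x') ≤ Δ := by
  obtain ⟨Q, -, rfl⟩ := hγ
  obtain ⟨_, rfl, s, t, hs, hst, ht, hd, hxst⟩ := hx
  rw [Q.toMap_eq_subcurve] at hd ⊢
  have hpath := (frechetDist_subcurve_le_iff hΔ hs hst ht le_rfl zero_le_one le_rfl).1 hd
  obtain ⟨y, hy, -⟩ := hpath.split_fst hxst.1 hxst.2
  refine ⟨Q.eval y, hy.right_mem.2.2, fun s' t' hs' hst' ht' hd' => ?_⟩
  have hpath' := (frechetDist_subcurve_le_iff hΔ hs' hst' ht' le_rfl zero_le_one le_rfl).1 hd'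
  obtain ⟨x', h1, h2⟩ := hpath'.split_snd hy.right_mem.2.1.1 hy.right_mem.2.1.2
  exact ⟨x', ⟨h1.le.1, h2.le.1⟩, by rw [dist_comm]; exact h1.right_mem.2.2⟩

/-- A simplification has a subcurve of small complexity that covers, for a larger radius, everything
that a given curve of small complexity covers. -/
theorem IsSimplification.exists_subcurve (hΔ : 0 ≤ Δ) (hS : IsSimplification P S Δ ℓ)
    {γ : unitInterval → Pt d} (hγ : γ ∈ curveSpace d ℓ) {s t : ℝ} (hs : 0 ≤ s) (hst : s ≤ t)
    (ht : t ≤ 1) (hd : frechetDist (P.subcurve s t) γ ≤ ENNReal.ofReal Δ) :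
    ∃ s' t', 0 ≤ s' ∧ s' ≤ t' ∧ t' ≤ 1 ∧ S.subcurveComplexity s' t' ≤ ℓ + 2 ∧
      HasMonotonePath (curveSpaceFree P S (2 * Δ)) (s, s') (t, t') ∧
      ∀ x ∈ cov P {γ} Δ, Covers (curveSpaceFree P S (4 * Δ)) s' t' x := by
  obtain ⟨s', t', hs', hst', ht', hd', hc⟩ :=
    hS.2 γ hγ s t hs hst ht (by rwa [frechetDist_comm])
  refine ⟨s', t', hs', hst', ht', hc,
    (frechetDist_subcurve_le_iff (by linarith) hs hst ht hs' hst' ht').1 hd', ?_⟩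
  rintro x ⟨η, hη, a, b, ha, hab, hb, hdx, hx⟩
  obtain rfl : γ = η := hη.symm
  refine ⟨a, b, hx.1, hx.2,
    (frechetDist_subcurve_le_iff (by linarith) ha hab hb hs' hst' ht').1 ?_⟩
  calc frechetDist (P.subcurve a b) (S.subcurve s' t')
      ≤ frechetDist (P.subcurve a b) γ + (frechetDist γ (P.subcurve s t) +
          frechetDist (P.subcurve s t) (S.subcurve s' t')) :=
        (frechetDist_triangle _ _ _).trans (by gcongr; exact frechetDist_triangle _ _ _)
    _ ≤ ENNReal.ofReal Δ + (ENNReal.ofReal Δ + ENNReal.ofReal (2 * Δ)) := by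
        rw [frechetDist_comm γ]
        gcongr
    _ = ENNReal.ofReal (4 * Δ) := by
        rw [← ENNReal.ofReal_add hΔ (by linarith), ← ENNReal.ofReal_add hΔ (by linarith)]
        congr 1
        ring

theorem dist_le_of_path_point {r s t s' x : ℝ}
    (h : HasMonotonePath (curveSpaceFree P S r) (s, s') (t, s')) (hx : x ∈ Icc s t) :
    dist (P.eval x) (S.eval s') ≤ r := by
  obtain ⟨y, h1, h2⟩ := h.split_fst hx.1 hx.2
  obtain rfl : y = s' := le_antisymm h2.le.2 h1.le.2
  exact h1.right_mem.2.2

/-- What a curve of small complexity covers is covered by sixteen proxy coverages. -/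
theorem coveredBy_cov (hΔ : 0 < Δ) (hS : IsSimplification P S Δ ℓ)
    (hE : ∀ e, extremalHeights P (4 * Δ) (S.vertex e.castSucc) (S.vertex e.succ) ⊆ (E e : Set ℝ))
    {γ : unitInterval → Pt d} (hγ : γ ∈ curveSpace d ℓ) :
    CoveredBy P (4 * Δ) ℓ E 16 {x | x ∈ generic P S (4 * Δ) E ∧ x ∈ cov P {γ} Δ} := by
  have hr : 0 ≤ 4 * Δ := by linarith
  by_cases hne : ∃ s t, 0 ≤ s ∧ s ≤ t ∧ t ≤ 1 ∧
      frechetDist (P.subcurve s t) γ ≤ ENNReal.ofReal Δ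
  swap
  · refine coveredBy_empty.mono (Nat.zero_le _) ?_
    rintro x ⟨-, _, rfl, s, t, hs, hst, ht, hd, -⟩
    exact hne ⟨s, t, hs, hst, ht, hd⟩
  obtain ⟨s, t, hs, hst, ht, hd⟩ := hne
  obtain ⟨a, b, ha, hab, hb, hc, hpath, hcov⟩ := hS.exists_subcurve hΔ.le hγ hs hst ht hd
  rcases hab.lt_or_eq with hab | rfl
  · exact (coveredBy_subcurve hE hr ha hab hb hc).mono (by norm_num) fun x hx =>
      ⟨hx.1, hcov x hx.2⟩
  have h4 := coveredBy_subcurve_point (ℓ := ℓ) hE ⟨ha, hb⟩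
  -- The subcurve of `S` is a single point here. A covered `x₀` at distance 4Δ from it may be lost,
  -- so the construction is repeated with a piece that contains `x₀`.
  by_cases hlost : ∃ x ∈ cov P {γ} Δ, 4 * Δ ≤ dist (P.eval x) (S.eval a)
  swap
  · push Not at hlost
    exact h4.mono (by norm_num) fun x hx => ⟨hx.1, hcov x hx.2, hlost x hx.2⟩
  obtain ⟨x₀, ⟨_, rfl, s₀, t₀, hs₀, hst₀, ht₀, hd₀, hx₀⟩, hfar⟩ := hlost
  obtain ⟨a', b', ha', hab', hb', hc', hpath', hcov'⟩ :=
    hS.exists_subcurve hΔ.le hγ hs₀ hst₀ ht₀ hd₀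
  rcases hab'.lt_or_eq with hab' | rfl
  · exact (coveredBy_subcurve hE hr ha' hab' hb' hc').mono (by norm_num) fun x hx =>
      ⟨hx.1, hcov' x hx.2⟩
  refine (h4.union (coveredBy_subcurve_point (ℓ := ℓ) hE ⟨ha', hb'⟩)).mono (by norm_num) ?_
  rintro x ⟨hx, hxc⟩
  by_contra hnot
  have h1 : 4 * Δ ≤ dist (P.eval x) (S.eval a) :=
    not_lt.1 fun hlt => hnot (Or.inl ⟨hx, hcov x hxc, hlt⟩)
  have h2 : 4 * Δ ≤ dist (P.eval x) (S.eval a') :=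
    not_lt.1 fun hlt => hnot (Or.inr ⟨hx, hcov' x hxc, hlt⟩)
  obtain ⟨z, hxz, hz⟩ := exists_matched hΔ.le hγ hxc
  obtain ⟨w, hw, hzw⟩ := hz s t hs hst ht hd
  obtain ⟨w', hw', hzw'⟩ := hz s₀ t₀ hs₀ hst₀ ht₀ hd₀
  have e1 := dist_le_of_path_point hpath hw
  have e2 := dist_le_of_path_point hpath' hw'
  have e3 := dist_triangle z (P.eval w) (S.eval a)
  have e4 := dist_triangle z (P.eval w') (S.eval a')
  -- A point lost twice is within Δ of some `z` on the curve, and `z` is within Δ + 2Δ of both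
  -- points of `S`, which must then coincide. But `x₀` is within 2Δ of the second and at least 4Δ
  -- from the first.
  have heq : S.eval a = S.eval a' :=
    eq_of_dist_extremal hxz (by linarith) (by linarith) h1 h2
  have e5 := dist_le_of_path_point hpath' hx₀
  rw [heq] at hfar
  linarith

end

section
variable {P S : PolyCurve d} {r : ℝ} {ℓ : ℕ} {E : Fin S.numEdges → Finset ℝ}

/-! ### Breakpoints -/

theorem breakpoints_finite : (breakpoints P S r E).Finite := by
  have hsub : ∀ c : EReal, {x : ℝ | (x : EReal) = c}.Finite := fun c =>
    Set.Subsingleton.finite fun x hx y hy => EReal.coe_injective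
      ((show (x : EReal) = c from hx).trans (show (y : EReal) = c from hy).symm)
  refine (Set.toFinite {0, 1}).union ?_
  refine ((Set.finite_iUnion fun e : Fin S.numEdges => (E e).finite_toSet.biUnion fun y _ =>
    Set.finite_iUnion fun i : Fin P.numEdges =>
      (hsub (leftEnd P r (S.vertex e.castSucc) (S.vertex e.succ) i y)).union
        (hsub (rightEnd P r (S.vertex e.castSucc) (S.vertex e.succ) i y)))).subset ?_
  rintro x ⟨e, y, hy, i, h⟩
  simp only [mem_iUnion]
  exact ⟨e, y, hy, i, h⟩

theorem zero_mem_breakpoints : (0 : ℝ) ∈ breakpoints P S r E := Or.inl (Or.inl rfl)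

theorem one_mem_breakpoints : (1 : ℝ) ∈ breakpoints P S r E := Or.inl (Or.inr rfl)

theorem breakpoints_subset : breakpoints P S r E ⊆ Icc 0 1 := by
  rintro x ((rfl | rfl) | ⟨e, y, hy, i, h | h⟩)
  · exact ⟨le_rfl, zero_le_one⟩
  · exact ⟨zero_le_one, le_rfl⟩
  · obtain ⟨z, hz, hzl, -⟩ := exists_leftEnd_eq (row_nonempty_of_leftEnd_le h.ge)
    obtain rfl : x = z := EReal.coe_injective (h.trans hzl)
    exact hz.1.1
  · obtain ⟨z, hz, hzl, -⟩ := exists_rightEnd_eq (row_nonempty_of_rightEnd_le h.ge)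
    obtain rfl : x = z := EReal.coe_injective (h.trans hzl)
    exact hz.1.1

/-- A union of intervals between points of a finite set `B` that meets all intervals between
consecutive points of `B` is everything. -/
theorem Icc_subset_of_meets {B W : Set ℝ} (hB : B.Finite) (h0 : (0 : ℝ) ∈ B) (h1 : (1 : ℝ) ∈ B)
    (hW : ∀ x ∈ W, ∃ a ∈ B, ∃ b ∈ B, x ∈ Icc a b ∧ Icc a b ⊆ W)
    (hmeet : ∀ a ∈ B, ∀ b ∈ B, a < b → (∀ c ∈ B, ¬ (a < c ∧ c < b)) → ∃ x ∈ Ioo a b, x ∈ W) :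
    Icc 0 1 ⊆ W := by
  intro x hx
  have hmem : ∀ {y}, y ∈ hB.toFinset ↔ y ∈ B := hB.mem_toFinset
  obtain ⟨a, b, hab, hax, hxb⟩ : ∃ a b, Consecutive hB.toFinset a b ∧ a ≤ x ∧ x ≤ b := by
    by_cases hxB : x ∈ hB.toFinset
    · rcases hx.2.lt_or_eq with hlt | rfl
      · obtain ⟨b, hb⟩ := exists_consecutive_right hxB (hmem.2 h1) hlt
        exact ⟨x, b, hb, le_rfl, hb.lt.le⟩
      · obtain ⟨a, ha⟩ := exists_consecutive_left hxB (hmem.2 h0) one_pos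
        exact ⟨a, 1, ha, ha.lt.le, le_rfl⟩
    · obtain ⟨a, b, hab, h2, h3⟩ := exists_consecutive hxB (hmem.2 h0) (hmem.2 h1) hx.1 hx.2
      exact ⟨a, b, hab, h2.le, h3.le⟩
  obtain ⟨y, hy, hyW⟩ := hmeet a (hmem.1 hab.left_mem) b (hmem.1 hab.right_mem) hab.lt
    fun c hc h => (hab.le_or_le c (hmem.2 hc)).elim (not_le.2 h.1) (not_le.2 h.2)
  obtain ⟨a', ha', b', hb', hyab, hsub⟩ := hW y hyW
  refine hsub ⟨?_, ?_⟩
  · exact ((hab.le_or_le a' (hmem.2 ha')).resolve_right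
      (not_le.2 (hyab.1.trans_lt hy.2))).trans hax
  · exact hxb.trans ((hab.le_or_le b' (hmem.2 hb')).resolve_left
      (not_le.2 (hy.1.trans_le hyab.2)))

/-- An interval between breakpoints that meets the interior of an atomic interval contains all of
it, including its ends. -/
theorem proxies_meet (hE : ∀ e, extremalHeights P r (S.vertex e.castSucc) (S.vertex e.succ) ⊆
    (E e : Set ℝ)) (hr : 0 ≤ r) {R : List (Candidate S)} (hR : ∀ c ∈ R, IsCandidate ℓ E c)
    (hmeet : ∀ a ∈ breakpoints P S r E, ∀ b ∈ breakpoints P S r E, a < b →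
      (∀ c ∈ breakpoints P S r E, ¬ (a < c ∧ c < b)) → ∃ x ∈ Ioo a b, ∃ c ∈ R, x ∈ c.proxy P r) :
    ∀ x ∈ Icc (0 : ℝ) 1, ∃ c ∈ R, x ∈ c.proxy P r := by
  refine Icc_subset_of_meets (W := {x | ∃ c ∈ R, x ∈ c.proxy P r}) breakpoints_finite
    zero_mem_breakpoints one_mem_breakpoints ?_ hmeet
  rintro x ⟨c, hc, hx⟩
  obtain ⟨a, ha, b, hb, hxab, hsub⟩ := (hR c hc).exists_Icc_of_mem_proxy hE hr hx
  exact ⟨a, ha, b, hb, hxab, fun y hy => ⟨c, hc, hsub hy⟩⟩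

theorem exists_generic_mem_Ioo {a b : ℝ} (hab : a < b) : ∃ x ∈ Ioo a b, x ∈ generic P S r E := by
  have hfin : (range P.param ∪ breakpoints P S r E).Finite :=
    (Set.finite_range _).union breakpoints_finite
  obtain ⟨x, hx, hx'⟩ := ((Ioo_infinite hab).sdiff hfin).nonempty
  exact ⟨x, hx, fun h => hx' (Or.inl h), fun h => hx' (Or.inr h)⟩

end

section
variable {P S : PolyCurve d} {Δ : ℝ} {ℓ : ℕ} {E : Fin S.numEdges → Finset ℝ}

theorem coveredBy_finset {C : Finset (unitInterval → Pt d)} {n : ℕ} {X : Set ℝ} {r : ℝ}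
    (h : ∀ γ ∈ C, CoveredBy P r ℓ E n {x | x ∈ X ∧ x ∈ cov P {γ} Δ}) :
    CoveredBy P r ℓ E (n * C.card)
      {x | x ∈ X ∧ x ∈ cov P (C : Set (unitInterval → Pt d)) Δ} := by
  classical
  induction C using Finset.induction_on with
  | empty =>
    refine coveredBy_empty.mono (Nat.zero_le _) ?_
    rintro x ⟨-, γ, hγ, -⟩
    simp at hγ
  | insert γ C hγ ih =>
    have h1 := h γ (Finset.mem_insert_self _ _)
    have h2 := ih fun γ' hγ' => h γ' (Finset.mem_insert_of_mem hγ')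
    refine (h1.union h2).mono ?_ ?_
    · rw [Finset.card_insert_of_notMem hγ]
      exact (by ring : n + n * C.card = n * (C.card + 1)).le
    · rintro x ⟨hx, γ', hγ', h'⟩
      rw [Finset.mem_coe, Finset.mem_insert] at hγ'
      rcases hγ' with rfl | hγ'
      · exact Or.inl ⟨hx, γ', rfl, h'⟩
      · exact Or.inr ⟨hx, γ', hγ', h'⟩

/-- The proxy coverages of `16 k_Δ` candidates cover everything. -/
theorem coveredBy_coverNumber (hℓ : 2 ≤ ℓ) (hΔ : 0 < Δ) (hS : IsSimplification P S Δ ℓ)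
    (hE : ∀ e, extremalHeights P (4 * Δ) (S.vertex e.castSucc) (S.vertex e.succ) ⊆
      (E e : Set ℝ)) : CoveredBy P (4 * Δ) ℓ E (16 * coverNumber P ℓ Δ) (Icc 0 1) := by
  obtain ⟨C, hC, hcard, hcov⟩ := exists_cover P hℓ Δ
  obtain ⟨L, h1, h2, h3⟩ := coveredBy_finset (X := generic P S (4 * Δ) E) fun γ hγ =>
    coveredBy_cov hΔ hS hE (hC hγ)
  rw [hcard] at h1
  refine ⟨L, h1, h2, proxies_meet hE (by linarith) h2 fun a ha b hb hab _ => ?_⟩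
  -- Only generic points are known to be in a proxy coverage so far; one of them per atomic interval
  -- is enough.
  obtain ⟨x, hx, hgen⟩ := exists_generic_mem_Ioo (P := P) (S := S) (r := 4 * Δ) (E := E) hab
  refine ⟨x, hx, h3 x ⟨hgen, ?_⟩⟩
  rw [hcov]
  exact ⟨(breakpoints_subset ha).1.trans hx.1.le, hx.2.le.trans (breakpoints_subset hb).2⟩

end

/-! ### The greedy algorithm -/

/-- The right side is a sum of `g` reciprocals, each at least that of `a + g`. -/
theorem div_le_harmonic_sub (a g : ℕ) :
    (g : ℝ) / (a + g : ℕ) ≤ (harmonic (a + g) : ℝ) - harmonic a := by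
  induction g with
  | zero => simp
  | succ g ih =>
    have h1 : (harmonic (a + (g + 1)) : ℝ) = harmonic (a + g) + ((a + g + 1 : ℕ) : ℝ)⁻¹ := by
      rw [← add_assoc, harmonic_succ]
      push_cast
      ring
    have h2 : (g : ℝ) / ((a + g + 1 : ℕ) : ℝ) ≤ (g : ℝ) / (a + g : ℕ) := by
      rcases Nat.eq_zero_or_pos (a + g) with h | h
      · obtain rfl : g = 0 := by omega
        simp
      · have : (0 : ℝ) < (a + g : ℕ) := by exact_mod_cast h
        exact div_le_div_of_nonneg_left (Nat.cast_nonneg _) this (by exact_mod_cast Nat.le_succ _)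
    have h3 : ((g + 1 : ℕ) : ℝ) / ((a + (g + 1) : ℕ) : ℝ) =
        (g : ℝ) / ((a + g + 1 : ℕ) : ℝ) + ((a + g + 1 : ℕ) : ℝ)⁻¹ := by
      rw [← add_assoc a g 1]
      push_cast
      ring
    rw [h1, h3]
    linarith

section
variable {P S : PolyCurve d} {r : ℝ} {ℓ : ℕ} {E : Fin S.numEdges → Finset ℝ} {A : Finset ℝ}

theorem uncovered_finite (R : List (Candidate S)) : (uncovered P r A R).Finite :=
  A.finite_toSet.subset fun _ h => h.1

theorem uncovered_cons (c : Candidate S) (R : List (Candidate S)) :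
    uncovered P r A (c :: R) = uncovered P r A R \ c.proxy P r := by
  ext x
  simp only [uncovered, mem_ofPred_eq, List.mem_cons, forall_eq_or_imp, mem_sdiff]
  tauto

theorem GreedyRun.isCandidate {R : List (Candidate S)} (h : GreedyRun P r ℓ E A R) :
    ∀ c ∈ R, IsCandidate ℓ E c := by
  induction h with
  | start => simp
  | step _ _ hc _ ih =>
    intro c' hc'
    rcases List.mem_cons.1 hc' with rfl | h
    · exact hc
    · exact ih c' h

theorem ncard_le_mul {U : Set ℝ} (hU : U.Finite) (L : List (Candidate S)) (m : ℕ)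
    (hcov : ∀ x ∈ U, ∃ c ∈ L, x ∈ c.proxy P r)
    (hm : ∀ c ∈ L, (U ∩ c.proxy P r).ncard ≤ m) : U.ncard ≤ L.length * m := by
  induction L generalizing U with
  | nil =>
    obtain rfl : U = ∅ := eq_empty_of_forall_notMem fun x hx => by simpa using hcov x hx
    simp
  | cons c L ih =>
    have h1 := ih (U := U \ c.proxy P r) hU.sdiff (fun x hx => by
      obtain ⟨c', hc', hx'⟩ := hcov x hx.1
      rcases List.mem_cons.1 hc' with rfl | h
      · exact absurd hx' hx.2
      · exact ⟨c', h, hx'⟩) fun c' hc' => (Set.ncard_le_ncard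
        (inter_subset_inter_left _ sdiff_subset) (hU.inter_of_left _)).trans
        (hm c' (List.mem_cons_of_mem _ hc'))
    have h2 := hm c List.mem_cons_self
    have h3 := Set.ncard_inter_add_ncard_sdiff_eq_ncard U (c.proxy P r) hU
    rw [List.length_cons, add_mul, one_mul]
    omega

/-- The length of a greedy run, in terms of the size of a cover by candidates. -/
theorem GreedyRun.length_le {n : ℕ} (hcov : CoveredBy P r ℓ E n (A : Set ℝ))
    {R : List (Candidate S)} (h : GreedyRun P r ℓ E A R) :
    (R.length : ℝ) ≤ n * ((harmonic A.card : ℝ) - harmonic (uncovered P r A R).ncard) := by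
  obtain ⟨L, hL, hLc, hcov⟩ := hcov
  induction h with
  | start =>
    have : uncovered P r A ([] : List (Candidate S)) = A := by ext; simp [uncovered]
    rw [this, Set.ncard_coe_finset]
    simp
  | @step R c hR hne hc hmax ih =>
    have hfin := uncovered_finite (P := P) (r := r) (A := A) R
    have h1 := ncard_le_mul hfin L _ (fun x hx => hcov x hx.1) fun c' hc' => hmax c' (hLc c' hc')
    have h2 := Set.ncard_inter_add_ncard_sdiff_eq_ncard (uncovered P r A R) (c.proxy P r) hfin
    rw [← uncovered_cons] at h2
    have hpos : 0 < (uncovered P r A R).ncard := (Set.ncard_pos hfin).2 hne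
    set u := (uncovered P r A R).ncard
    set g := (uncovered P r A R ∩ c.proxy P r).ncard
    set u' := (uncovered P r A (c :: R)).ncard
    have h3 := div_le_harmonic_sub u' g
    rw [add_comm u' g, h2] at h3
    -- The `n` covering candidates gain at most `g` points each, so `u ≤ n * g`. The step is then
    -- paid for by the drop of the harmonic number from `u` to `u'`.
    have h4 : (1 : ℝ) ≤ n * ((g : ℝ) / u) := by
      rw [← mul_div_assoc, one_le_div (by exact_mod_cast hpos)]
      exact_mod_cast h1.trans (Nat.mul_le_mul_right g hL)
    have h5 := mul_le_mul_of_nonneg_left h3 (Nat.cast_nonneg (α := ℝ) n)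
    rw [List.length_cons]
    push_cast
    linarith

/-- Gains are natural numbers bounded by the number of uncovered points, so a maximum is attained;
the first edge of `S` shows that there are candidates at all. -/
theorem GreedyRun.exists_step (hℓ : 2 ≤ ℓ) {R : List (Candidate S)} (h : GreedyRun P r ℓ E A R)
    (hne : (uncovered P r A R).Nonempty) : ∃ c, GreedyRun P r ℓ E A (c :: R) := by
  let f : Candidate S → ℕ := fun c => (uncovered P r A R ∩ c.proxy P r).ncard
  have hbdd : BddAbove (f '' {c | IsCandidate ℓ E c}) := by
    refine ⟨(uncovered P r A R).ncard, ?_⟩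
    rintro _ ⟨c, -, rfl⟩
    exact Set.ncard_le_ncard inter_subset_left (uncovered_finite R)
  have hS := S.numEdges_pos
  have hcand : IsCandidate ℓ E (.vertices (⟨0, by omega⟩ : Fin (S.numEdges + 1)) ⟨1, by omega⟩) :=
    .typeI _ _ 0 (Nat.zero_le _) rfl hℓ
  obtain ⟨c, hc, hfc⟩ := Nat.sSup_mem ⟨_, mem_image_of_mem f hcand⟩ hbdd
  exact ⟨c, .step h hne hc fun c' hc' => (le_csSup hbdd (mem_image_of_mem f hc')).trans_eq hfc.symm⟩

end

end SubtrajectoryCover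

theorem mainTheorem7 (d ℓ : ℕ) (hℓ : 2 ≤ ℓ) (Δ : ℝ) (hΔ : 0 < Δ)
    (P S : SubtrajectoryCover.PolyCurve d)
    (hS : SubtrajectoryCover.IsSimplification P S Δ ℓ)
    (E : Fin S.numEdges → Finset ℝ)
    (hE01 : ∀ e, (E e : Set ℝ) ⊆ Set.Icc 0 1)
    (hE : ∀ e, SubtrajectoryCover.extremalHeights P (4 * Δ)
      (S.vertex e.castSucc) (S.vertex e.succ) ⊆ (E e : Set ℝ))
    (A : Finset ℝ) (hA : (A : Set ℝ) ⊆ Set.Icc 0 1) :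
    -- every run of the greedy algorithm makes at most `16 (ln |A| + 1) k_Δ` iterations
    (∀ R : List (SubtrajectoryCover.Candidate S),
      SubtrajectoryCover.GreedyRun P (4 * Δ) ℓ E A R →
        (R.length : ℝ) ≤
          16 * (Real.log (A.card : ℝ) + 1) * (SubtrajectoryCover.coverNumber P ℓ Δ : ℝ)) ∧
    -- it can always proceed while some point of `A` is uncovered
    (∀ R : List (SubtrajectoryCover.Candidate S),
      SubtrajectoryCover.GreedyRun P (4 * Δ) ℓ E A R →
        (SubtrajectoryCover.uncovered P (4 * Δ) A R).Nonempty →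
          ∃ c, SubtrajectoryCover.GreedyRun P (4 * Δ) ℓ E A (c :: R)) ∧
    -- the set of curves with which it stops
    (∀ R : List (SubtrajectoryCover.Candidate S),
      SubtrajectoryCover.GreedyRun P (4 * Δ) ℓ E A R →
        SubtrajectoryCover.uncovered P (4 * Δ) A R = ∅ →
          {γ | ∃ c ∈ R, γ = c.curve} ⊆ SubtrajectoryCover.curveSpace d ℓ ∧
          (A : Set ℝ) ⊆ SubtrajectoryCover.cov P {γ | ∃ c ∈ R, γ = c.curve} (4 * Δ) ∧
          (SubtrajectoryCover.atomicMidpoints P S (4 * Δ) E ⊆ (A : Set ℝ) →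
            SubtrajectoryCover.cov P {γ | ∃ c ∈ R, γ = c.curve} (4 * Δ) = Set.Icc 0 1)) := by
  have hr : 0 ≤ 4 * Δ := by linarith
  refine ⟨fun R hR => ?_, fun R hR hne => hR.exists_step hℓ hne, fun R hR hunc => ?_⟩
  · have h := hR.length_le
      ((SubtrajectoryCover.coveredBy_coverNumber hℓ hΔ hS hE).mono le_rfl hA)
    have h1 := harmonic_le_one_add_log A.card
    have h2 : (0 : ℝ) ≤ harmonic (SubtrajectoryCover.uncovered P (4 * Δ) A R).ncard := by
      unfold harmonic
      push_cast
      positivity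
    refine h.trans ?_
    calc _ ≤ ((16 * SubtrajectoryCover.coverNumber P ℓ Δ : ℕ) : ℝ) *
          (Real.log (A.card : ℝ) + 1) := by
          refine mul_le_mul_of_nonneg_left ?_ (Nat.cast_nonneg _)
          linarith
      _ = _ := by push_cast; ring
  · have hcov : ∀ x, (∃ c ∈ R, x ∈ c.proxy P (4 * Δ)) →
        x ∈ SubtrajectoryCover.cov P {γ | ∃ c ∈ R, γ = c.curve} (4 * Δ) := by
      rintro x ⟨c, hc, hx⟩
      refine SubtrajectoryCover.cov_mono (Set.singleton_subset_iff.2 ?_)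
        (c.proxy_subset_cov hr hx)
      exact ⟨c, hc, rfl⟩
    have hAcov : ∀ a ∈ A, ∃ c ∈ R, a ∈ c.proxy P (4 * Δ) := by
      intro a ha
      by_contra hnot
      push Not at hnot
      have hmem : a ∈ SubtrajectoryCover.uncovered P (4 * Δ) A R := ⟨ha, hnot⟩
      simp [hunc] at hmem
    refine ⟨?_, fun a ha => hcov a (hAcov a ha), fun hmid => ?_⟩
    · rintro _ ⟨c, hc, rfl⟩
      exact (hR.isCandidate c hc).curve_mem hℓ
    · refine SubtrajectoryCover.cov_subset_Icc.antisymm fun x hx => hcov x ?_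
      refine SubtrajectoryCover.proxies_meet hE hr hR.isCandidate (fun a ha b hb hab hno => ?_) x hx
      exact ⟨(a + b) / 2, ⟨by linarith, by linarith⟩,
        hAcov _ (Finset.mem_coe.1 (hmid ⟨a, ha, b, hb, hab, hno, rfl⟩))⟩
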